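/- Conventions. Fix a finite set of unitary gates containing (exactly) the Hadamard gate and CNOT, for instance the universal set {H, T, CNOT}. A generalized circuit is a sequence of gates on some wires; the wires that are not input wires start in $|0\rangle$, the wires that are not output wires are traced out. A uniform QPT algorithm is a sequence of generalized circuits whose descriptions are computed from $1^\lambda$ in time polynomial in $\lambda$; a non-uniform QPT adversary is a polynomial-size sequence of generalized circuits with arbitrary quantum advice states. Two families of states are computationally indistinguishable if every such adversary has negligible advantage, uniformly in its advice. An EFI pair is a pair of families of $n(\lambda)$-qubit states $\rho_{0,\lambda},\rho_{1,\lambda}$ such that (i) a uniform QPT algorithm outputs $\rho_{b,\lambda}$ on input $(1^\lambda,b)$, where $b$ is given on its input qubit; (ii) there is a polynomial $p$, positive on $\mathbb N$, with $\mathrm{TD}(\rho_{0,\lambda},\rho_{1,\lambda})\ge 1/p(\lambda)$ for all $\lambda$, where TD is the trace distance; (iii) the two families are computationally indistinguishable. $F(\rho,\sigma)=(\mathrm{Tr}\sqrt{\sqrt\rho\,\sigma\sqrt\rho})^2$ is the fidelity, $\Phi^\pm$ are the projectors on $(|00\rangle\pm|11\rangle)/\sqrt2$, and $\Phi=\Phi^+$.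 The one-shot distillable entanglement $E_D^\varepsilon(\rho_{AB})\in[0,\infty]$ is the supremum of the $m$ such that $F(\Gamma(\rho_{AB}),\Phi^{\otimes m})\ge1-\varepsilon$ for some LOCC map $\Gamma$. The one-shot entanglement cost $E_C^\varepsilon(\rho_{AB})$ is the infimum of the $m$ such that $F(\Gamma(\Phi^{\otimes m}),\rho_{AB})\ge1-\varepsilon$ for some LOCC map $\Gamma$. The computational entanglement cost satisfies $\hat E_C^\varepsilon(\{\rho^\lambda\})\le c$ if LOCC maps $\Gamma^\lambda$ given by circuits of total size polynomial in $\lambda$ satisfy $F(\Gamma^\lambda(\Phi^{\otimes c(\lambda)}),\rho^\lambda)\ge 1-\varepsilon(\lambda)$ for all $\lambda$. An entanglement measure is a functional $E$ with $E_D^\varepsilon\le E^\varepsilon\le E_C^\varepsilon$ on all bipartite states of qubits, for all sufficiently small $\varepsilon\ge0$. **Theorem.** Let $(\rho_{0,\lambda},\rho_{1,\lambda})$ be an EFI pair of $n(\lambda)$-qubit states. There is a polynomial $q$ with coefficients in $\mathbb N$ such that $$\mathrm{TD}\big(\rho_{0,\lambda}^{\otimes q(\lambda)},\rho_{1,\lambda}^{\otimes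 q(\lambda)}\big)\ge 1-2^{-\lambda}\quad\text{for all }\lambda\in\mathbb N.\qquad(*)$$ For every such polynomial $q$ satisfying $(*)$ put $\rho'_b=\rho_{b,\lambda}^{\otimes q(\lambda)}$ and $$\psi^\lambda=\tfrac14(\Phi^++\Phi^-)_{AB}\otimes(\rho'_0+\rho'_1)_A,\qquad \phi^\lambda=\tfrac12\big(\Phi^+_{AB}\otimes(\rho'_0)_A+\Phi^-_{AB}\otimes(\rho'_1)_A\big),$$ which are bipartite states with $q(\lambda)n(\lambda)+1$ qubits at $A$ and one qubit at $B$, polynomially many in total. With $\varepsilon(\lambda)=2^{-\lambda}$: 1. Every $\psi^\lambda$ is separable, $\hat E_C^{0}(\{\psi^\lambda\})=0$ and $E_C^0(\psi^\lambda)=0$; and $E^{\varepsilon(\lambda)}(\psi^\lambda)=0$ for every functional $E\ge0$ with $E^{\varepsilon(\lambda)}(\psi^\lambda)\le E_C^{\varepsilon(\lambda)}(\psi^\lambda)$. 2. $E_D^{\varepsilon(\lambda)}(\phi^\lambda)\ge1$ for all $\lambda$; and $E^{\varepsilon(\lambda)}(\phi^\lambda)\ge1$ for every functional $E$ with $E_D^{\varepsilon(\lambda)}(\phi^\lambda)\le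 E^{\varepsilon(\lambda)}(\phi^\lambda)$. 3. For every polynomially bounded $p:\mathbb N\to\mathbb N$, the families $\{(\psi^\lambda)^{\otimes p(\lambda)}\}_\lambda$ and $\{(\phi^\lambda)^{\otimes p(\lambda)}\}_\lambda$ are computationally indistinguishable. Consequently, $\psi$ is pseudo-entangled, with reference family $\phi$, in both of the following senses. - (Gap $0$ vs. $1$.) $\psi^\lambda$ is prepared exactly by a uniform QPT algorithm, $E^{\varepsilon(\lambda)}(\psi^\lambda)\in\Theta(0)$ and $E^{\varepsilon(\lambda)}(\phi^\lambda)\in\Theta(1)$ for every entanglement measure $E$, and 3 holds. - (Parameters $(\varepsilon,0,1)$.) $\hat E_C^\varepsilon(\{\psi^\lambda\})\le0$, $E_D^{\varepsilon(\lambda)}(\phi^\lambda)\ge1$ for all $\lambda$, and 3 holds. -/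

import Mathlib

open scoped Kronecker ComplexOrder ENNReal NNReal

noncomputable section

namespace QInfo

/-! ### States, distances -/

/-- Operators on the finite-dimensional Hilbert space with orthonormal basis indexed by `X`. -/
abbrev Op (X : Type) : Type := Matrix X X ℂ

/-- Computational basis labels of an `n`-qubit register. -/
abbrev Bits (n : ℕ) : Type := Fin n → Bool

/-- Density operators: positive semidefinite with trace one. -/
def IsDensity {X : Type} [Fintype X] (ρ : Op X) : Prop :=
  ρ.PosSemidef ∧ ρ.trace = 1

/-- Square root of a positive semidefinite operator. -/
def opSqrt {X : Type} [Fintype X] [DecidableEq X] (M : Op X) : Op X :=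
  cfc Real.sqrt M

/-- `‖M‖₁ = Tr √(M† M)`. -/
def traceNorm {X : Type} [Fintype X] [DecidableEq X] (M : Op X) : ℝ :=
  (opSqrt (M.conjTranspose * M)).trace.re

/-- Trace distance `½ ‖ρ - σ‖₁`. -/
def traceDist {X : Type} [Fintype X] [DecidableEq X] (ρ σ : Op X) : ℝ :=
  traceNorm (ρ - σ) / 2

/-- (Squared) fidelity `(Tr √(√ρ σ √ρ))²`. -/
def fidelity {X : Type} [Fintype X] [DecidableEq X] (ρ σ : Op X) : ℝ :=
  ((opSqrt (opSqrt ρ * σ * opSqrt ρ)).trace.re) ^ 2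

/-- The projector `|s⟩⟨s|` on a computational basis state. -/
def basisState {ι : Type} [Fintype ι] (s : ι → Bool) : Op (ι → Bool) :=
  Matrix.of fun x y => if x = s ∧ y = s then 1 else 0

/-- Tensor product of the states of two disjoint registers of qubits. -/
def tensor {ι κ : Type} (ρ : Op (ι → Bool)) (σ : Op (κ → Bool)) : Op (ι ⊕ κ → Bool) :=
  Matrix.of fun x y =>
    ρ (fun i => x (Sum.inl i)) (fun i => y (Sum.inl i)) *
      σ (fun k => x (Sum.inr k)) (fun k => y (Sum.inr k))

/-- `q` copies `ρ^{⊗ q}` of an `n`-qubit state; copy `i` sits on the `i`-th block of `n` qubits. -/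
def tensorPow {n : ℕ} (q : ℕ) (ρ : Op (Bits n)) : Op (Bits (q * n)) :=
  Matrix.of fun x y =>
    ∏ i : Fin q, ρ (fun j => x (finProdFinEquiv (i, j))) (fun j => y (finProdFinEquiv (i, j)))

/-- A bipartite state on `a + b` qubits, seen as a state of one register: first the qubits of
party `A`, then those of party `B`. -/
def joint {a b : ℕ} (ρ : Op (Bits a × Bits b)) : Op (Bits (a + b)) :=
  Matrix.of fun x y =>
    ρ (fun i => x (Fin.castAdd b i), fun j => x (Fin.natAdd a j))
      (fun i => y (Fin.castAdd b i), fun j => y (Fin.natAdd a j))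

/-! ### Asymptotics -/

/-- Polynomially bounded functions. -/
def PolyBounded (f : ℕ → ℕ) : Prop :=
  ∃ p : Polynomial ℕ, ∀ l, f l ≤ p.eval l

/-- Negligible functions. -/
def Negligible (μ : ℕ → ℝ) : Prop :=
  ∀ p : Polynomial ℝ, (∀ l : ℕ, 0 < p.eval (l : ℝ)) →
    ∃ N : ℕ, ∀ l : ℕ, N < l → |μ l| < 1 / p.eval (l : ℝ)

/-- `u ∈ Θ(f)` for functions with values in `[0, ∞]`. -/
def IsThetaOf (u : ℕ → ℝ≥0∞) (f : ℕ → ℝ≥0) : Prop :=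
  ∃ c C : ℝ≥0, 0 < c ∧ ∃ N : ℕ, ∀ l : ℕ, N ≤ l →
    (c : ℝ≥0∞) * f l ≤ u l ∧ u l ≤ (C : ℝ≥0∞) * f l

/-! ### Generalized quantum circuits -/

/-- A finite (discrete) set of unitary gates. -/
structure GateSet where
  card : ℕ
  arity : Fin card → ℕ
  mat : ∀ g, Op (Bits (arity g))
  unitary : ∀ g, mat g ∈ Matrix.unitaryGroup (Bits (arity g)) ℂ

/-- The gate set contains the `k`-qubit gate `U` (up to the order in which its qubits are listed). -/
def GateSet.Contains (𝒢 : GateSet) {k : ℕ} (U : Op (Bits k)) : Prop :=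
  ∃ (g : Fin 𝒢.card) (e : Fin k ≃ Fin (𝒢.arity g)),
    ∀ x y, 𝒢.mat g x y = U (fun i => x (e i)) (fun i => y (e i))

/-- The Hadamard gate. -/
def hadamard : Op (Bits 1) :=
  Matrix.of fun x y => (if x 0 = true ∧ y 0 = true then -1 else 1) / (Real.sqrt 2 : ℂ)

/-- The controlled-NOT gate, with control qubit `0` and target qubit `1`. -/
def cnot : Op (Bits 2) :=
  Matrix.of fun x y => if x 0 = y 0 ∧ x 1 = xor (y 0) (y 1) then 1 else 0

/-- A gate together with the distinct wires (out of `w`) on which it acts. -/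
structure Gate (𝒢 : GateSet) (w : ℕ) where
  kind : Fin 𝒢.card
  wires : Fin (𝒢.arity kind) ↪ Fin w

/-- A generalized circuit: a sequence of gates on `wires` qubits. The wires outside the range of
`inp` are initialized to zero, the wires outside the range of `out` are traced out at the end. -/
structure Circuit (𝒢 : GateSet) (ι o : Type) where
  wires : ℕ
  inp : ι ↪ Fin wires
  out : o ↪ Fin wires
  gates : List (Gate 𝒢 wires)

/-- Number of gates plus number of qubits. -/
def Circuit.size {𝒢 : GateSet} {ι o : Type} (C : Circuit 𝒢 ι o) : ℕ :=
  C.gates.length + C.wires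

/-- The unitary `U` acting on the wires `e`, tensored with the identity on all other wires. -/
def onWires {k w : ℕ} (U : Op (Bits k)) (e : Fin k ↪ Fin w) : Op (Bits w) :=
  Matrix.of fun x y =>
    if ∀ j, (∀ i, e i ≠ j) → x j = y j then U (fun i => x (e i)) (fun i => y (e i)) else 0

/-- The unitary of a gate acting on its wires. -/
def Gate.unitary {𝒢 : GateSet} {w : ℕ} (g : Gate 𝒢 w) : Op (Bits w) :=
  onWires (𝒢.mat g.kind) g.wires

/-- Place the input state on the input wires, and `|0⟩` on all the others. -/
def initialize0 {ι : Type} [Fintype ι] {w : ℕ} (e : ι ↪ Fin w) (ρ : Op (ι → Bool)) : Op (Bits w) :=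
  Matrix.of fun x y =>
    if ∀ j, (∀ i, e i ≠ j) → x j = false ∧ y j = false then
      ρ (fun i => x (e i)) (fun i => y (e i)) else 0

/-- Partial trace over all the wires outside the range of `e`. -/
def traceOut {o : Type} [Fintype o] {w : ℕ} (e : o ↪ Fin w) (M : Op (Bits w)) : Op (o → Bool) :=
  Matrix.of fun x y => ∑ z : Bits w, ∑ z' : Bits w,
    if (∀ i, z (e i) = x i) ∧ (∀ i, z' (e i) = y i) ∧ (∀ j, (∀ i, e i ≠ j) → z j = z' j) then
      M z z' else 0

/-- The quantum channel computed by a generalized circuit. -/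
def Circuit.apply {𝒢 : GateSet} {ι o : Type} [Fintype ι] [Fintype o] (C : Circuit 𝒢 ι o)
    (ρ : Op (ι → Bool)) : Op (o → Bool) :=
  traceOut C.out
    (C.gates.foldl (fun M g => g.unitary * M * g.unitary.conjTranspose) (initialize0 C.inp ρ))

/-! ### Classical polynomial time, uniform circuit families

The classical machine model: structured programs acting on stacks of symbols. A program mentions
only finitely many stacks and finitely many symbols, so this is a multi-stack (equivalently,
multi-tape) Turing machine with structured control flow; each elementary operation costs one step.
-/

inductive Prog : Type
  | skip : Prog
  /-- push the symbol `a` on stack `r` -/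
  | push (r a : ℕ) : Prog
  /-- remove the top symbol of stack `r` (if any) -/
  | pop (r : ℕ) : Prog
  | seq (p q : Prog) : Prog
  /-- if the top symbol of stack `r` is `a` then `p` else `q` -/
  | ifTop (r a : ℕ) (p q : Prog) : Prog
  /-- while stack `r` is nonempty do `p` -/
  | whileNonempty (r : ℕ) (p : Prog) : Prog

/-- Contents of the stacks, top symbol first. -/
abbrev Store : Type := ℕ → List ℕ

/-- `Exec p s s' t`: started in `s`, the program `p` halts in `s'` after `t` steps. -/
inductive Exec : Prog → Store → Store → ℕ → Prop
  | skip (s : Store) : Exec Prog.skip s s 0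
  | push (r a : ℕ) (s : Store) : Exec (Prog.push r a) s (Function.update s r (a :: s r)) 1
  | pop (r : ℕ) (s : Store) : Exec (Prog.pop r) s (Function.update s r (s r).tail) 1
  | seq {p q : Prog} {s s' s'' : Store} {t t' : ℕ} :
      Exec p s s' t → Exec q s' s'' t' → Exec (Prog.seq p q) s s'' (t + t')
  | ifTop_pos {r a : ℕ} {p q : Prog} {s s' : Store} {t : ℕ} :
      (s r).head? = some a → Exec p s s' t → Exec (Prog.ifTop r a p q) s s' (t + 1)
  | ifTop_neg {r a : ℕ} {p q : Prog} {s s' : Store} {t : ℕ} :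
      (s r).head? ≠ some a → Exec q s s' t → Exec (Prog.ifTop r a p q) s s' (t + 1)
  | while_done {r : ℕ} {p : Prog} {s : Store} :
      s r = [] → Exec (Prog.whileNonempty r p) s s 1
  | while_step {r : ℕ} {p : Prog} {s s' s'' : Store} {t t' : ℕ} :
      s r ≠ [] → Exec p s s' t → Exec (Prog.whileNonempty r p) s' s'' t' →
        Exec (Prog.whileNonempty r p) s s'' (t + t' + 1)

/-- Description of a list of wires, over the alphabet `0` (tick), `1` (start of a wire): wire
number `j` is written as `1` followed by `j` ticks. -/
def codeWires {k w : ℕ} (e : Fin k ↪ Fin w) : List ℕ :=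
  (List.ofFn fun i => 1 :: List.replicate (e i : ℕ) 0).flatten

/-- Description of a gate: the symbol `3 + g` for its kind `g`, then its wires. -/
def Gate.code {𝒢 : GateSet} {w : ℕ} (g : Gate 𝒢 w) : List ℕ :=
  (3 + (g.kind : ℕ)) :: codeWires g.wires

/-- Description of a circuit: the number of wires in unary, the list of input wires, the list of
output wires and the list of gates, separated by the symbol `2`. -/
def Circuit.code {𝒢 : GateSet} {i o : ℕ} (C : Circuit 𝒢 (Fin i) (Fin o)) : List ℕ :=
  List.replicate C.wires 0 ++ 2 :: (codeWires C.inp ++ 2 :: (codeWires C.out ++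
    2 :: (C.gates.map Gate.code).flatten))

/-- A uniform QPT algorithm: a sequence of generalized circuits whose descriptions are computed by
one classical program that on input `1^l` (on stack `0`) writes the description of the `l`-th
circuit (on stack `1`) in a number of steps polynomial in `l`. In particular the circuits have
polynomial size. -/
def UniformQPT {𝒢 : GateSet} {i o : ℕ → ℕ} (C : ∀ l, Circuit 𝒢 (Fin (i l)) (Fin (o l))) : Prop :=
  ∃ (P : Prog) (T : Polynomial ℕ), ∀ l : ℕ, ∃ (s : Store) (t : ℕ),
    Exec P (fun r => if r = 0 then List.replicate l 0 else []) s t ∧ t ≤ T.eval l ∧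
      s 1 = (C l).code

/-! ### Computational indistinguishability -/

/-- Probability that the distinguisher `D` outputs `1` on the state `ρ` and the advice `α`. -/
def prOne {𝒢 : GateSet} {N a : ℕ} (D : Circuit 𝒢 (Fin N ⊕ Fin a) (Fin 1)) (ρ : Op (Bits N))
    (α : Op (Bits a)) : ℝ :=
  (D.apply (tensor ρ α) (fun _ => true) (fun _ => true)).re

/-- Computational indistinguishability against non-uniform QPT algorithms: circuits of polynomial
size with quantum advice. -/
def CompIndist (𝒢 : GateSet) {N : ℕ → ℕ} (ρ σ : ∀ l, Op (Bits (N l))) : Prop :=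
  ∀ (a : ℕ → ℕ) (D : ∀ l, Circuit 𝒢 (Fin (N l) ⊕ Fin (a l)) (Fin 1)),
    PolyBounded (fun l => (D l).size) →
      ∃ ε : ℕ → ℝ, (∀ l, 0 ≤ ε l) ∧ Negligible ε ∧
        ∀ (l : ℕ) (α : Op (Bits (a l))), IsDensity α →
          |prOne (D l) (ρ l) α - prOne (D l) (σ l) α| ≤ ε l

/-- EFI pairs: efficiently generated by a uniform QPT algorithm (which receives the bit `b` on its
input qubit), statistically far, computationally indistinguishable. -/
structure IsEFI (𝒢 : GateSet) {n : ℕ → ℕ} (ρ₀ ρ₁ : ∀ l, Op (Bits (n l))) : Prop where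
  density : ∀ l, IsDensity (ρ₀ l) ∧ IsDensity (ρ₁ l)
  generated : ∃ A : ∀ l, Circuit 𝒢 (Fin 1) (Fin (n l)), UniformQPT A ∧
    ∀ l, (A l).apply (basisState fun _ => false) = ρ₀ l ∧
      (A l).apply (basisState fun _ => true) = ρ₁ l
  far : ∃ p : Polynomial ℝ, ∀ l : ℕ,
    0 < p.eval (l : ℝ) ∧ 1 / p.eval (l : ℝ) ≤ traceDist (ρ₀ l) (ρ₁ l)
  indist : CompIndist 𝒢 ρ₀ ρ₁

/-! ### LOCC -/

/-- `LOCC A' B' A B Γ`: the map `Γ` from operators on `A ⊗ B` to operators on `A' ⊗ B'` is a finite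
LOCC protocol. In every step one party applies a quantum instrument, given by Kraus operators
`K x j`, with public classical outcome `x`, and all later steps may depend on `x`. -/
inductive LOCC (A' B' : Type) [Fintype A'] [DecidableEq A'] [Fintype B'] [DecidableEq B'] :
    (A B : Type) → [Fintype A] → [DecidableEq A] → [Fintype B] → [DecidableEq B] →
      (Op (A × B) → Op (A' × B')) → Prop
  | done : LOCC A' B' A' B' (fun ρ => ρ)
  | alice {A B A₁ X J : Type} [Fintype A] [DecidableEq A] [Fintype B] [DecidableEq B]
      [Fintype A₁] [DecidableEq A₁] [Fintype X] [Fintype J]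
      (K : X → J → Matrix A₁ A ℂ) (hK : ∑ x, ∑ j, (K x j).conjTranspose * K x j = 1)
      (Γ : X → Op (A₁ × B) → Op (A' × B')) (hΓ : ∀ x, LOCC A' B' A₁ B (Γ x)) :
      LOCC A' B' A B (fun ρ => ∑ x, Γ x (∑ j,
        (K x j ⊗ₖ (1 : Matrix B B ℂ)) * ρ * (K x j ⊗ₖ (1 : Matrix B B ℂ)).conjTranspose))
  | bob {A B B₁ X J : Type} [Fintype A] [DecidableEq A] [Fintype B] [DecidableEq B]
      [Fintype B₁] [DecidableEq B₁] [Fintype X] [Fintype J]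
      (K : X → J → Matrix B₁ B ℂ) (hK : ∑ x, ∑ j, (K x j).conjTranspose * K x j = 1)
      (Γ : X → Op (A × B₁) → Op (A' × B')) (hΓ : ∀ x, LOCC A' B' A B₁ (Γ x)) :
      LOCC A' B' A B (fun ρ => ∑ x, Γ x (∑ j,
        ((1 : Matrix A A ℂ) ⊗ₖ K x j) * ρ * ((1 : Matrix A A ℂ) ⊗ₖ K x j).conjTranspose))

/-- LOCC protocols carried out by generalized circuits. The parties hold `a` and `b` qubits and
share a classical register of `c` bits; in every step one party applies a circuit to its qubits and
the classical register, the new classical register being measured and made public. -/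
inductive CircuitLOCC (𝒢 : GateSet) (a' b' : ℕ) : ℕ → ℕ → ℕ → Type
  | done {c : ℕ} : CircuitLOCC 𝒢 a' b' a' b' c
  | alice {a b c a₁ c₁ : ℕ} (C : Circuit 𝒢 (Fin a ⊕ Fin c) (Fin a₁ ⊕ Fin c₁))
      (rest : CircuitLOCC 𝒢 a' b' a₁ b c₁) : CircuitLOCC 𝒢 a' b' a b c
  | bob {a b c b₁ c₁ : ℕ} (C : Circuit 𝒢 (Fin b ⊕ Fin c) (Fin b₁ ⊕ Fin c₁))
      (rest : CircuitLOCC 𝒢 a' b' a b₁ c₁) : CircuitLOCC 𝒢 a' b' a b c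

/-- Total size of the circuits of a protocol. -/
def CircuitLOCC.size {𝒢 : GateSet} {a' b' : ℕ} :
    {a b c : ℕ} → CircuitLOCC 𝒢 a' b' a b c → ℕ
  | _, _, _, .done => 0
  | _, _, _, .alice C rest => C.size + rest.size
  | _, _, _, .bob C rest => C.size + rest.size

/-- Apply `C` to `M` and the classical value `s`; the unnormalized state of the quantum output when
the classical output is measured to be `s'`. -/
def Circuit.instrument {𝒢 : GateSet} {a c a₁ c₁ : ℕ}
    (C : Circuit 𝒢 (Fin a ⊕ Fin c) (Fin a₁ ⊕ Fin c₁)) (s : Bits c) (s' : Bits c₁)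
    (M : Op (Bits a)) : Op (Bits a₁) :=
  Matrix.of fun x y => C.apply (tensor M (basisState s)) (Sum.elim x s') (Sum.elim y s')

/-- `Φ ⊗ id`, for a linear map `Φ` on operators of the first system. -/
def localA {A A₁ B : Type} (Φ : Op A → Op A₁) (ρ : Op (A × B)) : Op (A₁ × B) :=
  Matrix.of fun x y => Φ (Matrix.of fun u v => ρ (u, x.2) (v, y.2)) x.1 y.1

/-- `id ⊗ Φ`, for a linear map `Φ` on operators of the second system. -/
def localB {A B B₁ : Type} (Φ : Op B → Op B₁) (ρ : Op (A × B)) : Op (A × B₁) :=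
  Matrix.of fun x y => Φ (Matrix.of fun u v => ρ (x.1, u) (y.1, v)) x.2 y.2

/-- The map computed by a protocol. The argument `σ s` is the unnormalized state of the qubits when
the classical register holds `s`; at the end the classical register is discarded. -/
def CircuitLOCC.eval {𝒢 : GateSet} {a' b' : ℕ} :
    {a b c : ℕ} → CircuitLOCC 𝒢 a' b' a b c → (Bits c → Op (Bits a × Bits b)) →
      Op (Bits a' × Bits b')
  | _, _, _, .done, σ => ∑ s, σ s
  | _, _, _, .alice C rest, σ =>
      rest.eval fun s' => ∑ s, localA (C.instrument s s') (σ s)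
  | _, _, _, .bob C rest, σ =>
      rest.eval fun s' => ∑ s, localB (C.instrument s s') (σ s)

/-! ### Entanglement -/

/-- The EPR pair `|Φ⁺⟩⟨Φ⁺|`, with `|Φ⁺⟩ = (|00⟩ + |11⟩)/√2`. -/
def phiPlus : Op (Bool × Bool) :=
  Matrix.of fun x y => if x.1 = x.2 ∧ y.1 = y.2 then 1 / 2 else 0

/-- The state `|Φ⁻⟩⟨Φ⁻|`, with `|Φ⁻⟩ = (|00⟩ - |11⟩)/√2`. -/
def phiMinus : Op (Bool × Bool) :=
  Matrix.of fun x y =>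
    if x.1 = x.2 ∧ y.1 = y.2 then (if x.1 = y.1 then 1 / 2 else -(1 / 2)) else 0

/-- `m` EPR pairs shared between `A` and `B`. -/
def eprPairs (m : ℕ) : Op (Bits m × Bits m) :=
  Matrix.of fun x y => ∏ i, phiPlus (x.1 i, x.2 i) (y.1 i, y.2 i)

/-- Separable states: finite convex combinations of product states. -/
def IsSeparableState {A B : Type} [Fintype A] [Fintype B] (ρ : Op (A × B)) : Prop :=
  ∃ (k : ℕ) (w : Fin k → ℝ) (σ : Fin k → Op A) (τ : Fin k → Op B),
    (∀ i, 0 ≤ w i ∧ IsDensity (σ i) ∧ IsDensity (τ i)) ∧ ∑ i, w i = 1 ∧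
      ρ = ∑ i, (w i : ℂ) • (σ i ⊗ₖ τ i)

/-- One-shot distillable entanglement (possibly infinite, for instance for error `1`). -/
def distillable {A B : Type} [Fintype A] [DecidableEq A] [Fintype B] [DecidableEq B]
    (ε : ℝ) (ρ : Op (A × B)) : ℕ∞ :=
  sSup {e : ℕ∞ | ∃ (m : ℕ) (Γ : Op (A × B) → Op (Bits m × Bits m)),
    e = m ∧ LOCC (Bits m) (Bits m) A B Γ ∧ 1 - ε ≤ fidelity (Γ ρ) (eprPairs m)}

/-- One-shot entanglement cost. -/
def entCost {A B : Type} [Fintype A] [DecidableEq A] [Fintype B] [DecidableEq B]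
    (ε : ℝ) (ρ : Op (A × B)) : ℕ∞ :=
  sInf {e : ℕ∞ | ∃ (m : ℕ) (Γ : Op (Bits m × Bits m) → Op (A × B)),
    e = m ∧ LOCC A B (Bits m) (Bits m) Γ ∧ 1 - ε ≤ fidelity (Γ (eprPairs m)) ρ}

/-- The computational one-shot entanglement cost of the family `ρ` with error `ε` is at most `n`:
a family of LOCC maps given by circuits of polynomial total size turns `n l` EPR pairs into `ρ l`. -/
def CompCostLE (𝒢 : GateSet) {a b : ℕ → ℕ} (ε : ℕ → ℝ)
    (ρ : ∀ l, Op (Bits (a l) × Bits (b l))) (n : ℕ → ℕ) : Prop :=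
  ∃ Γ : ∀ l, CircuitLOCC 𝒢 (a l) (b l) (n l) (n l) 0,
    PolyBounded (fun l => (Γ l).size) ∧
      ∀ l, 1 - ε l ≤ fidelity ((Γ l).eval fun _ => eprPairs (n l)) (ρ l)

/-- A functional assigning a value in `[0, ∞]` to each error and bipartite state of qubits. -/
abbrev EntFunctional : Type :=
  ℝ → ∀ a b : ℕ, Op (Bits a × Bits b) → ℝ≥0∞

/-- Entanglement measures: functionals that lie between the one-shot distillable entanglement and
the one-shot entanglement cost, for all sufficiently small errors. (No functional does so for errors
close to `1`, where the former is infinite and the latter is zero.) -/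
def IsEntMeasure (E : EntFunctional) : Prop :=
  ∃ ε₀ : ℝ, 0 < ε₀ ∧ ∀ ε : ℝ, 0 ≤ ε → ε ≤ ε₀ → ∀ (a b : ℕ) (ρ : Op (Bits a × Bits b)),
    IsDensity ρ →
      ((distillable ε ρ : ℕ∞) : ℝ≥0∞) ≤ E ε a b ρ ∧ E ε a b ρ ≤ ((entCost ε ρ : ℕ∞) : ℝ≥0∞)

/-! ### Pseudo-entanglement -/

/-- Polynomially many copies of two families of bipartite states are computationally
indistinguishable. -/
def ManyCopyIndist (𝒢 : GateSet) {a b : ℕ → ℕ} (ψ φ : ∀ l, Op (Bits (a l) × Bits (b l))) : Prop :=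
  ∀ p : ℕ → ℕ, PolyBounded p →
    CompIndist 𝒢 (fun l => tensorPow (p l) (joint (ψ l))) (fun l => tensorPow (p l) (joint (φ l)))

/-- Pseudo-entangled state ensembles `ψ`, `φ` with gap `f` vs. `g`, for mixed states across a single
cut, with respect to the functional `E` and the error `ε`. -/
structure IsPseudoEntEnsemble (𝒢 : GateSet) (E : EntFunctional) (ε : ℕ → ℝ) (f g : ℕ → ℝ≥0)
    {a b : ℕ → ℕ} (ψ φ : ∀ l, Op (Bits (a l) × Bits (b l))) : Prop where
  density : ∀ l, IsDensity (ψ l) ∧ IsDensity (φ l)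
  poly : PolyBounded (fun l => a l + b l)
  preparable : ∃ C : ∀ l, Circuit 𝒢 (Fin 0) (Fin (a l + b l)), UniformQPT C ∧
    ∀ l, (C l).apply 1 = joint (ψ l)
  low : IsThetaOf (fun l => E (ε l) (a l) (b l) (ψ l)) f
  high : IsThetaOf (fun l => E (ε l) (a l) (b l) (φ l)) g
  indist : ManyCopyIndist 𝒢 ψ φ

/-- The family `ψ` has pseudo-entanglement `(ε, c, d)` (without efficient distillation), as
witnessed by the reference family `φ`. -/
structure IsPseudoEntWith (𝒢 : GateSet) (ε : ℕ → ℝ) (c d : ℕ → ℕ)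
    {a b : ℕ → ℕ} (ψ φ : ∀ l, Op (Bits (a l) × Bits (b l))) : Prop where
  error : ∀ l, 0 ≤ ε l ∧ ε l ≤ 1
  density : ∀ l, IsDensity (ψ l) ∧ IsDensity (φ l)
  poly : PolyBounded (fun l => a l + b l)
  cost : CompCostLE 𝒢 ε ψ c
  distill : ∀ l, (d l : ℕ∞) ≤ distillable (ε l) (φ l)
  indist : ManyCopyIndist 𝒢 ψ φ

/-! ### The construction -/

/-- The state `Φ_{AB} ⊗ ρ_A`: party `A` holds its half of `Φ` (qubit `0`) and the `N` qubits of `ρ`,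
party `B` holds the other half of `Φ`. -/
def attach {N : ℕ} (Φ : Op (Bool × Bool)) (ρ : Op (Bits N)) : Op (Bits (N + 1) × Bits 1) :=
  Matrix.of fun x y =>
    Φ (x.1 0, x.2 0) (y.1 0, y.2 0) * ρ (fun i => x.1 i.succ) (fun i => y.1 i.succ)

/-- `¼ (Φ⁺ + Φ⁻) ⊗ (ρ₀ + ρ₁)`. -/
def psiState {N : ℕ} (ρ₀ ρ₁ : Op (Bits N)) : Op (Bits (N + 1) × Bits 1) :=
  (1 / 4 : ℂ) • attach (phiPlus + phiMinus) (ρ₀ + ρ₁)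

/-- `½ (Φ⁺ ⊗ ρ₀ + Φ⁻ ⊗ ρ₁)`. -/
def phiState {N : ℕ} (ρ₀ ρ₁ : Op (Bits N)) : Op (Bits (N + 1) × Bits 1) :=
  (1 / 2 : ℂ) • (attach phiPlus ρ₀ + attach phiMinus ρ₁)

end QInfo

end

open QInfo
open scoped ENNReal NNReal

open scoped Kronecker ComplexOrder ENNReal NNReal

noncomputable section

namespace QInfo

open Matrix

/-! ### Square roots and fidelity -/

variable {X : Type} [Fintype X] [DecidableEq X]

/-! Both states are mixtures of Φ^s ⊗ ρ'_b, with a sign s and a bit b. In ψ the two are independent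
and uniform; in φ they are uniform and equal. All the entanglement of φ lies in the correlation of s
with b, and seeing this correlation amounts to telling ρ'_0 from ρ'_1.

Without the correlation, the random sign destroys all coherence: Φ⁺ + Φ⁻ = |00⟩⟨00| + |11⟩⟨11|. So ψ
is separable (`psiState_isSeparable`). It costs no EPR pair, even for efficient parties: A prepares
everything, measures the qubit meant for B and announces the bit (`compCostLE_psiState`). With the
correlation, an unbounded A applies the Helstrom measurement to find b, undoes the sign with a Pauli
Z and is left with Φ⁺ with probability (1 + TD(ρ'_0, ρ'_1))/2 (`one_le_distillable_phiState`).
Conversely one EPR pair suffices to create φ (`entCost_phiState_le`), so every entanglement measure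
of φ is squeezed to 1 once the error is small enough.

The trace distance is amplified by measuring every copy with the single-copy Helstrom test and
applying a maximum likelihood test to the outcomes. The Bhattacharyya coefficient of the outcome
distributions is multiplicative, hence exponentially small after polynomially many copies
(`traceDist_tensorPow_ge`, `exists_amplification`).

For bounded distinguishers, ψ - φ is a quarter of Φ⁺ ⊗ (ρ'_1 - ρ'_0) + Φ⁻ ⊗ (ρ'_0 - ρ'_1), and the
Bell pair can be part of the advice (`CompIndist.psiState_phiState`). The hybrid argument
`CompIndist.tensorPow` is used before this step, for the q copies inside ρ'_b, and after it, for the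
p copies of the result. Its polynomially many positions need a common negligible bound, which
`CompIndist.of_finite` supplies by choosing the best distinguisher for each security parameter.

Finally ψ has to be prepared uniformly. The circuit `prep` puts s and b in superposition on
ancillas, copies s to both halves of the pair and b to the input of q copies of the given circuit,
and traces out the originals (`prep_apply`). Its description is the given one with shifted copies of
its sections and a few constant words, so an explicit stack program writes it in polynomial time
(`UniformQPT.prep`). -/

theorem cfc_posSemidef {M : Op X} (hM : M.IsHermitian) {f : ℝ → ℝ}
    (hf : ∀ x ∈ spectrum ℝ M, 0 ≤ f x) : (cfc f M).PosSemidef := by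
  rw [hM.cfc_eq, Matrix.IsHermitian.cfc, Unitary.conjStarAlgAut_apply]
  refine Matrix.PosSemidef.mul_mul_conjTranspose_same
    (Matrix.PosSemidef.diagonal fun i => ?_) _
  simpa using hf _ (hM.eigenvalues_mem_spectrum_real i)

/-- The spectrum is finite, so continuity is no restriction. This admits discontinuous functions in
the functional calculus, such as the indicator of the positive reals in `exists_helstrom`. -/
theorem cfc_continuousOn_spectrum (M : Op X) (f : ℝ → ℝ) : ContinuousOn f (spectrum ℝ M) :=
  (Matrix.finite_real_spectrum (A := M)).continuousOn f

theorem opSqrt_posSemidef {M : Op X} (hM : M.PosSemidef) : (opSqrt M).PosSemidef :=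
  cfc_posSemidef hM.1 fun _ _ => Real.sqrt_nonneg _

theorem spectrum_nonneg_of_posSemidef {M : Op X} (hM : M.PosSemidef) {x : ℝ}
    (hx : x ∈ spectrum ℝ M) : 0 ≤ x := by
  rw [hM.1.spectrum_real_eq_range_eigenvalues] at hx
  obtain ⟨i, rfl⟩ := hx
  exact hM.eigenvalues_nonneg i

theorem opSqrt_mul_self {M : Op X} (hM : M.PosSemidef) : opSqrt M * opSqrt M = M := by
  have hs : IsSelfAdjoint M := hM.1
  unfold opSqrt
  rw [← cfc_mul _ _ M (cfc_continuousOn_spectrum _ _) (cfc_continuousOn_spectrum _ _)]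
  conv_rhs => rw [← cfc_id ℝ M]
  exact cfc_congr fun x hx => Real.mul_self_sqrt (spectrum_nonneg_of_posSemidef hM hx)

theorem opSqrt_mul_self_hermitian {M : Op X} (hM : M.IsHermitian) :
    opSqrt (M * M) = cfc (fun x : ℝ => |x|) M := by
  have hs : IsSelfAdjoint M := hM
  have h : M * M = cfc (fun x : ℝ => x * x) M := by
    rw [cfc_mul _ _ M (cfc_continuousOn_spectrum _ _) (cfc_continuousOn_spectrum _ _), cfc_id' ℝ M]
  unfold opSqrt
  rw [h, ← cfc_comp' Real.sqrt (fun x : ℝ => x * x) M Real.continuous_sqrt.continuousOn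
    (cfc_continuousOn_spectrum _ _)]
  exact cfc_congr fun x _ => Real.sqrt_mul_self_eq_abs x

theorem opSqrt_of_mul_self {B : Op X} (hB : B.PosSemidef) : opSqrt (B * B) = B := by
  have hs : IsSelfAdjoint B := hB.1
  rw [opSqrt_mul_self_hermitian hB.1]
  conv_rhs => rw [← cfc_id ℝ B]
  exact cfc_congr fun x hx => abs_of_nonneg (spectrum_nonneg_of_posSemidef hB hx)

theorem fidelity_self {ρ : Op X} (hρ : IsDensity ρ) : fidelity ρ ρ = 1 := by
  have h : opSqrt ρ * ρ * opSqrt ρ = ρ * ρ := by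
    conv_lhs => enter [1, 2]; rw [← opSqrt_mul_self hρ.1]
    rw [← Matrix.mul_assoc, opSqrt_mul_self hρ.1, Matrix.mul_assoc, opSqrt_mul_self hρ.1]
  rw [fidelity, h, opSqrt_of_mul_self hρ.1, hρ.2]
  simp

/-- The square of |w⟩⟨w| is ‖w‖² |w⟩⟨w|, so for w ≠ 0 the root of |w⟩⟨w| is |w⟩⟨w| / ‖w‖, of trace
‖w‖. The zero vector is treated apart because of the division. -/
theorem opSqrt_vecMulVec (w : X → ℂ) :
    (opSqrt (vecMulVec w (star w))).trace.re ^ 2 = (star w ⬝ᵥ w).re := by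
  have hnn : 0 ≤ star w ⬝ᵥ w := dotProduct_star_self_nonneg w
  obtain ⟨hre, him⟩ := Complex.le_def.1 hnn
  set r : ℝ := (star w ⬝ᵥ w).re with hr
  have hc : star w ⬝ᵥ w = (r : ℂ) := by
    apply Complex.ext
    · simp [hr]
    · simpa using him.symm
  have hw : vecMulVec w (star w) * vecMulVec w (star w) = (r : ℂ) • vecMulVec w (star w) := by
    rw [vecMulVec_mul_vecMulVec, hc]
    ext i j; simp [vecMulVec_apply]; ring
  have htr : (vecMulVec w (star w)).trace = (r : ℂ) := by
    rw [trace_vecMulVec, dotProduct_comm, hc]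
  have hpsd : (vecMulVec w (star w)).PosSemidef := posSemidef_vecMulVec_self_star w
  rcases eq_or_lt_of_le (show 0 ≤ r by simpa using hre) with h0 | h0
  · have : w = 0 := by
      rw [← dotProduct_star_self_eq_zero, hc, ← h0]; simp
    subst this
    have : opSqrt (vecMulVec (0 : X → ℂ) (star 0)) = 0 := by
      have h := opSqrt_of_mul_self (B := (0 : Op X)) Matrix.PosSemidef.zero
      simpa using h
    rw [this, ← h0]; simp
  · set s : ℝ := Real.sqrt r with hs
    have hs0 : 0 < s := Real.sqrt_pos.2 h0
    have hss : s * s = r := Real.mul_self_sqrt h0.le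
    have hB : (((s⁻¹ : ℝ) : ℂ) • vecMulVec w (star w)).PosSemidef :=
      hpsd.smul (by rw [Complex.zero_le_real]; positivity)
    have hBB : (((s⁻¹ : ℝ) : ℂ) • vecMulVec w (star w)) * (((s⁻¹ : ℝ) : ℂ) • vecMulVec w (star w)) =
        vecMulVec w (star w) := by
      rw [smul_mul_assoc, mul_smul_comm, hw, smul_smul, smul_smul]
      have : ((s⁻¹ : ℝ) : ℂ) * ((s⁻¹ : ℝ) : ℂ) * (r : ℂ) = 1 := by
        rw [← hss]; norm_cast; field_simp
      rw [this, one_smul]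
    have h := opSqrt_of_mul_self hB
    rw [hBB] at h
    rw [h, trace_smul, htr, smul_eq_mul, ← Complex.ofReal_mul, Complex.ofReal_re, ← hss]
    field_simp

/-- Fidelity with a pure state. -/
theorem fidelity_pure {ρ : Op X} (hρ : ρ.PosSemidef) (v : X → ℂ) :
    fidelity ρ (vecMulVec v (star v)) = (star v ⬝ᵥ (ρ *ᵥ v)).re := by
  have hh : (opSqrt ρ).conjTranspose = opSqrt ρ := (opSqrt_posSemidef hρ).1
  -- The operator under the outer root is again of rank one, with vector √ρ v, whose squared norm is
  -- ⟨v|ρ|v⟩.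
  have h : opSqrt ρ * vecMulVec v (star v) * opSqrt ρ =
      vecMulVec (opSqrt ρ *ᵥ v) (star (opSqrt ρ *ᵥ v)) := by
    rw [mul_vecMulVec, vecMulVec_mul, star_mulVec, hh]
  rw [fidelity, h, opSqrt_vecMulVec, star_mulVec, hh, ← dotProduct_mulVec, mulVec_mulVec,
    opSqrt_mul_self hρ]

/-! ### Trace norm -/

theorem traceNorm_hermitian {M : Op X} (hM : M.IsHermitian) :
    traceNorm M = (cfc (fun x : ℝ => |x|) M).trace.re := by
  rw [traceNorm, hM.eq, opSqrt_mul_self_hermitian hM]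

/-- By cyclicity the trace is that of √P E √P, which is positive semidefinite. -/
theorem trace_mul_nonneg {E P : Op X} (hE : E.PosSemidef) (hP : P.PosSemidef) :
    0 ≤ (E * P).trace := by
  have h : (E * P).trace = (opSqrt P * E * (opSqrt P).conjTranspose).trace := by
    have hh : (opSqrt P).conjTranspose = opSqrt P := (opSqrt_posSemidef hP).1
    rw [hh, Matrix.trace_mul_cycle, opSqrt_mul_self hP, Matrix.trace_mul_comm]
  rw [h]
  exact (hE.mul_mul_conjTranspose_same _).trace_nonneg

theorem trace_mul_re_nonneg {E P : Op X} (hE : E.PosSemidef) (hP : P.PosSemidef) :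
    0 ≤ (E * P).trace.re :=
  (Complex.le_def.1 (trace_mul_nonneg hE hP)).1

theorem trace_mul_eq_ofReal {E P : Op X} (hE : E.PosSemidef) (hP : P.PosSemidef) :
    (E * P).trace = ((E * P).trace.re : ℂ) :=
  Complex.eq_re_of_ofReal_le (r := 0) (by simpa using trace_mul_nonneg hE hP)

/-- Holevo-Helstrom, upper bound: no effect distinguishes better than the trace norm allows. -/
theorem trace_effect_mul_le {M E : Op X} (hM : M.IsHermitian) (ht : M.trace = 0)
    (hE : E.PosSemidef) (hE' : (1 - E).PosSemidef) : (E * M).trace.re ≤ traceNorm M / 2 := by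
  have hs : IsSelfAdjoint M := hM
  have hid : cfc (fun x : ℝ => x) M = M := cfc_id' ℝ M
  -- Both |M| - M and |M| + M are positive. Pairing the first with E and the second with 1 - E and
  -- adding gives Tr |M| + Tr M ≥ 2 Tr (E M), where Tr M = 0.
  have h1 : (cfc (fun x : ℝ => |x|) M - M).PosSemidef := by
    have : cfc (fun x : ℝ => |x|) M - M = cfc (fun x : ℝ => |x| - x) M := by
      rw [cfc_sub _ _ M (cfc_continuousOn_spectrum _ _) (cfc_continuousOn_spectrum _ _), hid]
    rw [this]
    exact cfc_posSemidef hM fun x _ => by linarith [le_abs_self x]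
  have h2 : (cfc (fun x : ℝ => |x|) M + M).PosSemidef := by
    have : cfc (fun x : ℝ => |x|) M + M = cfc (fun x : ℝ => |x| + x) M := by
      rw [cfc_add _ _ _ (cfc_continuousOn_spectrum _ _) (cfc_continuousOn_spectrum _ _), hid]
    rw [this]
    exact cfc_posSemidef hM fun x _ => by linarith [neg_abs_le x]
  have a := trace_mul_re_nonneg hE h1
  have b := trace_mul_re_nonneg hE' h2
  rw [traceNorm_hermitian hM]
  simp only [Matrix.mul_sub, Matrix.mul_add, Matrix.sub_mul, Matrix.one_mul, Matrix.trace_sub,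
    Matrix.trace_add, Complex.sub_re, Complex.add_re, ht, Complex.zero_re] at a b
  linarith

/-- Holevo-Helstrom, attainment by a projective measurement. -/
theorem exists_helstrom {M : Op X} (hM : M.IsHermitian) (ht : M.trace = 0) :
    ∃ P : Op X, P.conjTranspose = P ∧ P * P = P ∧ (P * M).trace.re = traceNorm M / 2 := by
  have hs : IsSelfAdjoint M := hM
  have hid : cfc (fun x : ℝ => x) M = M := cfc_id' ℝ M
  -- The spectral projector on the positive part: it multiplies M to (|M| + M)/2, and the second
  -- summand is traceless.
  refine ⟨cfc (fun x : ℝ => if 0 < x then 1 else 0) M, ?_, ?_, ?_⟩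
  · exact (cfc_posSemidef hM fun x _ => by split_ifs <;> norm_num).1
  · rw [← cfc_mul _ _ M (cfc_continuousOn_spectrum _ _) (cfc_continuousOn_spectrum _ _)]
    exact cfc_congr fun x _ => by split_ifs <;> norm_num
  · have h : cfc (fun x : ℝ => if 0 < x then 1 else 0) M * M =
        (1 / 2 : ℝ) • (cfc (fun x : ℝ => |x|) M + M) := by
      conv_lhs => enter [2]; rw [← hid]
      conv_rhs => enter [2, 2]; rw [← hid]
      rw [← cfc_mul _ _ M (cfc_continuousOn_spectrum _ _) (cfc_continuousOn_spectrum _ _),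
        ← cfc_add _ _ _ (cfc_continuousOn_spectrum _ _) (cfc_continuousOn_spectrum _ _),
        ← cfc_smul _ _ M (cfc_continuousOn_spectrum _ _)]
      refine cfc_congr fun x _ => ?_
      split_ifs with hx
      · rw [abs_of_pos hx, smul_eq_mul]; ring
      · rw [abs_of_nonpos (not_lt.1 hx)]; simp
    rw [h, Matrix.trace_smul, Matrix.trace_add, ht, traceNorm_hermitian hM]
    simp; ring

/-! ### Product operators -/

/-- Tensor product of a finite family of operators. -/
def piOp {J : Type} [Fintype J] {X : J → Type} (τ : ∀ j, Op (X j)) : Op (∀ j, X j) :=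
  Matrix.of fun x y => ∏ j, τ j (x j) (y j)

section PiOp

variable {J : Type} [Fintype J] [DecidableEq J] {X : J → Type} [∀ j, Fintype (X j)]
  [∀ j, DecidableEq (X j)]

omit [∀ j, DecidableEq (X j)] in
theorem piOp_mul (σ τ : ∀ j, Op (X j)) : piOp σ * piOp τ = piOp fun j => σ j * τ j := by
  ext x y
  simp only [piOp, Matrix.mul_apply, Matrix.of_apply, ← Finset.prod_mul_distrib]
  rw [Fintype.prod_sum]

omit [DecidableEq J] [∀ j, Fintype (X j)] [∀ j, DecidableEq (X j)] in
theorem piOp_conjTranspose (τ : ∀ j, Op (X j)) :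
    (piOp τ).conjTranspose = piOp fun j => (τ j).conjTranspose := by
  ext x y
  simp [piOp, Matrix.conjTranspose_apply]

omit [∀ j, DecidableEq (X j)] in
theorem piOp_trace (τ : ∀ j, Op (X j)) : (piOp τ).trace = ∏ j, (τ j).trace := by
  simp only [piOp, Matrix.trace, Matrix.diag, Matrix.of_apply]
  rw [Fintype.prod_sum]

omit [DecidableEq J] [∀ j, Fintype (X j)] in
theorem piOp_one : piOp (fun j => (1 : Op (X j))) = 1 := by
  ext x y
  by_cases h : x = y
  · subst h; simp [piOp]
  · rw [Matrix.one_apply_ne h]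
    obtain ⟨j, hj⟩ := Function.ne_iff.1 h
    exact Finset.prod_eq_zero (Finset.mem_univ j) (Matrix.one_apply_ne hj)

/-- The tensor product of the square roots is a square root, which exhibits the product in the form
B†B. -/
theorem piOp_posSemidef {τ : ∀ j, Op (X j)} (h : ∀ j, (τ j).PosSemidef) : (piOp τ).PosSemidef := by
  have : piOp τ = (piOp fun j => opSqrt (τ j)).conjTranspose * piOp fun j => opSqrt (τ j) := by
    rw [piOp_conjTranspose, piOp_mul]
    congr 1; funext j
    rw [(opSqrt_posSemidef (h j)).1.eq, opSqrt_mul_self (h j)]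
  rw [this]
  exact Matrix.posSemidef_conjTranspose_mul_self _

-- Distributivity of the tensor product. It makes a product of measurements a measurement on the
-- product, with strings as outcomes.
omit [∀ j, Fintype (X j)] [∀ j, DecidableEq (X j)] in
theorem piOp_sum {B : Type} [Fintype B] (P : ∀ j, B → Op (X j)) :
    ∑ x : J → B, piOp (fun j => P j (x j)) = piOp fun j => ∑ b, P j b := by
  ext x y
  simp only [piOp, Matrix.sum_apply, Matrix.of_apply]
  rw [Fintype.prod_sum]

end PiOp

/-! ### Density operators -/

section Density

variable {X Y : Type} [Fintype X] [Fintype Y] [DecidableEq X] [DecidableEq Y]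

omit [DecidableEq X] [DecidableEq Y] in
theorem trace_submatrix_equiv (e : Y ≃ X) (M : Op X) : (M.submatrix e e).trace = M.trace :=
  Fintype.sum_equiv e _ _ fun _ => rfl

omit [DecidableEq X] [DecidableEq Y] in
theorem IsDensity.submatrix {ρ : Op X} (h : IsDensity ρ) (e : Y ≃ X) :
    IsDensity (ρ.submatrix e e) :=
  ⟨h.1.submatrix e, by rw [trace_submatrix_equiv, h.2]⟩

omit [DecidableEq X] [DecidableEq Y] in
theorem IsDensity.kronecker {ρ : Op X} {σ : Op Y} (hρ : IsDensity ρ) (hσ : IsDensity σ) :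
    IsDensity (ρ ⊗ₖ σ) :=
  ⟨hρ.1.kronecker hσ.1, by rw [Matrix.trace_kronecker, hρ.2, hσ.2, one_mul]⟩

theorem IsDensity.piOp {J : Type} [Fintype J] [DecidableEq J] {X : J → Type} [∀ j, Fintype (X j)]
    [∀ j, DecidableEq (X j)] {τ : ∀ j, Op (X j)} (h : ∀ j, IsDensity (τ j)) :
    IsDensity (QInfo.piOp τ) :=
  ⟨piOp_posSemidef fun j => (h j).1, by simp [piOp_trace, fun j => (h j).2]⟩

omit [DecidableEq X] in
theorem IsDensity.half_add {ρ σ : Op X} (hρ : IsDensity ρ) (hσ : IsDensity σ) :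
    IsDensity ((1 / 2 : ℂ) • (ρ + σ)) := by
  refine ⟨(hρ.1.add hσ.1).smul ?_, ?_⟩
  · have : (1 / 2 : ℂ) = ((1 / 2 : ℝ) : ℂ) := by push_cast; ring
    rw [this, Complex.zero_le_real]; norm_num
  · rw [Matrix.trace_smul, Matrix.trace_add, hρ.2, hσ.2]; norm_num

omit [DecidableEq X] in
theorem isDensity_vecMulVec {v : X → ℂ} (hv : star v ⬝ᵥ v = 1) :
    IsDensity (vecMulVec v (star v)) :=
  ⟨posSemidef_vecMulVec_self_star v, by rw [trace_vecMulVec, dotProduct_comm, hv]⟩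

end Density

theorem IsDensity.tensor {ι κ : Type} [Fintype ι] [DecidableEq ι] [Fintype κ] [DecidableEq κ]
    {ρ : Op (ι → Bool)} {σ : Op (κ → Bool)}
    (hρ : IsDensity ρ) (hσ : IsDensity σ) : IsDensity (tensor ρ σ) :=
  (hρ.kronecker hσ).submatrix (Equiv.sumArrowEquivProdArrow ι κ Bool)

/-- Bit strings of length `q * n` as `q` blocks of length `n`. -/
def blocks (q n : ℕ) : Bits (q * n) ≃ (Fin q → Bits n) :=
  (Equiv.arrowCongr finProdFinEquiv.symm (Equiv.refl Bool)).trans (Equiv.curry _ _ _)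

/-- Tensor product of `q` states of `n` qubits each. -/
def hyb {n q : ℕ} (τ : Fin q → Op (Bits n)) : Op (Bits (q * n)) :=
  (piOp τ).submatrix (blocks q n) (blocks q n)

theorem tensorPow_eq_hyb {n : ℕ} (q : ℕ) (ρ : Op (Bits n)) : tensorPow q ρ = hyb fun _ => ρ := rfl

theorem IsDensity.tensorPow {n : ℕ} {ρ : Op (Bits n)} (h : IsDensity ρ) (q : ℕ) :
    IsDensity (tensorPow q ρ) := by
  rw [tensorPow_eq_hyb]
  exact (IsDensity.piOp fun _ => h).submatrix _

/-- Outcome probabilities of a product measurement on a product state factorize. -/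
theorem hyb_trace_mul {n q : ℕ} (σ τ : Fin q → Op (Bits n)) :
    (hyb σ * hyb τ).trace = ∏ i, (σ i * τ i).trace := by
  rw [hyb, hyb, Matrix.submatrix_mul_equiv, trace_submatrix_equiv, piOp_mul, piOp_trace]

/-- `Bits (a + b)` as a product. -/
def splitBits (a b : ℕ) : Bits (a + b) ≃ Bits a × Bits b :=
  (Fin.appendEquiv a b).symm

theorem IsDensity.joint {a b : ℕ} {ρ : Op (Bits a × Bits b)} (h : IsDensity ρ) :
    IsDensity (joint ρ) := h.submatrix (splitBits a b)

/-! ### The states of the construction -/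

/-- The registers of `attach`. -/
def attachEquiv (N : ℕ) : Bits (N + 1) × Bits 1 ≃ (Bool × Bool) × Bits N where
  toFun x := ((x.1 0, x.2 0), fun i => x.1 i.succ)
  invFun y := (Fin.cons y.1.1 y.2, fun _ => y.1.2)
  left_inv x := by
    ext i
    · refine Fin.cases ?_ (fun i => ?_) i <;> simp
    · simp [Subsingleton.elim i 0]
  right_inv y := by simp

theorem IsDensity.attach {N : ℕ} {Φ : Op (Bool × Bool)} {ρ : Op (Bits N)} (hΦ : IsDensity Φ)
    (hρ : IsDensity ρ) : IsDensity (attach Φ ρ) :=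
  (hΦ.kronecker hρ).submatrix (attachEquiv N)

/-- The Bell vectors `(|00⟩ ± |11⟩)/√2`, with the minus sign for `true`. -/
def bellVec (s : Bool) : Bool × Bool → ℂ := fun x =>
  if x.1 = x.2 then (if s && x.1 then -1 else 1) * ((Real.sqrt 2)⁻¹ : ℝ) else 0

/-- The Bell states `Φ⁺` and `Φ⁻`. -/
def bell (s : Bool) : Op (Bool × Bool) := if s then phiMinus else phiPlus

theorem inv_sqrt_two_mul_self :
    (((Real.sqrt 2)⁻¹ : ℝ) : ℂ) * (((Real.sqrt 2)⁻¹ : ℝ) : ℂ) = 1 / 2 := by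
  rw [← Complex.ofReal_mul, ← mul_inv, Real.mul_self_sqrt (by norm_num)]
  norm_num

theorem bell_eq (s : Bool) : bell s = vecMulVec (bellVec s) (star (bellVec s)) := by
  ext ⟨x1, x2⟩ ⟨y1, y2⟩
  have h := inv_sqrt_two_mul_self
  simp only [Complex.ofReal_inv] at h
  cases s <;> cases x1 <;> cases x2 <;> cases y1 <;> cases y2 <;>
    simp [bell, phiPlus, phiMinus, bellVec, vecMulVec_apply, h]

theorem bellVec_orthonormal (s t : Bool) :
    star (bellVec s) ⬝ᵥ bellVec t = if s = t then 1 else 0 := by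
  have h := inv_sqrt_two_mul_self
  simp only [Complex.ofReal_inv] at h
  cases s <;> cases t <;>
    simp [bellVec, dotProduct, Fintype.sum_prod_type, h]; norm_num

theorem bell_isDensity (s : Bool) : IsDensity (bell s) := by
  rw [bell_eq]
  exact isDensity_vecMulVec (by simp [bellVec_orthonormal])

theorem attach_add_left {N : ℕ} (Φ Φ' : Op (Bool × Bool)) (ρ : Op (Bits N)) :
    attach (Φ + Φ') ρ = attach Φ ρ + attach Φ' ρ := by
  ext x y; simp [attach, add_mul]

theorem attach_add_right {N : ℕ} (Φ : Op (Bool × Bool)) (ρ ρ' : Op (Bits N)) :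
    attach Φ (ρ + ρ') = attach Φ ρ + attach Φ ρ' := by
  ext x y; simp [attach, mul_add]

/-- The nested halves let `IsDensity.half_add` apply, and put ψ in terms of the same summands as
`phiState_eq`. -/
theorem psiState_eq {N : ℕ} (ρ₀ ρ₁ : Op (Bits N)) :
    psiState ρ₀ ρ₁ = (1 / 2 : ℂ) • ((1 / 2 : ℂ) • (attach (bell false) ρ₀ + attach (bell true) ρ₀) +
      (1 / 2 : ℂ) • (attach (bell false) ρ₁ + attach (bell true) ρ₁)) := by
  rw [psiState, attach_add_right, attach_add_left, attach_add_left, ← smul_add, smul_smul]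
  simp only [bell]
  norm_num

theorem psiState_isDensity {N : ℕ} {ρ₀ ρ₁ : Op (Bits N)} (h₀ : IsDensity ρ₀) (h₁ : IsDensity ρ₁) :
    IsDensity (psiState ρ₀ ρ₁) := by
  rw [psiState_eq]
  exact (((bell_isDensity _).attach h₀).half_add ((bell_isDensity _).attach h₀)).half_add
    (((bell_isDensity _).attach h₁).half_add ((bell_isDensity _).attach h₁))

theorem phiState_eq {N : ℕ} (ρ₀ ρ₁ : Op (Bits N)) :
    phiState ρ₀ ρ₁ = (1 / 2 : ℂ) • (attach (bell false) ρ₀ + attach (bell true) ρ₁) := by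
  simp [phiState, bell]

theorem phiState_isDensity {N : ℕ} {ρ₀ ρ₁ : Op (Bits N)} (h₀ : IsDensity ρ₀) (h₁ : IsDensity ρ₁) :
    IsDensity (phiState ρ₀ ρ₁) := by
  rw [phiState_eq]
  exact ((bell_isDensity _).attach h₀).half_add ((bell_isDensity _).attach h₁)

theorem hyb_posSemidef {n q : ℕ} {τ : Fin q → Op (Bits n)} (h : ∀ i, (τ i).PosSemidef) :
    (hyb τ).PosSemidef :=
  (piOp_posSemidef h).submatrix _

theorem hyb_sum {n q : ℕ} {B : Type} [Fintype B] (P : B → Op (Bits n)) :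
    ∑ x : Fin q → B, hyb (fun i => P (x i)) = hyb fun _ => ∑ b, P b := by
  rw [hyb, ← piOp_sum (fun _ : Fin q => P)]
  ext x y
  simp [hyb, Matrix.sum_apply]

theorem hyb_one {n q : ℕ} : hyb (fun _ : Fin q => (1 : Op (Bits n))) = 1 := by
  rw [hyb, piOp_one, Matrix.submatrix_one_equiv]

/-! ### Amplification of the trace distance -/

/-- One minus the left-hand side is half the sum of (√u - √v)² over the two outcomes. Each of these
squares is at least (u - v)²/4, because u - v = (√u - √v)(√u + √v) and √u + √v ≤ 2. -/
theorem bhattacharyya_bool_le {p r : ℝ} (hp : 0 ≤ p) (hp' : p ≤ 1) (hr : 0 ≤ r) (hr' : r ≤ 1) :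
    √(p * r) + √((1 - p) * (1 - r)) ≤ 1 - (p - r) ^ 2 / 4 := by
  rw [Real.sqrt_mul hp, Real.sqrt_mul (by linarith)]
  have key : ∀ u v : ℝ, 0 ≤ u → u ≤ 1 → 0 ≤ v → v ≤ 1 →
      (u - v) ^ 2 / 4 ≤ (√u - √v) ^ 2 := by
    intro u v hu hu' hv hv'
    have h1 : u - v = (√u - √v) * (√u + √v) := by
      nlinarith [Real.mul_self_sqrt hu, Real.mul_self_sqrt hv]
    have h2 : √u ≤ 1 := Real.sqrt_le_one.2 hu'
    have h3 : √v ≤ 1 := Real.sqrt_le_one.2 hv'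
    have h4 : (√u + √v) ^ 2 ≤ 4 := by
      nlinarith [Real.sqrt_nonneg u, Real.sqrt_nonneg v]
    rw [h1, mul_pow]
    nlinarith [sq_nonneg (√u - √v)]
  have a := key p r hp hp' hr hr'
  have b := key (1 - p) (1 - r) (by linarith) (by linarith) (by linarith) (by linarith)
  have e1 := Real.mul_self_sqrt hp
  have e2 := Real.mul_self_sqrt hr
  have e3 := Real.mul_self_sqrt (show (0 : ℝ) ≤ 1 - p by linarith)
  have e4 := Real.mul_self_sqrt (show (0 : ℝ) ≤ 1 - r by linarith)
  nlinarith

/-- The total variation distance of product distributions on bit strings, attained by the maximum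
likelihood test, in terms of the Bhattacharyya coefficient. -/
theorem one_sub_bhattacharyya_pow_le (q : ℕ) {p r : Bool → ℝ} (hp : ∀ b, 0 ≤ p b)
    (hr : ∀ b, 0 ≤ r b) (hp1 : ∑ b, p b = 1) :
    1 - (∑ b, √(p b * r b)) ^ q ≤
      ∑ x : Fin q → Bool with ∏ i, r (x i) ≤ ∏ i, p (x i), (∏ i, p (x i) - ∏ i, r (x i)) := by
  have h1 : ∑ x : Fin q → Bool, ∏ i, p (x i) = 1 := by
    rw [← Fintype.prod_sum (fun _ : Fin q => p), hp1]; simp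
  have h2 : ∑ x : Fin q → Bool, ∏ i, √(p (x i) * r (x i)) = (∑ b, √(p b * r b)) ^ q := by
    rw [← Fintype.prod_sum (fun _ : Fin q => fun b => √(p b * r b))]; simp
  rw [← h1, ← h2, ← Finset.sum_sub_distrib, Finset.sum_filter]
  -- Termwise P - √(PR) ≤ max(P - R, 0), since the geometric mean is at least the minimum of P and
  -- R.
  refine Finset.sum_le_sum fun x _ => ?_
  have hP : 0 ≤ ∏ i, p (x i) := Finset.prod_nonneg fun i _ => hp _
  have hR : 0 ≤ ∏ i, r (x i) := Finset.prod_nonneg fun i _ => hr _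
  have hs : ∏ i, √(p (x i) * r (x i)) = √((∏ i, p (x i)) * ∏ i, r (x i)) := by
    rw [← Finset.prod_mul_distrib]
    exact (Real.sqrt_prod _ fun i _ => mul_nonneg (hp _) (hr _)).symm
  rw [hs]
  split_ifs with h
  · have : ∏ i, r (x i) ≤ √((∏ i, p (x i)) * ∏ i, r (x i)) :=
      Real.le_sqrt_of_sq_le (by rw [sq]; exact mul_le_mul_of_nonneg_right h hR)
    linarith
  · have : ∏ i, p (x i) ≤ √((∏ i, p (x i)) * ∏ i, r (x i)) :=
      Real.le_sqrt_of_sq_le (by rw [sq]; exact mul_le_mul_of_nonneg_left (not_le.1 h).le hP)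
    linarith

/-- Each copy is measured with the Helstrom projector, so the outcomes are independent bits whose
bias differs by the trace distance d. Accepting the strings at least as likely under ρ as under σ is
an effect on all the copies, whose advantage is at least 1 - BC^q. The coefficient satisfies BC ≤ 1
- d²/4 ≤ exp(-d²/4). -/
theorem traceDist_tensorPow_ge {n : ℕ} {ρ σ : Op (Bits n)} (hρ : IsDensity ρ) (hσ : IsDensity σ)
    (q : ℕ) :
    1 - Real.exp (-(traceDist ρ σ ^ 2 / 4)) ^ q ≤ traceDist (tensorPow q ρ) (tensorPow q σ) := by
  have hM : (ρ - σ).IsHermitian := hρ.1.1.sub hσ.1.1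
  obtain ⟨P, hPh, hPP, hP⟩ := exists_helstrom hM (by rw [trace_sub, hρ.2, hσ.2, sub_self])
  set Q : Bool → Op (Bits n) := fun b => if b then P else 1 - P with hQ
  have hQpsd : ∀ b, (Q b).PosSemidef := by
    have h1 : P.PosSemidef := by
      have := Matrix.posSemidef_conjTranspose_mul_self P
      rwa [hPh, hPP] at this
    have h2 : (1 - P).PosSemidef := by
      have := Matrix.posSemidef_conjTranspose_mul_self (1 - P)
      rw [Matrix.conjTranspose_sub, hPh, Matrix.conjTranspose_one] at this
      have e : (1 - P) * (1 - P) = 1 - P := by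
        rw [mul_sub, sub_mul, sub_mul, hPP]; simp
      rwa [e] at this
    intro b; cases b
    · simpa [hQ] using h2
    · simpa [hQ] using h1
  have hQ1 : ∑ b, Q b = 1 := by simp [hQ]
  set p : Bool → ℝ := fun b => (Q b * ρ).trace.re with hp
  set r : Bool → ℝ := fun b => (Q b * σ).trace.re with hr
  have hp0 : ∀ b, 0 ≤ p b := fun b => trace_mul_re_nonneg (hQpsd b) hρ.1
  have hr0 : ∀ b, 0 ≤ r b := fun b => trace_mul_re_nonneg (hQpsd b) hσ.1
  have hsum : ∀ {τ : Op (Bits n)}, IsDensity τ → ∑ b, (Q b * τ).trace.re = 1 := by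
    intro τ hτ
    rw [← Complex.re_sum, ← trace_sum, ← Finset.sum_mul, hQ1, one_mul, hτ.2, Complex.one_re]
  have hd : p true - r true = traceDist ρ σ := by
    rw [traceDist, ← hP, mul_sub, trace_sub, Complex.sub_re]; rfl
  have hBC : ∑ b, √(p b * r b) ≤ Real.exp (-(traceDist ρ σ ^ 2 / 4)) := by
    have hps := hsum hρ
    have hrs := hsum hσ
    simp only [Fintype.sum_bool] at hps hrs ⊢
    change p true + p false = 1 at hps
    change r true + r false = 1 at hrs
    have e1 : p false = 1 - p true := by linarith
    have e2 : r false = 1 - r true := by linarith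
    rw [e1, e2, ← hd]
    refine (bhattacharyya_bool_le (hp0 _) (by linarith [hp0 false]) (hr0 _)
      (by linarith [hr0 false])).trans ?_
    have := Real.add_one_le_exp (-((p true - r true) ^ 2 / 4))
    linarith
  have hMq : (tensorPow q ρ - tensorPow q σ).IsHermitian :=
    (hρ.tensorPow q).1.1.sub (hσ.tensorPow q).1.1
  have htq : (tensorPow q ρ - tensorPow q σ).trace = 0 := by
    rw [trace_sub, (hρ.tensorPow q).2, (hσ.tensorPow q).2, sub_self]
  set T : Finset (Fin q → Bool) := {x | ∏ i, r (x i) ≤ ∏ i, p (x i)} with hT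
  have hEpsd : ∀ S : Finset (Fin q → Bool), (∑ x ∈ S, hyb fun i => Q (x i)).PosSemidef :=
    fun S => Matrix.posSemidef_sum _ fun x _ => hyb_posSemidef fun i => hQpsd _
  have hE1 : (1 - ∑ x ∈ T, hyb fun i => Q (x i)).PosSemidef := by
    have : (1 : Op (Bits (q * n))) = ∑ x : Fin q → Bool, hyb fun i => Q (x i) := by
      rw [hyb_sum, hQ1, hyb_one]
    rw [this, ← Finset.sum_add_sum_compl T, add_sub_cancel_left]
    exact hEpsd _
  have hub := trace_effect_mul_le hMq htq (hEpsd T) hE1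
  refine le_trans ?_ hub
  have hval : ((∑ x ∈ T, hyb fun i => Q (x i)) * (tensorPow q ρ - tensorPow q σ)).trace.re =
      ∑ x ∈ T, (∏ i, p (x i) - ∏ i, r (x i)) := by
    have hone : ∀ {τ : Op (Bits n)}, IsDensity τ → ∀ x : Fin q → Bool,
        ((hyb fun i => Q (x i)) * tensorPow q τ).trace.re = ∏ i, (Q (x i) * τ).trace.re := by
      intro τ hτ x
      rw [tensorPow_eq_hyb, hyb_trace_mul,
        Finset.prod_congr rfl fun i _ => trace_mul_eq_ofReal (hQpsd (x i)) hτ.1,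
        ← Complex.ofReal_prod, Complex.ofReal_re]
    rw [Finset.sum_mul, trace_sum, Complex.re_sum]
    refine Finset.sum_congr rfl fun x _ => ?_
    rw [mul_sub, trace_sub, Complex.sub_re, hone hρ, hone hσ]
  rw [hval]
  refine le_trans ?_ (one_sub_bhattacharyya_pow_le q hp0 hr0 (hsum hρ))
  have := pow_le_pow_left₀ (Finset.sum_nonneg fun b _ => Real.sqrt_nonneg (p b * r b)) hBC q
  linarith

/-- Rounding every coefficient up, negative ones to zero, only increases the values at natural
numbers. -/
theorem exists_nat_polynomial_ge (p : Polynomial ℝ) :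
    ∃ P : Polynomial ℕ, ∀ l : ℕ, p.eval (l : ℝ) ≤ (P.eval l : ℕ) := by
  induction p using Polynomial.induction_on' with
  | add p q hp hq =>
    obtain ⟨P, hP⟩ := hp
    obtain ⟨Q, hQ⟩ := hq
    exact ⟨P + Q, fun l => by
      rw [Polynomial.eval_add, Polynomial.eval_add]; push_cast; exact add_le_add (hP l) (hQ l)⟩
  | monomial k a =>
    refine ⟨Polynomial.monomial k ⌈a⌉₊, fun l => ?_⟩
    rw [Polynomial.eval_monomial, Polynomial.eval_monomial]
    push_cast
    exact mul_le_mul_of_nonneg_right (Nat.le_ceil a) (by positivity)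

theorem exists_amplification {n : ℕ → ℕ} {ρ₀ ρ₁ : ∀ l, Op (Bits (n l))}
    (hρ : ∀ l, IsDensity (ρ₀ l) ∧ IsDensity (ρ₁ l))
    (far : ∃ p : Polynomial ℝ, ∀ l : ℕ,
      0 < p.eval (l : ℝ) ∧ 1 / p.eval (l : ℝ) ≤ traceDist (ρ₀ l) (ρ₁ l)) :
    ∃ q : Polynomial ℕ, ∀ l : ℕ, 1 - (1 / 2 : ℝ) ^ l ≤
      traceDist (tensorPow (q.eval l) (ρ₀ l)) (tensorPow (q.eval l) (ρ₁ l)) := by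
  obtain ⟨p, hp⟩ := far
  obtain ⟨P, hP⟩ := exists_nat_polynomial_ge p
  -- With d ≥ 1/P this many copies make the exponent q d²/4 at least l, and exp(-l) ≤ 2^(-l).
  refine ⟨4 * P ^ 2 * Polynomial.X, fun l => ?_⟩
  refine le_trans ?_ (traceDist_tensorPow_ge (hρ l).1 (hρ l).2 _)
  have hd : 1 / ((P.eval l : ℕ) : ℝ) ≤ traceDist (ρ₀ l) (ρ₁ l) :=
    (one_div_le_one_div_of_le (hp l).1 (hP l)).trans (hp l).2
  have hP0 : (0 : ℝ) < ((P.eval l : ℕ) : ℝ) := (hp l).1.trans_le (hP l)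
  have hd2 : 1 / ((P.eval l : ℕ) : ℝ) ^ 2 ≤ traceDist (ρ₀ l) (ρ₁ l) ^ 2 := by
    rw [← _root_.one_div_pow]
    exact pow_le_pow_left₀ (by positivity) hd 2
  have hq : (((4 * P ^ 2 * Polynomial.X : Polynomial ℕ).eval l : ℕ) : ℝ) = 4 * ((P.eval l : ℕ) : ℝ) ^ 2 * l := by
    simp
  rw [← Real.exp_nat_mul, hq]
  have h1 : (l : ℝ) ≤ 4 * ((P.eval l : ℕ) : ℝ) ^ 2 * l * (traceDist (ρ₀ l) (ρ₁ l) ^ 2 / 4) := by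
    have : (1 : ℝ) ≤ ((P.eval l : ℕ) : ℝ) ^ 2 * traceDist (ρ₀ l) (ρ₁ l) ^ 2 := by
      rw [div_le_iff₀ (by positivity)] at hd2; linarith
    nlinarith [Nat.cast_nonneg (α := ℝ) l]
  have h2 : Real.exp (-(l : ℝ)) ≤ (1 / 2 : ℝ) ^ l := by
    rw [show -(l : ℝ) = l * (-1) by ring, Real.exp_nat_mul]
    refine pow_le_pow_left₀ (Real.exp_nonneg _) ?_ l
    rw [Real.exp_neg, ← one_div]
    exact one_div_le_one_div_of_le (by norm_num) (by linarith [Real.add_one_le_exp (1 : ℝ)])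
  have h3 := Real.exp_le_exp.2 (neg_le_neg h1)
  rw [mul_neg]
  linarith

/-! ### LOCC protocols -/

theorem ite_sum_zero {ι R : Type} [Fintype ι] [AddCommMonoid R] (p : Prop) [Decidable p]
    (f : ι → R) : (if p then ∑ i, f i else 0) = ∑ i, if p then f i else 0 := by
  split_ifs <;> simp

section Local

variable {A A' B B' : Type} [Fintype A] [DecidableEq A] [Fintype B] [DecidableEq B]

omit [DecidableEq A] in
theorem conj_kronecker_one_apply (K : Matrix A' A ℂ) (M : Op (A × B)) (a a' : A') (b b' : B) :
    ((K ⊗ₖ (1 : Matrix B B ℂ)) * M * (K ⊗ₖ (1 : Matrix B B ℂ)).conjTranspose) (a, b) (a', b') =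
      ∑ u, ∑ v, K a u * M (u, b) (v, b') * star (K a' v) := by
  simp only [Matrix.mul_apply, Fintype.sum_prod_type, Matrix.kroneckerMap_apply,
    Matrix.conjTranspose_apply, Matrix.one_apply, mul_ite, mul_one, mul_zero, ite_mul, zero_mul,
    Finset.sum_ite_eq, Finset.mem_univ, if_true, star_zero, apply_ite star,
    Finset.sum_mul]
  exact Finset.sum_comm

omit [DecidableEq B] in
theorem conj_one_kronecker_apply (K : Matrix B' B ℂ) (M : Op (A × B)) (a a' : A) (b b' : B') :
    (((1 : Matrix A A ℂ) ⊗ₖ K) * M * ((1 : Matrix A A ℂ) ⊗ₖ K).conjTranspose) (a, b) (a', b') =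
      ∑ u, ∑ v, K b u * M (a, u) (a', v) * star (K b' v) := by
  simp only [Matrix.mul_apply, Fintype.sum_prod_type_right, Matrix.kroneckerMap_apply,
    Matrix.conjTranspose_apply, Matrix.one_apply, ite_mul, one_mul, zero_mul, mul_ite, mul_zero,
    Finset.sum_ite_eq, Finset.mem_univ, if_true, star_zero, apply_ite star,
    Finset.sum_mul]
  exact Finset.sum_comm

end Local

section Columns

variable {X : Type} [Fintype X] [DecidableEq X]

/-- A state is the sum of |c⟩⟨c| over the columns c of its square root. These columns serve as Kraus
operators that create the state from nothing. -/
theorem sum_opSqrt_mul_star {ρ : Op X} (hρ : ρ.PosSemidef) (a b : X) :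
    ∑ j, opSqrt ρ a j * star (opSqrt ρ b j) = ρ a b := by
  conv_rhs => rw [← opSqrt_mul_self hρ]
  rw [Matrix.mul_apply]
  refine Finset.sum_congr rfl fun j _ => ?_
  rw [← Matrix.conjTranspose_apply, (opSqrt_posSemidef hρ).1.eq]

theorem sum_star_opSqrt_mul {ρ : Op X} (hρ : IsDensity ρ) :
    ∑ j, ∑ a, star (opSqrt ρ a j) * opSqrt ρ a j = 1 := by
  rw [Finset.sum_comm, ← hρ.2, Matrix.trace]
  refine Finset.sum_congr rfl fun a _ => ?_
  rw [Matrix.diag_apply, ← sum_opSqrt_mul_star hρ.1]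
  exact Finset.sum_congr rfl fun j _ => mul_comm _ _

end Columns

theorem eprPairs_zero : eprPairs 0 = 1 := by
  ext x y
  rw [Subsingleton.elim y x]
  simp [eprPairs]

theorem entCost_le {A B : Type} [Fintype A] [DecidableEq A] [Fintype B] [DecidableEq B]
    {ε : ℝ} (hε : 0 ≤ ε) {ρ : Op (A × B)} (hρ : IsDensity ρ) {m : ℕ}
    {Γ : Op (Bits m × Bits m) → Op (A × B)} (hΓ : LOCC A B (Bits m) (Bits m) Γ)
    (h : Γ (eprPairs m) = ρ) : entCost ε ρ ≤ m :=
  sInf_le ⟨m, Γ, rfl, hΓ, by rw [h, fidelity_self hρ]; linarith⟩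

/-- Separable states can be created by LOCC without any entanglement. -/
theorem entCost_eq_zero_of_separable {A B : Type} [Fintype A] [DecidableEq A] [Fintype B]
    [DecidableEq B] {ε : ℝ} (hε : 0 ≤ ε) {ρ : Op (A × B)} (hρ : IsDensity ρ)
    (hs : IsSeparableState ρ) : entCost ε ρ = 0 := by
  obtain ⟨k, w, σ, τ, hw, hw1, hsum⟩ := hs
  -- Alice draws i with probability w i, announces it and creates σ i; the index j of the column
  -- stays hidden.
  set K : Fin k → A → Matrix A (Bits 0) ℂ :=
    fun i j => Matrix.of fun a _ => ((√(w i) : ℝ) : ℂ) * opSqrt (σ i) a j with hK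
  -- Bob, told i, creates τ i and has nothing to announce, whence the outcome type `Unit`.
  set L : Fin k → Unit → B → Matrix B (Bits 0) ℂ :=
    fun i _ j => Matrix.of fun b _ => opSqrt (τ i) b j with hL
  have hww : ∀ i, ((√(w i) : ℝ) : ℂ) * ((√(w i) : ℝ) : ℂ) = (w i : ℂ) := fun i => by
    rw [← Complex.ofReal_mul, Real.mul_self_sqrt (hw i).1]
  have hK1 : ∑ i, ∑ j, (K i j).conjTranspose * K i j = 1 := by
    ext x y
    rw [Subsingleton.elim y x, Matrix.one_apply_eq]
    simp only [Matrix.sum_apply, Matrix.mul_apply, Matrix.conjTranspose_apply, hK, Matrix.of_apply]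
    have : ∀ i, ∑ j, ∑ a, star (((√(w i) : ℝ) : ℂ) * opSqrt (σ i) a j) *
        (((√(w i) : ℝ) : ℂ) * opSqrt (σ i) a j) = w i := fun i => by
      rw [← mul_one (w i : ℂ), ← sum_star_opSqrt_mul (hw i).2.1, Finset.mul_sum]
      refine Finset.sum_congr rfl fun j _ => ?_
      rw [Finset.mul_sum]
      refine Finset.sum_congr rfl fun a _ => ?_
      rw [star_mul', ← hww]
      simp only [Complex.star_def, Complex.conj_ofReal]
      ring
    simp only [this]
    exact_mod_cast hw1
  have hL1 : ∀ i, ∑ x, ∑ j, (L i x j).conjTranspose * L i x j = 1 := fun i => by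
    ext x y
    rw [Subsingleton.elim y x, Matrix.one_apply_eq]
    simp only [Matrix.sum_apply, Matrix.mul_apply, Matrix.conjTranspose_apply, hL, Matrix.of_apply,
      Finset.univ_unique, Finset.sum_const, Finset.card_singleton, one_smul]
    exact sum_star_opSqrt_mul (hw i).2.2
  have hΓ := LOCC.alice (A' := A) (B' := B) (B := Bits 0) K hK1 _
    fun i => LOCC.bob (L i) (hL1 i) _ fun _ => LOCC.done
  refine le_antisymm (entCost_le hε hρ hΓ ?_) bot_le
  rw [hsum, eprPairs_zero]
  ext ⟨a, b⟩ ⟨a', b'⟩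
  simp only [Matrix.sum_apply, Finset.univ_unique, Finset.sum_const, Finset.card_singleton,
    one_smul, conj_one_kronecker_apply, conj_kronecker_one_apply, hK, hL, Matrix.of_apply,
    Matrix.smul_apply, Matrix.kroneckerMap_apply, smul_eq_mul]
  refine Finset.sum_congr rfl fun i _ => ?_
  rw [← sum_opSqrt_mul_star (hw i).2.1.1, ← sum_opSqrt_mul_star (hw i).2.2.1, ← hww,
    Finset.sum_mul_sum]
  have h1 : ∀ x y x' y' : Bits 0, (1 : Op (Bits 0 × Bits 0)) (x, x') (y, y') = 1 :=
    fun x y x' y' => by rw [Subsingleton.elim (y, y') (x, x'), Matrix.one_apply_eq]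
  simp only [Finset.sum_singleton, h1, Finset.mul_sum, Finset.sum_mul]
  refine Finset.sum_comm.trans
    (Finset.sum_congr rfl fun j _ => Finset.sum_congr rfl fun j' _ => ?_)
  rw [star_mul']
  simp only [Complex.star_def, Complex.conj_ofReal]
  ring

/-- The eigenvalues of the Pauli operators `1` (for `false`) and `Z` (for `true`). -/
def pauliSign (s x : Bool) : ℂ := if s && x then -1 else 1

/-- A Pauli Z on the half of A exchanges Φ⁺ and Φ⁻. This both creates the sign in φ and corrects it
during distillation. -/
theorem bell_apply_pauliSign (s t : Bool) (x y : Bool × Bool) :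
    pauliSign s x.1 * bell t x y * star (pauliSign s y.1) = bell (xor t s) x y := by
  obtain ⟨x1, x2⟩ := x
  obtain ⟨y1, y2⟩ := y
  cases s <;> cases t <;> cases x1 <;> cases x2 <;> cases y1 <;> cases y2 <;>
    simp [bell, phiPlus, phiMinus, pauliSign]

theorem eprPairs_one_apply (x y : Bits 1 × Bits 1) :
    eprPairs 1 x y = bell false (x.1 0, x.2 0) (y.1 0, y.2 0) := by
  simp [eprPairs, bell]

/-- Alice tosses a fair coin s, applies Z^s to her half of a single EPR pair and attaches a fresh
copy of ρ_s. This gives the upper bound in Θ(1). -/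
theorem entCost_phiState_le {N : ℕ} {ε : ℝ} (hε : 0 ≤ ε) {ρ₀ ρ₁ : Op (Bits N)}
    (h₀ : IsDensity ρ₀) (h₁ : IsDensity ρ₁) : entCost ε (phiState ρ₀ ρ₁) ≤ 1 := by
  set σ : Bool → Op (Bits N) := fun s => if s then ρ₁ else ρ₀ with hσ
  have hd : ∀ s, IsDensity (σ s) := by intro s; cases s <;> simpa [hσ]
  set c : ℂ := (((Real.sqrt 2)⁻¹ : ℝ) : ℂ) with hc
  have hcc : c * c = 1 / 2 := inv_sqrt_two_mul_self
  have hcs : star c = c := Complex.conj_ofReal _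
  have hps : ∀ s x, star (pauliSign s x) * pauliSign s x = 1 := by
    intro s x; cases s <;> cases x <;> simp [pauliSign]
  -- The coin has amplitude c = 1/√2; the columns of √σ_s create the attached state as hidden
  -- outcomes.
  set K : Bool → Bits N → Matrix (Bits (N + 1)) (Bits 1) ℂ := fun s j => Matrix.of fun x y =>
    if y = (fun _ => x 0) then c * pauliSign s (x 0) * opSqrt (σ s) (fun i => x i.succ) j else 0
    with hK
  have hK1 : ∑ s, ∑ j, (K s j).conjTranspose * K s j = 1 := by
    ext y y'
    have hs : ∀ s, ∑ j, ((K s j).conjTranspose * K s j) y y' = if y = y' then 1 / 2 else 0 := by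
      intro s
      simp only [Matrix.mul_apply, Matrix.conjTranspose_apply, hK, Matrix.of_apply]
      have half : (1 / 2 : ℂ) = ∑ j, 1 / 2 * ∑ a, star (opSqrt (σ s) a j) * opSqrt (σ s) a j := by
        rw [← Finset.mul_sum, sum_star_opSqrt_mul (hd s), mul_one]
      rw [half, ite_sum_zero]
      refine Finset.sum_congr rfl fun j _ => ?_
      rw [← (Fin.consEquiv (fun _ : Fin (N + 1) => Bool)).sum_comp, Fintype.sum_prod_type]
      simp only [Fin.consEquiv_apply, Fin.cons_zero, Fin.cons_succ]
      rw [Finset.sum_eq_single (y 0)]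
      · have e : (fun _ : Fin 1 => y 0) = y := by ext i; rw [Subsingleton.elim i 0]
        simp only [e, if_true]
        by_cases h : y = y'
        · subst h
          rw [if_pos rfl, Finset.mul_sum]
          refine Finset.sum_congr rfl fun a _ => ?_
          simp only [if_true, star_mul', hcs]
          rw [← hcc]
          linear_combination (c * c * (star (opSqrt (σ s) a j) * opSqrt (σ s) a j)) * hps s (y 0)
        · simp [h, Ne.symm h]
      · intro b _ hb
        refine Finset.sum_eq_zero fun a _ => ?_
        rw [if_neg, star_zero, zero_mul]
        rintro rfl; exact hb rfl
      · simp
    simp only [Matrix.sum_apply, hs, Matrix.one_apply]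
    split_ifs <;> simp
  have hΓ := LOCC.alice (A' := Bits (N + 1)) (B' := Bits 1) (B := Bits 1) K hK1 _
    fun _ => LOCC.done
  refine entCost_le hε (phiState_isDensity h₀ h₁) hΓ ?_
  ext ⟨x, z⟩ ⟨x', z'⟩
  simp only [Matrix.sum_apply, conj_kronecker_one_apply, hK, Matrix.of_apply]
  have hs : ∀ s, ∑ j, ∑ u : Bits 1, ∑ v : Bits 1,
      (if u = (fun _ => x 0) then c * pauliSign s (x 0) * opSqrt (σ s) (fun i => x i.succ) j else 0) *
        eprPairs 1 (u, z) (v, z') *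
        star (if v = (fun _ => x' 0) then
          c * pauliSign s (x' 0) * opSqrt (σ s) (fun i => x' i.succ) j else 0) =
      1 / 2 * attach (bell s) (σ s) (x, z) (x', z') := by
    intro s
    simp only [apply_ite star, star_zero, mul_ite, mul_zero, ite_mul, zero_mul, Finset.sum_ite_eq',
      Finset.mem_univ, if_true, eprPairs_one_apply, star_mul', hcs]
    have := bell_apply_pauliSign s false (x 0, z 0) (x' 0, z' 0)
    simp only [Bool.false_xor] at this
    simp only [attach, Matrix.of_apply]
    rw [← sum_opSqrt_mul_star (hd s).1, ← this, Finset.mul_sum, Finset.mul_sum, ← hcc]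
    refine Finset.sum_congr rfl fun j _ => ?_
    ring
  rw [Fintype.sum_bool, hs, hs, phiState_eq]
  simp [hσ]
  ring

/-- One EPR pair can be distilled from `½ (Φ⁺ ⊗ ρ₀ + Φ⁻ ⊗ ρ₁)` by measuring which of `ρ₀`, `ρ₁`
the party `A` holds. -/
theorem one_le_distillable_phiState {N : ℕ} {ε : ℝ} {ρ₀ ρ₁ : Op (Bits N)}
    (h₀ : IsDensity ρ₀) (h₁ : IsDensity ρ₁) (hε : 1 - ε ≤ (1 + traceDist ρ₀ ρ₁) / 2) :
    1 ≤ distillable ε (phiState ρ₀ ρ₁) := by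
  have hM : (ρ₀ - ρ₁).IsHermitian := h₀.1.1.sub h₁.1.1
  obtain ⟨P, hPh, hPP, hP⟩ := exists_helstrom hM (by rw [trace_sub, h₀.2, h₁.2, sub_self])
  -- P favours ρ₀, so it belongs to the guess `false`.
  set Q : Bool → Op (Bits N) := fun b => if b then 1 - P else P with hQ
  have hQQ : ∀ b, (Q b).conjTranspose * Q b = Q b := by
    intro b; cases b
    · simpa [hQ, hPh] using hPP
    · simp [hQ, hPh, mul_sub, sub_mul, hPP]
  have hQpsd : ∀ b, (Q b).PosSemidef := fun b => by
    rw [← hQQ]; exact Matrix.posSemidef_conjTranspose_mul_self _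
  set σ : Bool → Op (Bits N) := fun s => if s then ρ₁ else ρ₀ with hσ
  have hd : ∀ s, IsDensity (σ s) := by intro s; cases s <;> simpa [hσ]
  have hps : ∀ s x, star (pauliSign s x) * pauliSign s x = 1 := by
    intro s x; cases s <;> cases x <;> simp [pauliSign]
  -- Guess s, correct the pair by Z^s, and discard the measured register: the row index j of Q s is
  -- the traced-out outcome.
  set K : Bool → Bits N → Matrix (Bits 1) (Bits (N + 1)) ℂ := fun s j => Matrix.of fun y x =>
    if x 0 = y 0 then pauliSign s (y 0) * Q s j (fun i => x i.succ) else 0 with hK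
  have hK1 : ∑ s, ∑ j, (K s j).conjTranspose * K s j = 1 := by
    ext x x'
    have hs : ∀ s, ∑ j, ((K s j).conjTranspose * K s j) x x' =
        if x 0 = x' 0 then Q s (fun i => x i.succ) (fun i => x' i.succ) else 0 := by
      intro s
      simp only [Matrix.mul_apply, Matrix.conjTranspose_apply, hK, Matrix.of_apply]
      conv_rhs => rw [← hQQ, Matrix.mul_apply, ite_sum_zero]
      refine Finset.sum_congr rfl fun j _ => ?_
      rw [Finset.sum_eq_single (fun _ => x 0)]
      · simp only [if_true, star_mul', Matrix.conjTranspose_apply]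
        by_cases h : x 0 = x' 0
        · rw [if_pos h.symm, if_pos h]
          linear_combination (star (Q s j fun i => x i.succ) * Q s j fun i => x' i.succ) *
            hps s (x 0)
        · rw [if_neg h, if_neg (Ne.symm h), mul_zero]
      · intro y _ hy
        rw [if_neg, star_zero, zero_mul]
        intro h; exact hy (by ext i; rw [Subsingleton.elim i 0, h])
      · simp
    have hsum : Q true + Q false = 1 := by simp [hQ]
    simp only [Matrix.sum_apply, hs, Fintype.sum_bool]
    have hx : x = x' ↔ x 0 = x' 0 ∧ (fun i : Fin N => x i.succ) = fun i => x' i.succ := by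
      constructor
      · rintro rfl; exact ⟨rfl, rfl⟩
      · rintro ⟨a, b⟩
        ext i
        refine Fin.cases a (fun i => congrFun b i) i
    by_cases h : x 0 = x' 0
    · rw [if_pos h, if_pos h, ← Matrix.add_apply, hsum]
      simp only [Matrix.one_apply, hx, h, true_and]
    · rw [if_neg h, if_neg h, Matrix.one_apply, if_neg fun e => h (hx.1 e).1, add_zero]
  have hΓ := LOCC.alice (A' := Bits 1) (B' := Bits 1) (B := Bits 1) K hK1 _ fun _ => LOCC.done
  refine le_sSup_of_le ⟨1, _, rfl, hΓ, ?_⟩ (by simp)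
  let e : Bits 1 × Bits 1 ≃ Bool × Bool :=
    (Equiv.funUnique (Fin 1) Bool).prodCongr (Equiv.funUnique (Fin 1) Bool)
  -- A guess s on the component with bit t leaves the Bell state of sign t xor s, hence Φ⁺ exactly
  -- when the guess is right.
  have hout : (∑ s, ∑ j, K s j ⊗ₖ (1 : Op (Bits 1)) * phiState ρ₀ ρ₁ *
      (K s j ⊗ₖ (1 : Op (Bits 1))).conjTranspose) =
      ∑ s, ∑ t, (1 / 2 * (Q s * σ t).trace) • (bell (xor t s)).submatrix e e := by
    ext ⟨y, z⟩ ⟨y', z'⟩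
    simp only [Matrix.sum_apply, conj_kronecker_one_apply, hK, Matrix.of_apply]
    refine Finset.sum_congr rfl fun s _ => ?_
    have hone : ∀ t, ∑ j, ∑ u : Bits (N + 1), ∑ v : Bits (N + 1),
        (if u 0 = y 0 then pauliSign s (y 0) * Q s j (fun i => u i.succ) else 0) *
          attach (bell t) (σ t) (u, z) (v, z') *
          star (if v 0 = y' 0 then pauliSign s (y' 0) * Q s j (fun i => v i.succ) else 0) =
        (Q s * σ t).trace * bell (xor t s) (y 0, z 0) (y' 0, z' 0) := by
      intro t
      have htr : (Q s * σ t).trace = ∑ j, ∑ u, ∑ v, Q s j u * σ t u v * star (Q s j v) := by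
        have : (Q s * σ t).trace = (Q s * σ t * (Q s).conjTranspose).trace := by
          conv_rhs => rw [Matrix.trace_mul_comm, ← Matrix.mul_assoc, hQQ]
        rw [this, Matrix.trace]
        refine Finset.sum_congr rfl fun j _ => ?_
        simp only [Matrix.diag_apply, Matrix.mul_apply, Matrix.conjTranspose_apply, Finset.sum_mul]
        exact Finset.sum_comm
      rw [htr, ← bell_apply_pauliSign, Finset.sum_mul]
      refine Finset.sum_congr rfl fun j _ => ?_
      rw [← (Fin.consEquiv (fun _ : Fin (N + 1) => Bool)).sum_comp, Fintype.sum_prod_type,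
        Finset.sum_eq_single (y 0), Finset.sum_mul]
      · refine Finset.sum_congr rfl fun u _ => ?_
        rw [← (Fin.consEquiv (fun _ : Fin (N + 1) => Bool)).sum_comp, Fintype.sum_prod_type,
          Finset.sum_eq_single (y' 0), Finset.sum_mul]
        · refine Finset.sum_congr rfl fun v _ => ?_
          simp [attach]
          ring
        · intro b _ hb
          simp [hb]
        · simp
      · intro b _ hb
        simp [hb]
      · simp
    have hphi : phiState ρ₀ ρ₁ = (1 / 2 : ℂ) • ∑ t, attach (bell t) (σ t) := by
      rw [phiState_eq, Fintype.sum_bool, add_comm (attach (bell true) _)]; simp [hσ]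
    have hmove : ∀ (u v : Bits (N + 1)) (a b : ℂ), a * phiState ρ₀ ρ₁ (u, z) (v, z') * b =
        ∑ t, 1 / 2 * (a * attach (bell t) (σ t) (u, z) (v, z') * b) := by
      intro u v a b
      rw [hphi]
      simp only [Matrix.smul_apply, smul_eq_mul, Fintype.sum_bool, Matrix.add_apply]
      ring
    simp only [hmove]
    simp only [Finset.sum_comm (s := (Finset.univ : Finset (Bits (N + 1)))) (t := (Finset.univ : Finset Bool)),
      Finset.sum_comm (s := (Finset.univ : Finset (Bits N))) (t := (Finset.univ : Finset Bool))]
    refine Finset.sum_congr rfl fun t _ => ?_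
    simp only [← Finset.mul_sum, hone t]
    simp [e, mul_assoc]
  have hpsd : (∑ s, ∑ t, (1 / 2 * (Q s * σ t).trace) •
      (bell (xor t s)).submatrix e e).PosSemidef := by
    refine Matrix.posSemidef_sum _ fun s _ => Matrix.posSemidef_sum _ fun t _ => ?_
    refine ((bell_isDensity _).1.submatrix e).smul (mul_nonneg ?_ (trace_mul_nonneg (hQpsd s) (hd t).1))
    have : (1 / 2 : ℂ) = ((1 / 2 : ℝ) : ℂ) := by push_cast; ring
    rw [this, Complex.zero_le_real]; norm_num
  have hepr : eprPairs 1 = vecMulVec (bellVec false ∘ e) (star (bellVec false ∘ e)) := by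
    ext x y
    rw [eprPairs_one_apply, bell_eq]
    rfl
  have hin : ∀ u, star (bellVec false ∘ e) ⬝ᵥ ((bell u).submatrix e e *ᵥ (bellVec false ∘ e)) =
      if u = false then 1 else 0 := by
    intro u
    have h1 : (bell u).submatrix e e *ᵥ (bellVec false ∘ e) = (bell u *ᵥ bellVec false) ∘ e := by
      ext x
      exact Fintype.sum_equiv e _ (fun y => bell u (e x) y * bellVec false y) fun _ => rfl
    have h2 : star (bellVec false ∘ e) ⬝ᵥ ((bell u *ᵥ bellVec false) ∘ e) =
        star (bellVec false) ⬝ᵥ (bell u *ᵥ bellVec false) :=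
      Fintype.sum_equiv e _ _ fun _ => rfl
    rw [h1, h2, bell_eq, vecMulVec_mulVec, bellVec_orthonormal]
    cases u <;> simp [bellVec_orthonormal]
  change 1 - ε ≤ fidelity (∑ s, ∑ j, K s j ⊗ₖ (1 : Op (Bits 1)) * phiState ρ₀ ρ₁ *
      (K s j ⊗ₖ (1 : Op (Bits 1))).conjTranspose) _
  rw [hout, hepr, fidelity_pure hpsd]
  -- The Bell vectors are orthogonal, so the fidelity is the success probability ½(Tr Pρ₀ + Tr (1 -
  -- P)ρ₁), which equals (1 + TD)/2.
  refine hε.trans (le_of_eq ?_)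
  rw [traceDist, ← hP]
  simp only [Fintype.sum_bool, add_mulVec, smul_mulVec, dotProduct_add, dotProduct_smul, hin]
  simp [hQ, hσ, mul_sub, sub_mul, h₁.2]
  ring

/-! ### Linearity and relabelling of circuits -/

theorem traceOut_add {o : Type} [Fintype o] {w : ℕ} (e : o ↪ Fin w) (M M' : Op (Bits w)) :
    traceOut e (M + M') = traceOut e M + traceOut e M' := by
  ext x y
  simp only [traceOut, Matrix.of_apply, Matrix.add_apply, ← Finset.sum_add_distrib]
  refine Finset.sum_congr rfl fun z _ => Finset.sum_congr rfl fun z' _ => ?_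
  split_ifs <;> simp

theorem traceOut_smul {o : Type} [Fintype o] {w : ℕ} (e : o ↪ Fin w) (c : ℂ) (M : Op (Bits w)) :
    traceOut e (c • M) = c • traceOut e M := by
  ext x y
  simp only [traceOut, Matrix.of_apply, Matrix.smul_apply, Finset.smul_sum]
  refine Finset.sum_congr rfl fun z _ => Finset.sum_congr rfl fun z' _ => ?_
  split_ifs <;> simp

/-- The unitary computed by a sequence of gates. -/
def gatesUnitary {𝒢 : GateSet} {w : ℕ} : List (Gate 𝒢 w) → Op (Bits w)
  | [] => 1
  | g :: gs => gatesUnitary gs * g.unitary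

/-- Collapsing the gates into one conjugation makes the channel visibly linear and lets pure inputs
be followed as vectors. -/
theorem foldl_conj_eq {𝒢 : GateSet} {w : ℕ} (gs : List (Gate 𝒢 w)) (M : Op (Bits w)) :
    gs.foldl (fun M g => g.unitary * M * g.unitary.conjTranspose) M =
      gatesUnitary gs * M * (gatesUnitary gs).conjTranspose := by
  induction gs generalizing M with
  | nil => simp [gatesUnitary]
  | cons g gs ih =>
    rw [List.foldl_cons, ih, gatesUnitary, Matrix.conjTranspose_mul]
    simp only [Matrix.mul_assoc]

theorem Circuit.apply_eq {𝒢 : GateSet} {ι o : Type} [Fintype ι] [Fintype o] (C : Circuit 𝒢 ι o)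
    (ρ : Op (ι → Bool)) : C.apply ρ = traceOut C.out
      (gatesUnitary C.gates * initialize0 C.inp ρ * (gatesUnitary C.gates).conjTranspose) := by
  rw [Circuit.apply, foldl_conj_eq]

theorem Circuit.apply_add {𝒢 : GateSet} {ι o : Type} [Fintype ι] [Fintype o] (C : Circuit 𝒢 ι o)
    (ρ σ : Op (ι → Bool)) : C.apply (ρ + σ) = C.apply ρ + C.apply σ := by
  have : initialize0 C.inp (ρ + σ) = initialize0 C.inp ρ + initialize0 C.inp σ := by
    ext x y
    simp only [initialize0, Matrix.of_apply, Matrix.add_apply]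
    split_ifs <;> simp
  rw [C.apply_eq, C.apply_eq, C.apply_eq, this, mul_add, add_mul, traceOut_add]

theorem Circuit.apply_smul {𝒢 : GateSet} {ι o : Type} [Fintype ι] [Fintype o] (C : Circuit 𝒢 ι o)
    (c : ℂ) (ρ : Op (ι → Bool)) : C.apply (c • ρ) = c • C.apply ρ := by
  have : initialize0 C.inp (c • ρ) = c • initialize0 C.inp ρ := by
    ext x y
    simp only [initialize0, Matrix.of_apply, Matrix.smul_apply]
    split_ifs <;> simp
  rw [C.apply_eq, C.apply_eq, this, mul_smul_comm, smul_mul_assoc, traceOut_smul]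

/-- Relabel the inputs and the outputs of a circuit. -/
def Circuit.reindex {𝒢 : GateSet} {ι κ o p : Type} (C : Circuit 𝒢 ι o) (e : κ ≃ ι) (f : p ≃ o) :
    Circuit 𝒢 κ p where
  wires := C.wires
  inp := e.toEmbedding.trans C.inp
  out := f.toEmbedding.trans C.out
  gates := C.gates

/-- Permuting registers needs no gates, so rearranged systems can be handed to a distinguisher
without changing its size. -/
theorem Circuit.reindex_apply {𝒢 : GateSet} {ι κ o p : Type} [Fintype ι] [Fintype κ] [Fintype o]
    [Fintype p] (C : Circuit 𝒢 ι o) (e : κ ≃ ι) (f : p ≃ o) (ρ : Op (κ → Bool)) (x y : o → Bool) :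
    (C.reindex e f).apply ρ (x ∘ f) (y ∘ f) = C.apply (ρ.submatrix (· ∘ e) (· ∘ e)) x y := by
  have h1 : initialize0 (e.toEmbedding.trans C.inp) ρ =
      initialize0 C.inp (ρ.submatrix (· ∘ e) (· ∘ e)) := by
    ext x y
    simp only [initialize0, Matrix.of_apply, Function.Embedding.trans_apply,
      Equiv.coe_toEmbedding, e.forall_congr_left (p := fun i => C.inp (e i) ≠ _),
      Equiv.apply_symm_apply, Matrix.submatrix_apply]
    rfl
  have h2 : ∀ M, traceOut (f.toEmbedding.trans C.out) M (x ∘ f) (y ∘ f) = traceOut C.out M x y := by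
    intro M
    simp only [traceOut, Matrix.of_apply, Function.Embedding.trans_apply, Equiv.coe_toEmbedding,
      Function.comp_apply]
    refine Finset.sum_congr rfl fun z _ => Finset.sum_congr rfl fun z' _ => ?_
    refine if_congr (and_congr ?_ (and_congr ?_ ?_)) rfl rfl
    · exact ⟨fun h i => by simpa using h (f.symm i), fun h i => h (f i)⟩
    · exact ⟨fun h i => by simpa using h (f.symm i), fun h i => h (f i)⟩
    · refine forall_congr' fun j => imp_congr_left ?_
      exact ⟨fun h i => by simpa using h (f.symm i), fun h i => h (f i)⟩
  rw [Circuit.apply_eq, Circuit.apply_eq, ← h1, ← h2]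
  rfl

/-- The probability that a circuit with one output qubit outputs `1`. -/
def Circuit.acc {𝒢 : GateSet} {ι : Type} [Fintype ι] (D : Circuit 𝒢 ι (Fin 1))
    (ρ : Op (ι → Bool)) : ℝ := (D.apply ρ (fun _ => true) (fun _ => true)).re

theorem prOne_eq_acc {𝒢 : GateSet} {N a : ℕ} (D : Circuit 𝒢 (Fin N ⊕ Fin a) (Fin 1))
    (ρ : Op (Bits N)) (α : Op (Bits a)) : prOne D ρ α = D.acc (tensor ρ α) := rfl

theorem Circuit.acc_reindex {𝒢 : GateSet} {ι κ : Type} [Fintype ι] [Fintype κ]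
    (D : Circuit 𝒢 ι (Fin 1)) (e : κ ≃ ι) (ρ : Op (κ → Bool)) :
    (D.reindex e (Equiv.refl _)).acc ρ = D.acc (ρ.submatrix (· ∘ e) (· ∘ e)) := by
  rw [Circuit.acc, Circuit.acc, ← D.reindex_apply e (Equiv.refl _)]
  rfl

theorem Circuit.acc_add {𝒢 : GateSet} {ι : Type} [Fintype ι] (D : Circuit 𝒢 ι (Fin 1))
    (ρ σ : Op (ι → Bool)) : D.acc (ρ + σ) = D.acc ρ + D.acc σ := by
  simp [Circuit.acc, Circuit.apply_add]

theorem Circuit.acc_smul {𝒢 : GateSet} {ι : Type} [Fintype ι] (D : Circuit 𝒢 ι (Fin 1))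
    (c : ℝ) (ρ : Op (ι → Bool)) : D.acc ((c : ℂ) • ρ) = c * D.acc ρ := by
  rw [Circuit.acc, Circuit.apply_smul, Matrix.smul_apply, smul_eq_mul, Complex.re_ofReal_mul]; rfl

/-! ### Asymptotics -/

theorem PolyBounded.mono {f g : ℕ → ℕ} (hg : PolyBounded g) (h : ∀ l, f l ≤ g l) : PolyBounded f :=
  hg.imp fun _ hp l => (h l).trans (hp l)

theorem PolyBounded.add {f g : ℕ → ℕ} (hf : PolyBounded f) (hg : PolyBounded g) :
    PolyBounded fun l => f l + g l := by
  obtain ⟨p, hp⟩ := hf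
  obtain ⟨q, hq⟩ := hg
  exact ⟨p + q, fun l => by rw [Polynomial.eval_add]; exact add_le_add (hp l) (hq l)⟩

theorem PolyBounded.mul {f g : ℕ → ℕ} (hf : PolyBounded f) (hg : PolyBounded g) :
    PolyBounded fun l => f l * g l := by
  obtain ⟨p, hp⟩ := hf
  obtain ⟨q, hq⟩ := hg
  exact ⟨p * q, fun l => by rw [Polynomial.eval_mul]; exact Nat.mul_le_mul (hp l) (hq l)⟩

theorem PolyBounded.const (c : ℕ) : PolyBounded fun _ => c :=
  ⟨Polynomial.C c, fun l => by rw [Polynomial.eval_C]⟩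

theorem PolyBounded.eval (p : Polynomial ℕ) : PolyBounded fun l => p.eval l := ⟨p, fun _ => le_rfl⟩

theorem PolyBounded.id : PolyBounded fun l => l := ⟨Polynomial.X, fun l => by simp⟩

theorem Negligible.poly_mul {k : ℕ → ℕ} (hk : PolyBounded k) {ε : ℕ → ℝ} (hε : Negligible ε) :
    Negligible fun l => k l * ε l := by
  obtain ⟨K, hK⟩ := hk
  intro p hp
  -- The summand 1 keeps the test polynomial positive where K vanishes.
  obtain ⟨N, hN⟩ := hε (p * (K.map (Nat.castRingHom ℝ) + 1)) fun l => by
    have : 0 ≤ (K.map (Nat.castRingHom ℝ)).eval (l : ℝ) := by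
      rw [Polynomial.eval_natCast_map]; simp
    rw [Polynomial.eval_mul, Polynomial.eval_add, Polynomial.eval_one]
    exact mul_pos (hp l) (by linarith)
  refine ⟨N, fun l hl => ?_⟩
  have h := hN l hl
  have hKl : (K.map (Nat.castRingHom ℝ)).eval (l : ℝ) = ((K.eval l : ℕ) : ℝ) := by
    rw [Polynomial.eval_natCast_map]; simp
  rw [Polynomial.eval_mul, Polynomial.eval_add, Polynomial.eval_one, hKl] at h
  have hk' : (k l : ℝ) ≤ ((K.eval l : ℕ) : ℝ) := by exact_mod_cast hK l
  have hp0 := hp l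
  have hK0 : (0 : ℝ) ≤ ((K.eval l : ℕ) : ℝ) := Nat.cast_nonneg _
  rw [abs_mul, Nat.abs_cast]
  rw [lt_div_iff₀ (by positivity)] at h ⊢
  nlinarith [abs_nonneg (ε l), mul_nonneg (mul_nonneg (sub_nonneg.2 hk') (abs_nonneg (ε l))) hp0.le,
    mul_nonneg (abs_nonneg (ε l)) hp0.le]

/-! ### Computational indistinguishability -/

section Indist

variable {𝒢 : GateSet} {N : ℕ → ℕ} {ρ σ : ∀ l, Op (Bits (N l))}

/-- Indistinguishability by the best among polynomially sized distinguishers chosen from a finite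
set for each security parameter. -/
theorem CompIndist.of_finite (h : CompIndist 𝒢 ρ σ) (hN : PolyBounded N) (m : ℕ → ℕ)
    (D : ∀ l, Fin (m l) → Σ a : ℕ, Circuit 𝒢 (Fin (N l) ⊕ Fin a) (Fin 1)) {B : ℕ → ℕ}
    (hB : PolyBounded B) (hD : ∀ l i, (D l i).2.size ≤ B l) :
    ∃ ε : ℕ → ℝ, (∀ l, 0 ≤ ε l) ∧ Negligible ε ∧
      ∀ l i, ∀ α : Op (Bits (D l i).1), IsDensity α →
        |prOne (D l i).2 (ρ l) α - prOne (D l i).2 (σ l) α| ≤ ε l := by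
  let S : ∀ l, (Σ a : ℕ, Circuit 𝒢 (Fin (N l) ⊕ Fin a) (Fin 1)) → Set ℝ := fun l d =>
    {x | ∃ α : Op (Bits d.1), IsDensity α ∧ x = |prOne d.2 (ρ l) α - prOne d.2 (σ l) α|}
  have hbound : ∀ c : ∀ l, Σ a : ℕ, Circuit 𝒢 (Fin (N l) ⊕ Fin a) (Fin 1),
      (∀ l, (c l).2.size ≤ B l + (N l + 1)) →
      ∃ ε : ℕ → ℝ, (∀ l, 0 ≤ ε l) ∧ Negligible ε ∧ ∀ l, ∀ x ∈ S l (c l), x ≤ ε l := by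
    intro c hc
    obtain ⟨ε, h0, hn, hε⟩ := h (fun l => (c l).1) (fun l => (c l).2)
      ((hB.add (hN.add (PolyBounded.const 1))).mono hc)
    exact ⟨ε, h0, hn, fun l x ⟨α, hα, hx⟩ => hx ▸ hε l α hα⟩
  -- For each l, pick the candidate whose advantage, maximized over the advice, is largest; the
  -- picks form one family, to which indistinguishability applies.
  have hc : ∀ l, ∃ c : Σ a : ℕ, Circuit 𝒢 (Fin (N l) ⊕ Fin a) (Fin 1),
      c.2.size ≤ B l + (N l + 1) ∧ ∀ i, sSup (S l (D l i)) ≤ sSup (S l c) := by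
    intro l
    rcases Nat.eq_zero_or_pos (m l) with h0 | h0
    -- Without candidates any circuit does. This one has no gates and outputs a fresh wire, which
    -- accounts for the extra N l + 1 in the size bound.
    · refine ⟨⟨0, ⟨N l + 1, (Equiv.sumEmpty (Fin (N l)) (Fin 0)).toEmbedding.trans
        Fin.castSuccEmb, ⟨fun _ => Fin.last _, fun _ _ _ => Subsingleton.elim _ _⟩,
        []⟩⟩, by simp [Circuit.size], fun i => ?_⟩
      exact absurd i.2 (by omega)
    · have : Nonempty (Fin (m l)) := ⟨⟨0, h0⟩⟩
      obtain ⟨i, hi⟩ := Finite.exists_max fun i => sSup (S l (D l i))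
      exact ⟨D l i, (hD l i).trans (Nat.le_add_right _ _), hi⟩
  choose c hcs hcm using hc
  obtain ⟨ε, h0, hn, hε⟩ := hbound c hcs
  refine ⟨ε, h0, hn, fun l i α hα => ?_⟩
  -- The supremum of an unbounded set would be the default 0. Boundedness comes from
  -- indistinguishability itself, for the chosen family altered at the single index l.
  have hbdd : BddAbove (S l (D l i)) := by
    obtain ⟨ε', -, -, hε'⟩ := hbound (Function.update c l (D l i)) fun l' => by
      rcases eq_or_ne l' l with rfl | hl
      · rw [Function.update_self]; exact (hD _ i).trans (Nat.le_add_right _ _)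
      · rw [Function.update_of_ne hl]; exact hcs _
    refine ⟨ε' l, fun x hx => hε' l x ?_⟩
    rwa [Function.update_self]
  exact ((le_csSup hbdd ⟨α, hα, rfl⟩).trans (hcm l i)).trans (Real.sSup_le (hε l) (h0 l))

/-- `CompIndist.of_finite` for advice registers with arbitrary labels. -/
theorem CompIndist.of_finite' (h : CompIndist 𝒢 ρ σ) (hN : PolyBounded N) (m : ℕ → ℕ)
    {κ : ∀ l, Fin (m l) → Type} [∀ l i, Fintype (κ l i)] [∀ l i, DecidableEq (κ l i)]
    (D : ∀ l i, Circuit 𝒢 (Fin (N l) ⊕ κ l i) (Fin 1)) {B : ℕ → ℕ}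
    (hB : PolyBounded B) (hD : ∀ l i, (D l i).size ≤ B l) :
    ∃ ε : ℕ → ℝ, (∀ l, 0 ≤ ε l) ∧ Negligible ε ∧
      ∀ l i, ∀ α : Op (κ l i → Bool), IsDensity α →
        |(D l i).acc (tensor (ρ l) α) - (D l i).acc (tensor (σ l) α)| ≤ ε l := by
  obtain ⟨ε, h0, hn, hε⟩ := h.of_finite hN m (fun l i => ⟨Fintype.card (κ l i),
    (D l i).reindex (Equiv.sumCongr (Equiv.refl _) (Fintype.equivFin (κ l i)).symm)
      (Equiv.refl _)⟩) hB hD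
  refine ⟨ε, h0, hn, fun l i α hα => ?_⟩
  have key : ∀ τ : Op (Bits (N l)), (D l i).acc (tensor τ α) = prOne
      ((D l i).reindex (Equiv.sumCongr (Equiv.refl _) (Fintype.equivFin (κ l i)).symm)
      (Equiv.refl _)) τ (α.submatrix (· ∘ Fintype.equivFin (κ l i))
        (· ∘ Fintype.equivFin (κ l i))) := by
    intro τ
    rw [prOne_eq_acc, Circuit.acc_reindex]
    congr 1
    ext x y
    simp only [tensor, Matrix.of_apply, Matrix.submatrix_apply, Function.comp_def,
      Equiv.sumCongr_apply, Sum.map_inl, Sum.map_inr, Equiv.symm_apply_apply, Equiv.refl_apply]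
  rw [key, key]
  exact hε l i _ (hα.submatrix
    (Equiv.arrowCongr (Fintype.equivFin (κ l i)).symm (Equiv.refl Bool)))

/-- Isolating copy `i` of `k` copies of an `n`-qubit register, next to another register. -/
def isolateFun {k n : ℕ} (a : ℕ) (i : Fin k) :
    Fin n ⊕ (({j // j ≠ i} × Fin n) ⊕ Fin a) → Fin (k * n) ⊕ Fin a
  | .inl r => .inl (finProdFinEquiv (i, r))
  | .inr (.inl (j, r)) => .inl (finProdFinEquiv (j.1, r))
  | .inr (.inr s) => .inr s

theorem isolateFun_bijective {k n : ℕ} (a : ℕ) (i : Fin k) :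
    Function.Bijective (isolateFun (n := n) a i) := by
  constructor
  · rintro (r | ⟨j, r⟩ | s) (r' | ⟨j', r'⟩ | s') h
    · simpa [isolateFun] using h
    · have := j'.2
      simp only [isolateFun, Sum.inl.injEq, EmbeddingLike.apply_eq_iff_eq, Prod.mk.injEq] at h
      exact absurd h.1.symm this
    · simp [isolateFun] at h
    · have := j.2
      simp only [isolateFun, Sum.inl.injEq, EmbeddingLike.apply_eq_iff_eq, Prod.mk.injEq] at h
      exact absurd h.1 this
    · simp only [isolateFun, Sum.inl.injEq, EmbeddingLike.apply_eq_iff_eq, Prod.mk.injEq] at h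
      simp [Subtype.ext h.1, h.2]
    · simp [isolateFun] at h
    · simp [isolateFun] at h
    · simp [isolateFun] at h
    · simpa [isolateFun] using h
  · rintro (s | s)
    · obtain ⟨⟨j, r⟩, rfl⟩ := finProdFinEquiv.surjective s
      by_cases hj : j = i
      · exact ⟨.inl r, by simp [isolateFun, hj]⟩
      · exact ⟨.inr (.inl (⟨j, hj⟩, r)), rfl⟩
    · exact ⟨.inr (.inr s), rfl⟩

def isolate {k n : ℕ} (a : ℕ) (i : Fin k) :
    Fin n ⊕ (({j // j ≠ i} × Fin n) ⊕ Fin a) ≃ Fin (k * n) ⊕ Fin a :=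
  Equiv.ofBijective _ (isolateFun_bijective a i)

/-- The product of all factors but the `i`-th. -/
def restState {k n : ℕ} (i : Fin k) (τ : Fin k → Op (Bits n)) :
    Op ({j // j ≠ i} × Fin n → Bool) :=
  (piOp fun j : {j // j ≠ i} => τ j).submatrix (Equiv.curry _ _ _) (Equiv.curry _ _ _)

theorem restState_isDensity {k n : ℕ} (i : Fin k) {τ : Fin k → Op (Bits n)}
    (h : ∀ j, IsDensity (τ j)) : IsDensity (restState i τ) :=
  (IsDensity.piOp fun j : {j // j ≠ i} => h j).submatrix (Equiv.curry _ _ _)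

/-- Seen from copy i, the other copies and the advice form a single larger advice state. -/
theorem tensor_hyb_eq {k n a : ℕ} (i : Fin k) (τ : Fin k → Op (Bits n)) (α : Op (Bits a)) :
    tensor (hyb τ) α = (tensor (τ i) (tensor (restState i τ) α)).submatrix (· ∘ isolate a i)
      (· ∘ isolate a i) := by
  ext x y
  simp only [tensor, hyb, piOp, restState, Matrix.of_apply, Matrix.submatrix_apply]
  rw [Fintype.prod_eq_mul_prod_subtype_ne _ i, mul_assoc]
  rfl

/-- The hybrid argument: polynomially many copies of indistinguishable states are
indistinguishable. The other copies are part of the advice. -/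
theorem CompIndist.tensorPow (h : CompIndist 𝒢 ρ σ) (hN : PolyBounded N)
    (hρ : ∀ l, IsDensity (ρ l)) (hσ : ∀ l, IsDensity (σ l)) {k : ℕ → ℕ} (hk : PolyBounded k) :
    CompIndist 𝒢 (fun l => tensorPow (k l) (ρ l)) (fun l => tensorPow (k l) (σ l)) := by
  intro a D hD
  -- One negligible ε must serve all k l positions; separate bounds for each position could not be
  -- summed.
  obtain ⟨ε, h0, hn, hε⟩ := h.of_finite' hN k
    (fun l i => (D l).reindex (isolate (a l) i) (Equiv.refl _)) hD fun l i => le_rfl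
  refine ⟨fun l => k l * ε l, fun l => mul_nonneg (Nat.cast_nonneg _) (h0 l), hn.poly_mul hk,
    fun l α hα => ?_⟩
  -- The i-th hybrid has i copies of σ followed by copies of ρ.
  let τ : ℕ → Fin (k l) → Op (Bits (N l)) := fun i j => if j.1 < i then σ l else ρ l
  have hτ : ∀ i j, IsDensity (τ i j) := fun i j => by
    dsimp only [τ]; split_ifs
    exacts [hσ l, hρ l]
  let G : ℕ → ℝ := fun i => (D l).acc (tensor (hyb (τ i)) α)
  have hstart : prOne (D l) (QInfo.tensorPow (k l) (ρ l)) α = G 0 := by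
    simp only [prOne_eq_acc, tensorPow_eq_hyb, G, τ, Nat.not_lt_zero, if_false]
  have hend : prOne (D l) (QInfo.tensorPow (k l) (σ l)) α = G (k l) := by
    simp only [prOne_eq_acc, tensorPow_eq_hyb, G, τ, Fin.is_lt, if_true]
  rw [hstart, hend]
  refine (dist_le_range_sum_dist G (k l)).trans ?_
  change _ ≤ (k l : ℝ) * ε l
  rw [← nsmul_eq_mul]
  refine (Finset.sum_le_card_nsmul _ _ (ε l) fun i hi => ?_).trans (by rw [Finset.card_range])
  have hi' : i < k l := Finset.mem_range.1 hi
  have hG : ∀ i', G i' = ((D l).reindex (isolate (a l) ⟨i, hi'⟩) (Equiv.refl _)).acc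
      (tensor (τ i' ⟨i, hi'⟩) (tensor (restState ⟨i, hi'⟩ (τ i')) α)) := fun i' => by
    rw [Circuit.acc_reindex, ← tensor_hyb_eq]
  -- Consecutive hybrids differ only in copy i, so the enlarged advice is the same for both.
  have hrest : restState ⟨i, hi'⟩ (τ (i + 1)) = restState ⟨i, hi'⟩ (τ i) := by
    unfold restState
    congr 2
    funext j
    have hj : (j : Fin (k l)).1 ≠ i := fun e => j.2 (Fin.ext e)
    have : (j : Fin (k l)).1 < i + 1 ↔ (j : Fin (k l)).1 < i := by omega
    simp only [τ, this]
  rw [hG i, hG (i + 1), hrest, Real.dist_eq]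
  simp only [τ, lt_irrefl, if_false, Nat.lt_succ_self, if_true]
  exact hε l ⟨i, hi'⟩ _ ((restState_isDensity _ fun j => hτ i j).tensor hα)

/-! ### Indistinguishability of the construction -/

/-- Isolating the register of `ρ` in `attach Φ ρ`, next to another register. -/
def attachFun (n a : ℕ) : Fin n ⊕ (Fin 2 ⊕ Fin a) → Fin (n + 1 + 1) ⊕ Fin a
  | .inl r => .inl r.succ.castSucc
  | .inr (.inl 0) => .inl (Fin.castSucc 0)
  | .inr (.inl 1) => .inl (Fin.last _)
  | .inr (.inr s) => .inr s

theorem attachFun_bijective (n a : ℕ) : Function.Bijective (attachFun n a) := by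
  constructor
  · rintro (r | j | s) (r' | j' | s') h
    · simpa [attachFun] using h
    · fin_cases j' <;> simp [attachFun, Fin.ext_iff] at h
      omega
    · simp [attachFun] at h
    · fin_cases j <;> simp [attachFun, Fin.ext_iff] at h
      omega
    · fin_cases j <;> fin_cases j' <;> simp [attachFun, Fin.ext_iff] at h ⊢
    · fin_cases j <;> simp [attachFun] at h
    · simp [attachFun] at h
    · fin_cases j' <;> simp [attachFun] at h
    · simpa [attachFun] using h
  · rintro (s | s)
    · refine Fin.lastCases ⟨.inr (.inl 1), rfl⟩ (fun s => ?_) s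
      exact Fin.cases ⟨.inr (.inl 0), rfl⟩ (fun s => ⟨.inl s, rfl⟩) s
    · exact ⟨.inr (.inr s), rfl⟩

/-- The Bell pair moves into the advice, so distinguishing the attached states reduces to
distinguishing the states of the register. -/
theorem tensor_joint_attach_eq {n a : ℕ} (Φ : Op (Bool × Bool)) (τ : Op (Bits n))
    (α : Op (Bits a)) : tensor (joint (attach Φ τ)) α =
      (tensor τ (tensor (Φ.submatrix (finTwoArrowEquiv Bool) (finTwoArrowEquiv Bool)) α)).submatrix
        (· ∘ Equiv.ofBijective _ (attachFun_bijective n a))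
        (· ∘ Equiv.ofBijective _ (attachFun_bijective n a)) := by
  ext x y
  simp only [tensor, joint, attach, Matrix.of_apply, Matrix.submatrix_apply]
  rw [mul_comm (Φ _ _), mul_assoc]
  rfl

theorem tensor_joint_add {n a b : ℕ} (ρ σ : Op (Bits n × Bits b)) (α : Op (Bits a)) :
    tensor (joint (ρ + σ)) α = tensor (joint ρ) α + tensor (joint σ) α := by
  ext x y; simp [tensor, joint, add_mul]

theorem tensor_joint_smul {n a b : ℕ} (c : ℂ) (ρ : Op (Bits n × Bits b)) (α : Op (Bits a)) :
    tensor (joint (c • ρ)) α = c • tensor (joint ρ) α := by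
  ext x y; simp [tensor, joint, mul_assoc]

/-- The difference of acceptance probabilities is a quarter of two terms, one for each Bell state,
in which ρ is exchanged for σ. Each is at most ε in absolute value, so ε/2 bounds the whole. -/
theorem CompIndist.psiState_phiState (h : CompIndist 𝒢 ρ σ) (hN : PolyBounded N) :
    CompIndist 𝒢 (fun l => joint (psiState (ρ l) (σ l))) (fun l => joint (phiState (ρ l) (σ l))) := by
  intro a D hD
  obtain ⟨ε, h0, hn, hε⟩ := h.of_finite' hN (fun _ => 1) (fun l _ => (D l).reindex
    (Equiv.ofBijective _ (attachFun_bijective (N l) (a l))) (Equiv.refl _)) hD fun l i => le_rfl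
  refine ⟨ε, h0, hn, fun l α hα => ?_⟩
  have key : ∀ s, |(D l).acc (tensor (joint (attach (bell s) (ρ l))) α) -
      (D l).acc (tensor (joint (attach (bell s) (σ l))) α)| ≤ ε l := by
    intro s
    rw [tensor_joint_attach_eq, tensor_joint_attach_eq, ← Circuit.acc_reindex,
      ← Circuit.acc_reindex]
    exact hε l 0 _ (((bell_isDensity s).submatrix (finTwoArrowEquiv Bool)).tensor hα)
  have half : (1 / 2 : ℂ) = ((1 / 2 : ℝ) : ℂ) := by push_cast; ring
  rw [prOne_eq_acc, prOne_eq_acc]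
  beta_reduce
  rw [psiState_eq, phiState_eq, half]
  simp only [tensor_joint_add, tensor_joint_smul, Circuit.acc_add, Circuit.acc_smul]
  have hf := abs_le.1 (key false)
  have ht := abs_le.1 (key true)
  rw [abs_le]
  constructor <;> linarith [h0 l]

end Indist

/-! ### Gates contained in the gate set -/

/-- The gate `U` of the gate set, acting on the wires `f`. -/
def GateSet.Contains.gate {𝒢 : GateSet} {k w : ℕ} {U : Op (Bits k)} (h : 𝒢.Contains U)
    (f : Fin k ↪ Fin w) : Gate 𝒢 w :=
  ⟨h.choose, h.choose_spec.choose.symm.toEmbedding.trans f⟩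

/-- The wires are listed through the inverse permutation, so the order of the qubits in the gate set
does not matter. -/
theorem onWires_equiv {k m w : ℕ} {U : Op (Bits k)} {V : Op (Bits m)} (e : Fin k ≃ Fin m)
    (h : ∀ x y, V x y = U (fun i => x (e i)) (fun i => y (e i))) (f : Fin k ↪ Fin w) :
    onWires V (e.symm.toEmbedding.trans f) = onWires U f := by
  ext x y
  simp only [onWires, Matrix.of_apply, h, Function.Embedding.trans_apply, Equiv.coe_toEmbedding,
    Equiv.symm_apply_apply]
  refine if_congr (forall_congr' fun j => imp_congr_left ?_) rfl rfl
  exact ⟨fun h i => by simpa using h (e i), fun h i => h (e.symm i)⟩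

theorem GateSet.Contains.gate_unitary {𝒢 : GateSet} {k w : ℕ} {U : Op (Bits k)}
    (h : 𝒢.Contains U) (f : Fin k ↪ Fin w) : (h.gate f).unitary = onWires U f :=
  onWires_equiv _ h.choose_spec.choose_spec f

/-- CNOT is an involutive permutation of the basis, so the value at x is read off at the image of x.
-/
theorem onWires_cnot_mulVec {w : ℕ} (f : Fin 2 ↪ Fin w) (v : Bits w → ℂ) (x : Bits w) :
    (onWires cnot f *ᵥ v) x = v (Function.update x (f 1) (xor (x (f 1)) (x (f 0)))) := by
  have hne : f 0 ≠ f 1 := fun h => by simpa using f.injective h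
  have : ∀ y, onWires cnot f x y =
      if y = Function.update x (f 1) (xor (x (f 1)) (x (f 0))) then 1 else 0 := by
    intro y
    simp only [onWires, cnot, Matrix.of_apply, ← ite_and]
    refine if_congr ⟨?_, ?_⟩ rfl rfl
    · rintro ⟨h, h0, h1⟩
      ext j
      by_cases hj1 : j = f 1
      · subst hj1
        rw [Function.update_self, h1, h0]
        cases y (f 0) <;> cases y (f 1) <;> rfl
      · rw [Function.update_of_ne hj1]
        by_cases hj0 : j = f 0
        · rw [hj0, h0]
        · refine (h j fun i => ?_).symm
          fin_cases i
          · exact Ne.symm hj0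
          · exact Ne.symm hj1
    · rintro rfl
      refine ⟨fun j hj => (Function.update_of_ne (Ne.symm (hj 1)) _ _).symm, ?_, ?_⟩
      · rw [Function.update_of_ne hne]
      · rw [Function.update_of_ne hne, Function.update_self]
        cases x (f 0) <;> cases x (f 1) <;> rfl
  simp only [Matrix.mulVec, dotProduct, this, ite_mul, one_mul, zero_mul, Finset.sum_ite_eq',
    Finset.mem_univ, if_true]

theorem onWires_hadamard_mulVec {w : ℕ} (f : Fin 1 ↪ Fin w) (v : Bits w → ℂ) (x : Bits w) :
    (onWires hadamard f *ᵥ v) x =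
      ∑ b, hadamard (fun _ => x (f 0)) (fun _ => b) * v (Function.update x (f 0) b) := by
  have : ∀ y, onWires hadamard f x y =
      ∑ b, if y = Function.update x (f 0) b then
        hadamard (fun _ => x (f 0)) (fun _ => b) else 0 := by
    intro y
    simp only [onWires, Matrix.of_apply]
    have hfin : ∀ (z : Bits w), (fun i => z (f i)) = fun _ => z (f 0) := fun z => by
      ext i; rw [Subsingleton.elim i 0]
    have hiff : ∀ b, y = Function.update x (f 0) b ↔
        (∀ j, (∀ i, f i ≠ j) → x j = y j) ∧ b = y (f 0) := by
      intro b
      constructor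
      · rintro rfl
        exact ⟨fun j hj => (Function.update_of_ne (Ne.symm (hj 0)) _ _).symm,
          (Function.update_self (f 0) b x).symm⟩
      · rintro ⟨h, rfl⟩
        ext j
        by_cases hj : j = f 0
        · subst hj; rw [Function.update_self]
        · rw [Function.update_of_ne hj]
          exact (h j fun i => by rw [Subsingleton.elim i 0]; exact Ne.symm hj).symm
    simp only [hiff, ite_and, hfin]
    split_ifs <;> simp
  simp only [Matrix.mulVec, dotProduct, this, Finset.sum_mul, ite_mul, zero_mul]
  rw [Finset.sum_comm]
  simp only [Finset.sum_ite_eq', Finset.mem_univ, if_true]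

theorem hadamard_apply_false (x : Bits 1) :
    hadamard x (fun _ => false) = (((Real.sqrt 2)⁻¹ : ℝ) : ℂ) := by
  simp [hadamard]

/-! ### Four ancillas and `q` blocks of wires -/

/-- The ancilla wires. -/
def anc {m : ℕ} (k : Fin 4) : Fin (4 + m) := Fin.castAdd m k

/-- The wires of block `i`. -/
def blk {q w : ℕ} (i : Fin q) : Fin w ↪ Fin (4 + q * w) :=
  ⟨fun j => Fin.natAdd 4 (finProdFinEquiv (i, j)), fun j j' h => by
    simpa using (Fin.natAdd_injective _ _ h)⟩

theorem blk_apply {q w : ℕ} (i : Fin q) (j : Fin w) :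
    blk i j = Fin.natAdd 4 (finProdFinEquiv (i, j)) := rfl

theorem blk_inj {q w : ℕ} {i i' : Fin q} {j j' : Fin w} : blk i j = blk i' j' ↔ i = i' ∧ j = j' := by
  rw [blk_apply, blk_apply, (Fin.natAdd_injective _ _).eq_iff]
  simp

theorem anc_inj {m : ℕ} {k k' : Fin 4} : (anc k : Fin (4 + m)) = anc k' ↔ k = k' := by
  rw [anc, anc, (Fin.castAdd_injective _ _).eq_iff]

theorem anc_ne_blk {q w : ℕ} (k : Fin 4) (i : Fin q) (j : Fin w) : anc k ≠ blk i j := by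
  intro h
  have := congrArg Fin.val h
  simp only [anc, blk_apply, Fin.val_castAdd, Fin.val_natAdd] at this
  omega

theorem forall_wires {q w : ℕ} {P : Fin (4 + q * w) → Prop} :
    (∀ j, P j) ↔ (∀ k, P (anc k)) ∧ ∀ i j, P (blk i j) := by
  refine ⟨fun h => ⟨fun k => h _, fun i j => h _⟩, fun h j => ?_⟩
  refine Fin.addCases (fun k => h.1 k) (fun r => ?_) j
  obtain ⟨⟨i, j⟩, rfl⟩ := finProdFinEquiv.surjective r
  exact h.2 i j

/-- Bit strings on four ancillas and `q` blocks of wires. -/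
def ancBlocks (q w : ℕ) : Bits (4 + q * w) ≃ Bits 4 × (Fin q → Bits w) :=
  (splitBits 4 (q * w)).trans ((Equiv.refl _).prodCongr (blocks q w))

theorem ancBlocks_fst {q w : ℕ} (x : Bits (4 + q * w)) (k : Fin 4) :
    (ancBlocks q w x).1 k = x (anc k) := rfl

theorem ancBlocks_snd {q w : ℕ} (x : Bits (4 + q * w)) (i : Fin q) (j : Fin w) :
    (ancBlocks q w x).2 i j = x (blk i j) := rfl

/-- Operators acting separately on the blocks. -/
def blockOp {q w : ℕ} (M : Fin q → Op (Bits w)) : Op (Bits (4 + q * w)) :=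
  ((1 : Op (Bits 4)) ⊗ₖ piOp M).submatrix (ancBlocks q w) (ancBlocks q w)

theorem blockOp_mul {q w : ℕ} (M M' : Fin q → Op (Bits w)) :
    blockOp M * blockOp M' = blockOp fun i => M i * M' i := by
  rw [blockOp, blockOp, Matrix.submatrix_mul_equiv, ← Matrix.mul_kronecker_mul, piOp_mul, one_mul]
  rfl

theorem blockOp_one {q w : ℕ} : blockOp (fun _ : Fin q => (1 : Op (Bits w))) = 1 := by
  rw [blockOp, piOp_one, Matrix.one_kronecker_one, Matrix.submatrix_one_equiv]

/-- The ancillas are untouched, so a vector that is a product over the blocks for every fixed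
ancilla string remains one. The factors may depend on that string. -/
theorem blockOp_mulVec {q w : ℕ} (M : Fin q → Op (Bits w)) (c : Bits 4 → ℂ)
    (u : Bits 4 → Fin q → Bits w → ℂ) (x : Bits (4 + q * w)) :
    (blockOp M *ᵥ fun y => c (ancBlocks q w y).1 *
      ∏ i, u (ancBlocks q w y).1 i ((ancBlocks q w y).2 i)) x =
      c (ancBlocks q w x).1 * ∏ i, (M i *ᵥ u (ancBlocks q w x).1 i) ((ancBlocks q w x).2 i) := by
  simp only [Matrix.mulVec, dotProduct, blockOp, Matrix.submatrix_apply]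
  rw [(ancBlocks q w).sum_comp fun y => ((1 : Op (Bits 4)) ⊗ₖ piOp M) (ancBlocks q w x) y *
    (c y.1 * ∏ i, u y.1 i (y.2 i)), Fintype.sum_prod_type, Finset.sum_eq_single (ancBlocks q w x).1]
  · rw [Fintype.prod_sum, Finset.mul_sum]
    refine Finset.sum_congr rfl fun f _ => ?_
    simp only [Matrix.kroneckerMap_apply, Matrix.one_apply_eq, piOp, Matrix.of_apply,
      Finset.prod_mul_distrib]
    ring
  · intro p _ hp
    refine Finset.sum_eq_zero fun f _ => ?_
    rw [Matrix.kroneckerMap_apply, Matrix.one_apply_ne (Ne.symm hp)]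
    simp
  · simp

/-- A gate moved to block `i`. -/
def Gate.shift {𝒢 : GateSet} {q w : ℕ} (i : Fin q) (g : Gate 𝒢 w) : Gate 𝒢 (4 + q * w) :=
  ⟨g.kind, g.wires.trans (blk i)⟩

theorem onWires_trans_blk {q w k : ℕ} (i : Fin q) (U : Op (Bits k)) (f : Fin k ↪ Fin w) :
    onWires U (f.trans (blk i)) = blockOp (Function.update (fun _ => 1) i (onWires U f)) := by
  ext x y
  simp only [onWires, Matrix.of_apply, Function.Embedding.trans_apply,
    blockOp, Matrix.submatrix_apply, Matrix.kroneckerMap_apply, piOp]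
  rw [Fintype.prod_eq_mul_prod_subtype_ne _ i, Function.update_self]
  have hrest : ∀ i' : {i' // i' ≠ i}, Function.update (fun _ : Fin q => (1 : Op (Bits w))) i
      (Matrix.of fun x y => if ∀ j, (∀ k, f k ≠ j) → x j = y j then
        U (fun k => x (f k)) (fun k => y (f k)) else 0) i' = 1 :=
    fun i' => Function.update_of_ne i'.2 _ _
  simp only [hrest, Matrix.of_apply]
  by_cases h : (ancBlocks q w x).1 = (ancBlocks q w y).1 ∧
      ∀ i', i' ≠ i → (ancBlocks q w x).2 i' = (ancBlocks q w y).2 i'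
  · have h1 : ∏ i' : {i' // i' ≠ i}, (1 : Op (Bits w)) ((ancBlocks q w x).2 i')
        ((ancBlocks q w y).2 i') = 1 :=
      Finset.prod_eq_one fun i' _ => by rw [h.2 i' i'.2, Matrix.one_apply_eq]
    rw [h1, h.1, Matrix.one_apply_eq, one_mul, mul_one]
    refine if_congr ⟨fun hh j hj => hh (blk i j) fun k hk => hj k (blk_inj.1 hk).2,
      fun hh => forall_wires.2 ⟨fun k _ => congrFun h.1 k, fun i' j hj => ?_⟩⟩ rfl rfl
    by_cases hi : i' = i
    · subst hi
      exact hh j fun k hk => hj k (by rw [hk])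
    · exact congrFun (h.2 i' hi) j
  · rw [if_neg]
    · by_cases h4 : (ancBlocks q w x).1 = (ancBlocks q w y).1
      · have : ∃ i', i' ≠ i ∧ (ancBlocks q w x).2 i' ≠ (ancBlocks q w y).2 i' := by
          by_contra hcon
          push Not at hcon
          exact h ⟨h4, hcon⟩
        obtain ⟨i', hi, hne⟩ := this
        have h0 : ∏ i' : {i' // i' ≠ i}, (1 : Op (Bits w)) ((ancBlocks q w x).2 i')
            ((ancBlocks q w y).2 i') = 0 :=
          Finset.prod_eq_zero (Finset.mem_univ ⟨i', hi⟩) (Matrix.one_apply_ne hne)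
        rw [h0, mul_zero, mul_zero]
      · rw [Matrix.one_apply_ne h4, zero_mul]
    · intro hh
      refine h ⟨funext fun k => hh _ fun j => (anc_ne_blk _ _ _).symm, fun i' hi => funext fun j =>
        hh _ fun k hk => hi (blk_inj.1 hk).1.symm⟩

theorem Gate.shift_unitary {𝒢 : GateSet} {q w : ℕ} (i : Fin q) (g : Gate 𝒢 w) :
    (g.shift i).unitary = blockOp (Function.update (fun _ => 1) i g.unitary) :=
  onWires_trans_blk i _ _

theorem gatesUnitary_append {𝒢 : GateSet} {w : ℕ} (a b : List (Gate 𝒢 w)) :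
    gatesUnitary (a ++ b) = gatesUnitary b * gatesUnitary a := by
  induction a with
  | nil => simp [gatesUnitary]
  | cons g a ih => rw [List.cons_append, gatesUnitary, gatesUnitary, ih, mul_assoc]

theorem gatesUnitary_map_shift {𝒢 : GateSet} {q w : ℕ} (i : Fin q) (gs : List (Gate 𝒢 w)) :
    gatesUnitary (gs.map (Gate.shift i)) =
      blockOp (Function.update (fun _ => 1) i (gatesUnitary gs)) := by
  induction gs with
  | nil =>
    rw [List.map_nil, gatesUnitary, gatesUnitary, ← blockOp_one, Function.update_eq_self_iff.2 rfl]
  | cons g gs ih =>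
    rw [List.map_cons, gatesUnitary, gatesUnitary, ih, Gate.shift_unitary, blockOp_mul]
    congr 1
    funext i'
    by_cases h : i' = i
    · subst h; simp
    · simp [Function.update_of_ne h]

/-- `Nodup` ensures that no block receives the circuit twice. -/
theorem gatesUnitary_flatten_shift {𝒢 : GateSet} {q w : ℕ} (gs : List (Gate 𝒢 w))
    {l : List (Fin q)} (hl : l.Nodup) :
    gatesUnitary (l.map fun i => gs.map (Gate.shift i)).flatten =
      blockOp fun i => if i ∈ l then gatesUnitary gs else 1 := by
  induction l with
  | nil => simp [gatesUnitary, blockOp_one]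
  | cons i l ih =>
    rw [List.nodup_cons] at hl
    rw [List.map_cons, List.flatten_cons, gatesUnitary_append, ih hl.2, gatesUnitary_map_shift,
      blockOp_mul]
    congr 1
    funext i'
    by_cases h : i' = i
    · subst h; simp [hl.1]
    · simp [h]

/-! ### The preparation circuit -/

section Prep

variable {𝒢 : GateSet} (hH : 𝒢.Contains hadamard) (hC : 𝒢.Contains cnot) {n : ℕ}
  (A : Circuit 𝒢 (Fin 1) (Fin n)) (q : ℕ)

/-- A single wire. -/
def single {w : ℕ} (j : Fin w) : Fin 1 ↪ Fin w := ⟨fun _ => j, fun _ _ _ => Subsingleton.elim _ _⟩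

@[simp] theorem single_apply {w : ℕ} (j : Fin w) (i : Fin 1) : single j i = j := rfl

/-- A pair of distinct wires. -/
def pair {w : ℕ} (i j : Fin w) (h : i ≠ j) : Fin 2 ↪ Fin w :=
  ⟨![i, j], fun a b => by
    fin_cases a <;> fin_cases b <;> simp [h, h.symm]⟩

/-- Prepares `∑ |s s s b⟩ / 2` on the ancillas. -/
def ancGates (m : ℕ) : List (Gate 𝒢 (4 + m)) :=
  [hH.gate (single (anc 2)), hH.gate (single (anc 3)),
    hC.gate (pair (anc 2) (anc 0) (by rw [Ne, anc_inj]; decide)),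
    hC.gate (pair (anc 2) (anc 1) (by rw [Ne, anc_inj]; decide))]

/-- Copies the last ancilla to wire `r` of block `i`. -/
def copyGate {w : ℕ} (r : Fin w) (i : Fin q) : Gate 𝒢 (4 + q * w) :=
  hC.gate (pair (anc 3) (blk i r) (anc_ne_blk _ _ _))

/-- The output wires. -/
def prepOut : Fin (q * n + 1 + 1) ↪ Fin (4 + q * A.wires) :=
  ⟨Fin.snoc (Fin.cons (anc 0) fun r => blk (finProdFinEquiv.symm r).1
    (A.out (finProdFinEquiv.symm r).2) : Fin (q * n + 1) → Fin (4 + q * A.wires)) (anc 1), by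
    intro a b
    refine Fin.lastCases ?_ (fun a => Fin.cases ?_ (fun a => ?_) a) a <;>
      refine Fin.lastCases ?_ (fun b => Fin.cases ?_ (fun b => ?_) b) b <;>
      simp only [Fin.snoc_castSucc, Fin.snoc_last, Fin.cons_zero, Fin.cons_succ, anc_inj, blk_inj,
        anc_ne_blk, (anc_ne_blk _ _ _).symm, A.out.injective.eq_iff, IsEmpty.forall_iff, imp_true_iff,
        Fin.reduceEq]
    intro h
    rw [finProdFinEquiv.symm.injective (Prod.ext h.1 h.2)]⟩

/-- The gates of `prep`. -/
def prepGates : List (Gate 𝒢 (4 + q * A.wires)) :=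
  ancGates hH hC (q * A.wires) ++ ((List.finRange q).map (copyGate hC q (A.inp 0)) ++
    ((List.finRange q).map fun i => A.gates.map (Gate.shift i)).flatten)

/-- Prepares `¼ (Φ⁺ + Φ⁻) ⊗ (ρ₀^{⊗ q} + ρ₁^{⊗ q})`, where `A` prepares `ρ_b` from the bit `b`. -/
def prep : Circuit 𝒢 (Fin 0) (Fin (q * n + 1 + 1)) where
  wires := 4 + q * A.wires
  inp := ⟨Fin.elim0, fun a => a.elim0⟩
  out := prepOut A q
  gates := prepGates hH hC A q

/-- Ancilla 2 becomes the uniform bit s, copied by the CNOTs to ancillas 0 and 1, the future pair;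
ancilla 3 becomes the uniform bit b. The entry 1/2 is the product of the two Hadamard amplitudes. -/
theorem ancGates_mulVec (m : ℕ) (x : Bits (4 + m)) :
    (gatesUnitary (ancGates hH hC m) *ᵥ fun y => if y = fun _ => false then 1 else 0) x =
      if x (anc 0) = x (anc 2) ∧ x (anc 1) = x (anc 2) ∧ ∀ r, x (Fin.natAdd 4 r) = false
      then 1 / 2 else 0 := by
  have hv1 : (onWires hadamard (single (anc 2)) *ᵥ
      fun y : Bits (4 + m) => if y = fun _ => false then (1 : ℂ) else 0) =
      fun y => if ∀ j, j ≠ anc 2 → y j = false then (((Real.sqrt 2)⁻¹ : ℝ) : ℂ) else 0 := by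
    funext y
    rw [onWires_hadamard_mulVec, Fintype.sum_bool, if_neg, mul_zero, zero_add, hadamard_apply_false,
      mul_ite, mul_one, mul_zero]
    · refine if_congr ⟨fun h j hj => ?_, fun h => funext fun j => ?_⟩ rfl rfl
      · have := congrFun h j
        rwa [Function.update_of_ne (by simpa using hj)] at this
      · by_cases hj : j = anc 2
        · subst hj; exact Function.update_self _ _ _
        · rw [Function.update_of_ne (by simpa using hj), h j hj]
    · intro h
      have := congrFun h (single (anc 2) 0)
      simp at this
  have hv2 : (onWires hadamard (single (anc 3)) *ᵥ fun y : Bits (4 + m) =>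
      if ∀ j, j ≠ anc 2 → y j = false then (((Real.sqrt 2)⁻¹ : ℝ) : ℂ) else 0) =
      fun y => if ∀ j, j ≠ anc 2 → j ≠ anc 3 → y j = false then (1 / 2 : ℂ) else 0 := by
    funext y
    rw [onWires_hadamard_mulVec, Fintype.sum_bool, if_neg, mul_zero, zero_add, hadamard_apply_false,
      mul_ite, inv_sqrt_two_mul_self, mul_zero]
    · refine if_congr ⟨fun h j hj hj' => ?_, fun h j hj => ?_⟩ rfl rfl
      · have := h j hj
        rwa [Function.update_of_ne (by simpa using hj')] at this
      · by_cases hj' : j = anc 3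
        · subst hj'; exact Function.update_self _ _ _
        · rw [Function.update_of_ne (by simpa using hj'), h j hj hj']
    · intro h
      have := h (anc 3) (by rw [Ne, anc_inj]; decide)
      simp at this
  simp only [ancGates, gatesUnitary, one_mul, GateSet.Contains.gate_unitary, ← Matrix.mulVec_mulVec]
  rw [hv1, hv2, onWires_cnot_mulVec, onWires_cnot_mulVec]
  have hp0 : ∀ h, pair (anc 2 : Fin (4 + m)) (anc 0) h 0 = anc 2 := fun _ => rfl
  have hp1 : ∀ h, pair (anc 2 : Fin (4 + m)) (anc 0) h 1 = anc 0 := fun _ => rfl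
  have hp2 : ∀ h, pair (anc 2 : Fin (4 + m)) (anc 1) h 0 = anc 2 := fun _ => rfl
  have hp3 : ∀ h, pair (anc 2 : Fin (4 + m)) (anc 1) h 1 = anc 1 := fun _ => rfl
  simp only [hp0, hp1, hp2, hp3]
  have hne : ∀ {a b : Fin 4}, a ≠ b → (anc a : Fin (4 + m)) ≠ anc b := fun h => by
    rwa [Ne, anc_inj]
  have hne' : ∀ (a : Fin 4) (r : Fin m), Fin.natAdd 4 r ≠ anc a := fun a r h => by
    have := congrArg Fin.val h
    simp only [anc, Fin.val_castAdd, Fin.val_natAdd] at this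
    omega
  rw [Function.update_of_ne (hne (by decide : (0 : Fin 4) ≠ 1)),
    Function.update_of_ne (hne (by decide : (2 : Fin 4) ≠ 1))]
  refine if_congr ⟨fun h => ⟨?_, ?_, fun r => ?_⟩, fun h => ?_⟩ rfl rfl
  · have := h (anc 0) (hne (by decide)) (hne (by decide))
    rw [Function.update_self] at this
    simpa using this
  · have := h (anc 1) (hne (by decide)) (hne (by decide))
    rw [Function.update_of_ne (hne (by decide)), Function.update_self] at this
    simpa using this
  · have := h (Fin.natAdd 4 r) (hne' _ _) (hne' _ _)
    rwa [Function.update_of_ne (hne' _ _), Function.update_of_ne (hne' _ _)] at this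
  · intro j
    refine Fin.addCases (fun k => ?_) (fun r => ?_) j
    · change (anc k : Fin (4 + m)) ≠ _ → _
      intro h2 h3
      change Function.update (Function.update x (anc 1) _) (anc 0) _ (anc k) = false
      fin_cases k
      · refine (Function.update_self _ _ _).trans ?_
        rw [h.1]; simp
      · refine (Function.update_of_ne (hne (by decide)) _ _).trans ?_
        refine (Function.update_self _ _ _).trans ?_
        rw [h.2.1]; simp
      · exact absurd rfl h2
      · exact absurd rfl h3
    · intro _ _
      rw [Function.update_of_ne (hne' _ _), Function.update_of_ne (hne' _ _)]
      exact h.2.2 r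

/-- The control wire is never a target, so all the CNOTs read the same bit; a repeated block would
cancel its own copy. -/
theorem copyGates_mulVec {w : ℕ} (r : Fin w) {l : List (Fin q)} (hl : l.Nodup)
    (v : Bits (4 + q * w) → ℂ) (x : Bits (4 + q * w)) :
    (gatesUnitary (l.map (copyGate hC q r)) *ᵥ v) x =
      v fun j => if ∃ i ∈ l, j = blk i r then xor (x j) (x (anc 3)) else x j := by
  induction l generalizing v with
  | nil => simp [gatesUnitary]
  | cons i l ih =>
    rw [List.nodup_cons] at hl
    rw [List.map_cons, gatesUnitary, ← Matrix.mulVec_mulVec, ih hl.2, copyGate,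
      GateSet.Contains.gate_unitary, onWires_cnot_mulVec]
    have hp0 : ∀ h, pair (anc 3) (blk i r) h 0 = anc 3 := fun _ => rfl
    have hp1 : ∀ h, pair (anc 3) (blk i r) h 1 = blk i r := fun _ => rfl
    simp only [hp0, hp1]
    have h1 : ¬ ∃ i' ∈ l, blk i r = blk i' r := by
      rintro ⟨i', hi', h⟩
      exact hl.1 ((blk_inj.1 h).1 ▸ hi')
    have h2 : ¬ ∃ i' ∈ l, anc 3 = blk i' r := by
      rintro ⟨i', -, h⟩
      exact anc_ne_blk _ _ _ h
    rw [if_neg h1, if_neg h2]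
    congr 1
    funext j
    by_cases hj : j = blk i r
    · subst hj
      rw [Function.update_self, if_pos ⟨i, by simp, rfl⟩]
    · rw [Function.update_of_ne hj]
      refine if_congr ?_ rfl rfl
      simp [hj]

/-- The input of a block: the bit `b` on wire `r`. -/
def inputVec {w : ℕ} (r : Fin w) (b : Bool) : Bits w → ℂ :=
  fun y => if y = fun j => decide (j = r) && b then 1 else 0

theorem prod_inputVec {w q : ℕ} (r : Fin w) (b : Bool) (f : Fin q → Bits w) :
    ∏ i, inputVec r b (f i) = if ∀ i, f i = fun j => decide (j = r) && b then 1 else 0 := by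
  simp only [inputVec]
  rw [Finset.prod_ite_zero]
  simp

/-- After the copying, each block is in the basis state encoding the bit on ancilla 3. The final
vector is therefore a superposition over ancilla strings of q identical outputs of A. -/
theorem prepGates_mulVec : (gatesUnitary (prepGates hH hC A q) *ᵥ
      fun y => if y = fun _ => false then 1 else 0) = fun x =>
      (fun p : Bits 4 => if p 0 = p 2 ∧ p 1 = p 2 then (1 / 2 : ℂ) else 0)
        (ancBlocks q A.wires x).1 * ∏ i, (gatesUnitary A.gates *ᵥ
          inputVec (A.inp 0) ((ancBlocks q A.wires x).1 3)) ((ancBlocks q A.wires x).2 i) := by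
  funext x
  rw [prepGates, gatesUnitary_append, gatesUnitary_append, ← Matrix.mulVec_mulVec,
    ← Matrix.mulVec_mulVec, gatesUnitary_flatten_shift _ (List.nodup_finRange q)]
  simp only [List.mem_finRange, if_true]
  rw [← blockOp_mulVec (fun _ => gatesUnitary A.gates)
    (fun p : Bits 4 => if p 0 = p 2 ∧ p 1 = p 2 then (1 / 2 : ℂ) else 0)
    (fun p _ => inputVec (A.inp 0) (p 3))]
  congr 2
  funext y
  rw [copyGates_mulVec _ _ _ (List.nodup_finRange q), ancGates_mulVec]
  have ha : ∀ k : Fin 4, ¬ ∃ i ∈ List.finRange q, anc k = blk i (A.inp 0) := by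
    rintro k ⟨i, -, h⟩
    exact anc_ne_blk _ _ _ h
  simp only [ha, if_false]
  by_cases h : y (anc 0) = y (anc 2) ∧ y (anc 1) = y (anc 2)
  · have hp : (if (ancBlocks q A.wires y).1 0 = (ancBlocks q A.wires y).1 2 ∧
        (ancBlocks q A.wires y).1 1 = (ancBlocks q A.wires y).1 2 then (1 / 2 : ℂ) else 0) = 1 / 2 :=
      if_pos h
    rw [hp]
    simp only [h.1, h.2, true_and, prod_inputVec, ancBlocks_fst, mul_ite, mul_one, mul_zero]
    refine if_congr ⟨fun hh i => funext fun j => ?_, fun hh r => ?_⟩ rfl rfl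
    · have := hh (finProdFinEquiv (i, j))
      rw [ancBlocks_snd]
      rw [← blk_apply] at this
      by_cases hj : j = A.inp 0
      · subst hj
        rw [if_pos ⟨i, by simp, rfl⟩] at this
        simpa using this
      · rw [if_neg] at this
        · simp [hj, this]
        · rintro ⟨i', -, e⟩
          exact hj (blk_inj.1 e).2
    · obtain ⟨⟨i, j⟩, rfl⟩ := finProdFinEquiv.surjective r
      rw [← blk_apply]
      have := congrFun (hh i) j
      rw [ancBlocks_snd] at this
      by_cases hj : j = A.inp 0
      · subst hj
        rw [if_pos ⟨i, by simp, rfl⟩]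
        simpa using this
      · rw [if_neg]
        · simpa [hj] using this
        · rintro ⟨i', -, e⟩
          exact hj (blk_inj.1 e).2
  · have hp : (if (ancBlocks q A.wires y).1 0 = (ancBlocks q A.wires y).1 2 ∧
        (ancBlocks q A.wires y).1 1 = (ancBlocks q A.wires y).1 2 then (1 / 2 : ℂ) else 0) = 0 :=
      if_neg h
    rw [hp, zero_mul, if_neg fun hh => h ⟨hh.1, hh.2.1⟩]

end Prep

theorem ite_eq_ite_of_iff {α : Type} {p q : Prop} (ip : Decidable p) (iq : Decidable q) (h : p ↔ q)
    (a b : α) : @ite α p ip a b = @ite α q iq a b := by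
  by_cases hp : p
  · rw [if_pos hp, if_pos (h.1 hp)]
  · rw [if_neg hp, if_neg fun hq => hp (h.2 hq)]

/-! ### The output state of the preparation circuit -/

section Prep

variable {𝒢 : GateSet} (hH : 𝒢.Contains hadamard) (hC : 𝒢.Contains cnot) {n : ℕ}
  (A : Circuit 𝒢 (Fin 1) (Fin n)) (q : ℕ)

theorem conj_vecMulVec {w : ℕ} (U : Op (Bits w)) (v : Bits w → ℂ) :
    U * vecMulVec v (star v) * U.conjTranspose = vecMulVec (U *ᵥ v) (star (U *ᵥ v)) := by
  rw [mul_vecMulVec, vecMulVec_mul, star_mulVec]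

theorem apply_basisState_eq (b : Bool) : A.apply (basisState fun _ => b) =
    traceOut A.out (vecMulVec (gatesUnitary A.gates *ᵥ inputVec (A.inp 0) b)
      (star (gatesUnitary A.gates *ᵥ inputVec (A.inp 0) b))) := by
  rw [Circuit.apply_eq, ← conj_vecMulVec]
  congr 3
  ext x y
  have key : ∀ z : Bits A.wires, (z = fun j => decide (j = A.inp 0) && b) ↔
      (∀ j, (∀ i, A.inp i ≠ j) → z j = false) ∧ (fun i => z (A.inp i)) = fun _ => b := by
    intro z
    constructor
    · rintro rfl
      refine ⟨fun j hj => ?_, funext fun i => ?_⟩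
      · simp [Ne.symm (hj 0)]
      · simp [Subsingleton.elim i 0]
    · rintro ⟨h1, h2⟩
      funext j
      by_cases hj : j = A.inp 0
      · subst hj; simpa using congrFun h2 0
      · rw [h1 j fun i => by rw [Subsingleton.elim i 0]; exact Ne.symm hj]
        simp [hj]
  simp only [initialize0, basisState, Matrix.of_apply, vecMulVec_apply, inputVec, Pi.star_apply,
    apply_ite star, star_one, star_zero, mul_ite, mul_one, mul_zero, ← ite_and]
  refine ite_eq_ite_of_iff _ _ ?_ _ _
  rw [key, key]
  constructor
  · rintro ⟨h, hx, hy⟩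
    exact ⟨⟨fun j hj => (h j hj).2, hy⟩, fun j hj => (h j hj).1, hx⟩
  · rintro ⟨⟨h, hy⟩, h', hx⟩
    exact ⟨fun j hj => ⟨h' j hj, h j hj⟩, hx, hy⟩

theorem sum_bits_four (F : Bits 4 → ℂ) : ∑ p, F p = ∑ a, ∑ b, ∑ c, ∑ d, F ![a, b, c, d] := by
  simp only [← (Fin.consEquiv (fun _ => Bool)).sum_comp, Fintype.sum_prod_type,
    Finset.univ_unique, Finset.sum_singleton]
  rfl

/-- Tracing out ancilla 2 identifies the value of s on both sides, which kills the coherence of the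
pair. Tracing out ancilla 3 keeps only equal values of b. The amplitude 1/2 enters squared. -/
theorem sum_ancillas (T : Bool → Bool → ℂ) (x0 x1 y0 y1 : Bool) :
    (∑ p : Bits 4, ∑ p' : Bits 4,
      if (p 0 = x0 ∧ p 1 = x1) ∧ (p' 0 = y0 ∧ p' 1 = y1) ∧ p 2 = p' 2 ∧ p 3 = p' 3 then
        (if p 0 = p 2 ∧ p 1 = p 2 then (1 / 2 : ℂ) else 0) *
          star (if p' 0 = p' 2 ∧ p' 1 = p' 2 then (1 / 2 : ℂ) else 0) * T (p 3) (p' 3) else 0) =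
      if x0 = x1 ∧ y0 = y1 ∧ x0 = y0 then 1 / 4 * ∑ b, T b b else 0 := by
  simp only [sum_bits_four, Matrix.cons_val, and_assoc, ite_and, ← ite_sum_zero]
  have h2 : (starRingEnd ℂ) 2 = 2 := map_ofNat _ _
  cases x0 <;> cases x1 <;> cases y0 <;> cases y1 <;> simp [h2] <;> ring

theorem prepOut_last : prepOut A q (Fin.last _) = anc 1 := by simp [prepOut]

theorem prepOut_zero : prepOut A q (Fin.castSucc 0) = anc 0 := by
  have key : ∀ r : Fin (q * n + 1), prepOut A q (Fin.castSucc r) = (Fin.cons (anc 0) fun r =>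
      blk (finProdFinEquiv.symm r).1 (A.out (finProdFinEquiv.symm r).2) :
        Fin (q * n + 1) → Fin (4 + q * A.wires)) r := fun r =>
    Fin.snoc_castSucc (α := fun _ => Fin (4 + q * A.wires)) _ _ r
  rw [key, Fin.cons_zero]

theorem prepOut_block (i : Fin q) (j : Fin n) :
    prepOut A q (Fin.castSucc (Fin.succ (finProdFinEquiv (i, j)))) = blk i (A.out j) := by
  refine (Fin.snoc_castSucc (α := fun _ => Fin (4 + q * A.wires)) _ _ (Fin.succ _)).trans ?_
  rw [Fin.cons_succ, Equiv.symm_apply_apply]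

theorem forall_prepOut {P : Fin (q * n + 1 + 1) → Prop} : (∀ r, P r) ↔
    P (Fin.castSucc 0) ∧ P (Fin.last _) ∧ ∀ i j, P (Fin.castSucc (Fin.succ (finProdFinEquiv (i, j)))) := by
  refine ⟨fun h => ⟨h _, h _, fun i j => h _⟩, fun h r => ?_⟩
  refine Fin.lastCases h.2.1 (fun r => Fin.cases h.1 (fun r => ?_) r) r
  obtain ⟨⟨i, j⟩, rfl⟩ := finProdFinEquiv.surjective r
  exact h.2.2 i j

theorem sum_ancBlocks {q w : ℕ} (G : Bits (4 + q * w) → Bits (4 + q * w) → ℂ) :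
    ∑ z, ∑ z', G z z' = ∑ p, ∑ p', ∑ f, ∑ f', G ((ancBlocks q w).symm (p, f))
      ((ancBlocks q w).symm (p', f')) := by
  rw [← (ancBlocks q w).symm.sum_comp, Fintype.sum_prod_type]
  refine Finset.sum_congr rfl fun p _ => ?_
  rw [Finset.sum_comm]
  rw [← (ancBlocks q w).symm.sum_comp, Fintype.sum_prod_type]
  refine Finset.sum_congr rfl fun p' _ => ?_
  exact Finset.sum_comm

/-- The partial trace of the final state of `prep`, block by block. -/
theorem traceOut_prepOut (c : Bits 4 → ℂ) (u : Bool → Bits A.wires → ℂ)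
    (x y : Bits (q * n + 1 + 1)) :
    traceOut (prepOut A q) (vecMulVec
      (fun z => c (ancBlocks q A.wires z).1 * ∏ i, u ((ancBlocks q A.wires z).1 3) ((ancBlocks q A.wires z).2 i))
      (star fun z => c (ancBlocks q A.wires z).1 *
        ∏ i, u ((ancBlocks q A.wires z).1 3) ((ancBlocks q A.wires z).2 i))) x y =
    ∑ p : Bits 4, ∑ p' : Bits 4,
      if (p 0 = x (Fin.castSucc 0) ∧ p 1 = x (Fin.last _)) ∧
        (p' 0 = y (Fin.castSucc 0) ∧ p' 1 = y (Fin.last _)) ∧ p 2 = p' 2 ∧ p 3 = p' 3 then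
      c p * star (c p') * ∏ i, traceOut A.out (vecMulVec (u (p 3)) (star (u (p' 3))))
        (fun j => x (Fin.castSucc (Fin.succ (finProdFinEquiv (i, j)))))
        (fun j => y (Fin.castSucc (Fin.succ (finProdFinEquiv (i, j))))) else 0 := by
  rw [traceOut, Matrix.of_apply, sum_ancBlocks]
  refine Finset.sum_congr rfl fun p _ => Finset.sum_congr rfl fun p' _ => ?_
  -- The condition of the partial trace splits into one on the ancillas, where 0 and 1 are output
  -- and 2 and 3 traced out, and one for each block separately.
  have hcond : ∀ f f' : Fin q → Bits A.wires,
      ((∀ r, (ancBlocks q A.wires).symm (p, f) (prepOut A q r) = x r) ∧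
        (∀ r, (ancBlocks q A.wires).symm (p', f') (prepOut A q r) = y r) ∧
        ∀ j, (∀ r, prepOut A q r ≠ j) → (ancBlocks q A.wires).symm (p, f) j =
          (ancBlocks q A.wires).symm (p', f') j) ↔
      ((p 0 = x (Fin.castSucc 0) ∧ p 1 = x (Fin.last _)) ∧
        (p' 0 = y (Fin.castSucc 0) ∧ p' 1 = y (Fin.last _)) ∧ p 2 = p' 2 ∧ p 3 = p' 3) ∧
      ∀ i, (∀ j, f i (A.out j) = x (Fin.castSucc (Fin.succ (finProdFinEquiv (i, j))))) ∧
        (∀ j, f' i (A.out j) = y (Fin.castSucc (Fin.succ (finProdFinEquiv (i, j))))) ∧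
        ∀ j, (∀ k, A.out k ≠ j) → f i j = f' i j := by
    intro f f'
    have ha : ∀ (p : Bits 4) (f : Fin q → Bits A.wires) k,
        (ancBlocks q A.wires).symm (p, f) (anc k) = p k := fun p f k =>
      (ancBlocks_fst ((ancBlocks q A.wires).symm (p, f)) k).symm.trans
        (by rw [Equiv.apply_symm_apply])
    have hb : ∀ (p : Bits 4) (f : Fin q → Bits A.wires) i j,
        (ancBlocks q A.wires).symm (p, f) (blk i j) = f i j := fun p f i j =>
      (ancBlocks_snd ((ancBlocks q A.wires).symm (p, f)) i j).symm.trans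
        (by rw [Equiv.apply_symm_apply])
    simp only [forall_prepOut, forall_wires (q := q), prepOut_zero, prepOut_last, prepOut_block, ha, hb]
    have h4 : (∀ k : Fin 4, ((anc 0 : Fin (4 + q * A.wires)) ≠ anc k ∧
        (anc 1 : Fin (4 + q * A.wires)) ≠ anc k ∧ ∀ (i : Fin q) (j : Fin n),
          blk i (A.out j) ≠ anc k) → p k = p' k) ↔ p 2 = p' 2 ∧ p 3 = p' 3 := by
      simp only [Ne, anc_inj, (anc_ne_blk _ _ _).symm, not_false_iff, implies_true, and_true]
      constructor
      · intro h; exact ⟨h 2 (by decide), h 3 (by decide)⟩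
      · rintro ⟨h2, h3⟩ k
        fin_cases k <;> simp [h2, h3]
    have hblk : ∀ i (j : Fin A.wires), (((anc 0 : Fin (4 + q * A.wires)) ≠ blk i j ∧
        (anc 1 : Fin (4 + q * A.wires)) ≠ blk i j ∧ ∀ (i' : Fin q) (j' : Fin n),
          blk i' (A.out j') ≠ blk i j) → f i j = f' i j) ↔
        ((∀ k, A.out k ≠ j) → f i j = f' i j) := by
      intro i j
      refine imp_congr_left ⟨fun h k hk => h.2.2 i k (by rw [hk]), fun h =>
        ⟨anc_ne_blk _ _ _, anc_ne_blk _ _ _, fun i' j' e => h j' (blk_inj.1 e).2⟩⟩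
    simp only [h4, hblk]
    constructor
    · rintro ⟨⟨h1, h2, h3⟩, ⟨h4, h5, h6⟩, h7, h8⟩
      exact ⟨⟨⟨h1, h2⟩, ⟨h4, h5⟩, h7⟩, fun i => ⟨h3 i, h6 i, h8 i⟩⟩
    · rintro ⟨⟨⟨h1, h2⟩, ⟨h4, h5⟩, h7⟩, h⟩
      exact ⟨⟨h1, h2, fun i => (h i).1⟩, ⟨h4, h5, fun i => (h i).2.1⟩, h7, fun i => (h i).2.2⟩
  simp only [hcond, ite_and (_ ∧ _) (∀ _, _), vecMulVec_apply, Equiv.apply_symm_apply, Pi.star_apply,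
    star_mul', star_prod]
  split_ifs with h
  · simp only [traceOut, Matrix.of_apply, vecMulVec_apply, Pi.star_apply, Fintype.prod_sum,
      Finset.mul_sum]
    refine Finset.sum_congr rfl fun f _ => Finset.sum_congr rfl fun f' _ => ?_
    by_cases hall : ∀ i, (∀ j, f i (A.out j) = x (Fin.castSucc (Fin.succ (finProdFinEquiv (i, j))))) ∧
        (∀ j, f' i (A.out j) = y (Fin.castSucc (Fin.succ (finProdFinEquiv (i, j))))) ∧
        ∀ j, (∀ k, A.out k ≠ j) → f i j = f' i j
    · rw [if_pos hall]
      refine Eq.trans ?_ (congrArg (c p * star (c p') * ·)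
        (Finset.prod_congr rfl fun i _ => (if_pos (hall i)).symm))
      simp only [Finset.prod_mul_distrib]
      ring
    · rw [if_neg hall]
      push Not at hall
      obtain ⟨i, hi⟩ := hall
      refine ((congrArg (c p * star (c p') * ·) (Finset.prod_eq_zero (Finset.mem_univ i)
        (if_neg fun h => ?_))).trans (mul_zero _)).symm
      obtain ⟨j, hj, hne⟩ := hi h.1 h.2.1
      exact hne (h.2.2 j hj)
  · simp

/-- The coherences of Φ⁺ and Φ⁻ have opposite signs and cancel, leaving |00⟩⟨00| + |11⟩⟨11|. -/
theorem psiState_apply {N : ℕ} (ρ₀ ρ₁ : Op (Bits N)) (x y : Bits (N + 1) × Bits 1) :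
    psiState ρ₀ ρ₁ x y = if x.1 0 = x.2 0 ∧ y.1 0 = y.2 0 ∧ x.1 0 = y.1 0 then
      1 / 4 * (ρ₀ (fun i => x.1 i.succ) (fun i => y.1 i.succ) +
        ρ₁ (fun i => x.1 i.succ) (fun i => y.1 i.succ)) else 0 := by
  simp only [psiState, attach, phiPlus, phiMinus, Matrix.smul_apply, Matrix.of_apply,
    Matrix.add_apply, smul_eq_mul]
  generalize x.1 0 = a
  generalize x.2 0 = b
  generalize y.1 0 = c
  generalize y.2 0 = d
  cases a <;> cases b <;> cases c <;> cases d <;> norm_num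

theorem initialize0_empty {w : ℕ} (e : Fin 0 ↪ Fin w) : initialize0 e (1 : Op (Bits 0)) =
    vecMulVec (fun y : Bits w => if y = fun _ => false then 1 else 0)
      (star fun y => if y = fun _ => false then 1 else 0) := by
  ext x y
  simp only [initialize0, Matrix.of_apply, vecMulVec_apply, Pi.star_apply, apply_ite star,
    star_one, star_zero, mul_ite, mul_one, mul_zero, ← ite_and]
  have h1 : (1 : Op (Bits 0)) (fun i => x (e i)) (fun i => y (e i)) = 1 := by
    rw [Subsingleton.elim (fun i => x (e i)) (fun i => y (e i)), Matrix.one_apply_eq]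
  rw [h1]
  refine ite_eq_ite_of_iff _ _ ?_ _ _
  constructor
  · exact fun h => ⟨funext fun j => (h j (fun i => i.elim0)).2,
      funext fun j => (h j (fun i => i.elim0)).1⟩
  · exact fun h j _ => ⟨congrFun h.2 j, congrFun h.1 j⟩

theorem prep_apply : (prep hH hC A q).apply 1 = joint (psiState
    (tensorPow q (A.apply (basisState fun _ => false)))
    (tensorPow q (A.apply (basisState fun _ => true)))) := by
  refine ((Circuit.apply_eq _ _).trans (congrArg (fun M => traceOut (prepOut A q)
    (gatesUnitary (prepGates hH hC A q) * M * (gatesUnitary (prepGates hH hC A q)).conjTranspose))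
    (initialize0_empty _))).trans ?_
  rw [conj_vecMulVec, prepGates_mulVec]
  ext x y
  refine (traceOut_prepOut A q (fun p : Bits 4 => if p 0 = p 2 ∧ p 1 = p 2 then (1 / 2 : ℂ) else 0)
    (fun b => gatesUnitary A.gates *ᵥ inputVec (A.inp 0) b) x y).trans ?_
  have hT : ∀ b, ∏ i, traceOut A.out (vecMulVec (gatesUnitary A.gates *ᵥ inputVec (A.inp 0) b)
      (star (gatesUnitary A.gates *ᵥ inputVec (A.inp 0) b)))
        (fun j => x (Fin.castSucc (Fin.succ (finProdFinEquiv (i, j)))))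
        (fun j => y (Fin.castSucc (Fin.succ (finProdFinEquiv (i, j))))) =
      tensorPow q (A.apply (basisState fun _ => b)) (fun r => x (Fin.castSucc (Fin.succ r)))
        (fun r => y (Fin.castSucc (Fin.succ r))) := by
    intro b
    rw [apply_basisState_eq]
    rfl
  have hj : joint (psiState (tensorPow q (A.apply (basisState fun _ => false)))
      (tensorPow q (A.apply (basisState fun _ => true)))) x y =
      if x (Fin.castSucc 0) = x (Fin.last _) ∧ y (Fin.castSucc 0) = y (Fin.last _) ∧
        x (Fin.castSucc 0) = y (Fin.castSucc 0) then
      1 / 4 * ∑ b, tensorPow q (A.apply (basisState fun _ => b))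
        (fun r => x (Fin.castSucc (Fin.succ r))) (fun r => y (Fin.castSucc (Fin.succ r))) else 0 := by
    rw [Fintype.sum_bool, add_comm (tensorPow q (A.apply (basisState fun _ => true)) _ _)]
    exact psiState_apply _ _ _ _
  rw [hj]
  simp only [← hT]
  exact sum_ancillas (fun b b' => ∏ i, traceOut A.out
    (vecMulVec (gatesUnitary A.gates *ᵥ inputVec (A.inp 0) b)
      (star (gatesUnitary A.gates *ᵥ inputVec (A.inp 0) b')))
        (fun j => x (Fin.castSucc (Fin.succ (finProdFinEquiv (i, j)))))
        (fun j => y (Fin.castSucc (Fin.succ (finProdFinEquiv (i, j)))))) _ _ _ _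

end Prep

/-! ### Separability of ψ and its creation without EPR pairs -/

/-- The operator `|s⟩⟨s|` on one qubit. -/
def bitState (s : Bool) : Op Bool := vecMulVec (Pi.single s 1) (star (Pi.single s 1))

theorem bitState_apply (s a b : Bool) : bitState s a b = if a = s ∧ b = s then 1 else 0 := by
  cases s <;> cases a <;> cases b <;> simp [bitState, vecMulVec_apply]

theorem bitState_isDensity (s : Bool) : IsDensity (bitState s) :=
  isDensity_vecMulVec (by simp)

/-- The first qubit of a register and the others. -/
def consBits (N : ℕ) : Bits (N + 1) ≃ Bool × Bits N := (Fin.consEquiv fun _ => Bool).symm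

/-- The pair is a shared uniform classical bit, so ψ is an equal mixture of two products, one for
each value of the bit. -/
theorem psiState_isSeparable {N : ℕ} {ρ₀ ρ₁ : Op (Bits N)} (h₀ : IsDensity ρ₀)
    (h₁ : IsDensity ρ₁) : IsSeparableState (psiState ρ₀ ρ₁) := by
  refine ⟨2, fun _ => 1 / 2,
    fun i => (bitState (i = 0) ⊗ₖ ((1 / 2 : ℂ) • (ρ₀ + ρ₁))).submatrix (consBits N) (consBits N),
    fun i => (bitState (i = 0)).submatrix (Equiv.funUnique (Fin 1) Bool)
      (Equiv.funUnique (Fin 1) Bool), fun i => ⟨by norm_num,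
        ((bitState_isDensity _).kronecker (h₀.half_add h₁)).submatrix _,
        (bitState_isDensity _).submatrix _⟩, by simp, ?_⟩
  ext x y
  have hc : ∀ x : Bits (N + 1), consBits N x = (x 0, fun i => x i.succ) := fun x => rfl
  rw [psiState_apply]
  simp only [Fin.sum_univ_two, Matrix.add_apply, Matrix.smul_apply, smul_eq_mul,
    kroneckerMap_apply, submatrix_apply, hc, Equiv.funUnique_apply, bitState_apply]
  generalize x.1 0 = a
  generalize y.1 0 = b
  rw [show (default : Fin 1) = 0 from rfl]
  generalize x.2 0 = c
  generalize y.2 0 = d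
  cases a <;> cases b <;> cases c <;> cases d <;> simp <;> ring

/-- A circuit without gates that outputs its input wires. -/
def wiring (𝒢 : GateSet) {ι o : Type} {w : ℕ} (e : ι ≃ Fin w) (f : o ≃ Fin w) : Circuit 𝒢 ι o where
  wires := w
  inp := e.toEmbedding
  out := f.toEmbedding
  gates := []

theorem wiring_apply (𝒢 : GateSet) {ι o : Type} [Fintype ι] [Fintype o] {w : ℕ} (e : ι ≃ Fin w)
    (f : o ≃ Fin w) (ρ : Op (ι → Bool)) (x y : o → Bool) :
    (wiring 𝒢 e f).apply ρ x y = ρ (fun i => x (f.symm (e i))) (fun i => y (f.symm (e i))) := by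
  have h1 : ∀ (z : Bits w) (x : o → Bool), (∀ i, z (f i) = x i) ↔ z = fun j => x (f.symm j) := by
    intro z x
    constructor
    · exact fun h => funext fun j => by rw [← h, f.apply_symm_apply]
    · rintro rfl i
      exact congrArg x (f.symm_apply_apply i)
  have h2 : ∀ j, ¬ ∀ i, f i ≠ j := fun j h => h (f.symm j) (f.apply_symm_apply j)
  have h3 : ∀ j, ¬ ∀ i, e i ≠ j := fun j h => h (e.symm j) (e.apply_symm_apply j)
  have h4 : (wiring 𝒢 e f).apply ρ x y = ∑ z : Bits w, ∑ z' : Bits w,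
      if (∀ i, z (f i) = x i) ∧ (∀ i, z' (f i) = y i) ∧ (∀ j, (∀ i, f i ≠ j) → z j = z' j) then
        (if ∀ j, (∀ i, e i ≠ j) → z j = false ∧ z' j = false then
          ρ (fun i => z (e i)) (fun i => z' (e i)) else 0) else 0 := rfl
  rw [h4]
  simp only [h1, h2, h3, IsEmpty.forall_iff, implies_true, and_true, if_true, ite_and]
  simp

theorem compCostLE_psiState (𝒢 : GateSet) {N : ℕ → ℕ} (ρ₀ ρ₁ : ∀ l, Op (Bits (N l)))
    (h : ∀ l, IsDensity (ρ₀ l) ∧ IsDensity (ρ₁ l))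
    (C : ∀ l, Circuit 𝒢 (Fin 0) (Fin (N l + 1 + 1)))
    (hC : ∀ l, (C l).apply 1 = joint (psiState (ρ₀ l) (ρ₁ l)))
    (hs : PolyBounded fun l => (C l).size) :
    CompCostLE 𝒢 (fun _ => 0) (fun l => psiState (ρ₀ l) (ρ₁ l)) (fun _ => 0) := by
  -- Alice prepares all of ψ, with the qubit of B in the place of the public register. It is
  -- measured and announced, and a gate-free circuit of one wire hands the bit to Bob.
  refine ⟨fun l => .alice ((C l).reindex (Equiv.equivOfIsEmpty _ _) finSumFinEquiv)
    (.bob (wiring 𝒢 (Equiv.emptySum (Fin 0) (Fin 1)) (Equiv.sumEmpty (Fin 1) (Fin 0))) .done),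
    (hs.add (PolyBounded.const 1)).mono fun l => le_of_eq rfl, fun l => ?_⟩
  have key : ∀ x y : Bits (N l + 1) × Bits 1, (CircuitLOCC.eval
      (.alice ((C l).reindex (Equiv.equivOfIsEmpty _ _) finSumFinEquiv)
        (.bob (wiring 𝒢 (Equiv.emptySum (Fin 0) (Fin 1)) (Equiv.sumEmpty (Fin 1) (Fin 0))) .done) :
        CircuitLOCC 𝒢 (N l + 1) 1 0 0 0) fun _ => eprPairs 0) x y = psiState (ρ₀ l) (ρ₁ l) x y := by
    intro x y
    have hA : ∀ (s : Bits 0) (s' : Bits 1) (u v : Bits 0), localA (((C l).reindex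
        (Equiv.equivOfIsEmpty (Fin 0 ⊕ Fin 0) (Fin 0)) finSumFinEquiv).instrument s s')
        (eprPairs 0) (x.1, u) (y.1, v) = psiState (ρ₀ l) (ρ₁ l) (x.1, s') (y.1, s') := by
      intro s s' u v
      have hx : ∀ z : Bits (N l + 1), (Sum.elim z s' : Fin (N l + 1) ⊕ Fin 1 → Bool) =
          Fin.append z s' ∘ finSumFinEquiv := by
        intro z
        funext i
        rcases i with i | i <;> simp
      simp only [localA, Circuit.instrument, of_apply]
      rw [hx, hx, Circuit.reindex_apply]
      have h1 : ∀ M : Op (Bits 0), (∀ a, M a a = 1) → M = 1 := by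
        intro M hM
        ext a b
        rw [Subsingleton.elim b a, hM, Matrix.one_apply_eq]
      refine (congrArg (fun M => (C l).apply M _ _) (h1 _ fun a => ?_)).trans ?_
      rotate_left
      · rw [hC]
        have h2 : ∀ z : Bits (N l + 1), ((fun i => Fin.append z s' (Fin.castAdd 1 i)),
            fun j => Fin.append z s' (Fin.natAdd (N l + 1) j)) = (z, s') := by
          intro z
          simp
        simp only [joint, of_apply, h2]
      · simp only [submatrix_apply, tensor, of_apply, basisState, eprPairs, Finset.univ_eq_empty,
          Finset.prod_empty, one_mul]
        exact if_pos ⟨Subsingleton.elim _ _, Subsingleton.elim _ _⟩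
    -- The measurement does no harm: entries of ψ that are off-diagonal in the qubit of B vanish.
    have hz : ∀ s' : Bits 1, psiState (ρ₀ l) (ρ₁ l) (x.1, s') (y.1, s') * basisState s' x.2 y.2 =
        if s' = x.2 then psiState (ρ₀ l) (ρ₁ l) x y else 0 := by
      intro s'
      simp only [basisState, of_apply, mul_ite, mul_one, mul_zero]
      by_cases h1 : x.2 = s'
      · subst h1
        rw [if_pos rfl]
        by_cases h2 : y.2 = x.2
        · rw [if_pos ⟨rfl, h2⟩, ← h2]
          nth_rw 1 [h2]
        · rw [if_neg fun h => h2 h.2, psiState_apply, if_neg]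
          rintro ⟨ha, hb, hc⟩
          exact h2 (funext fun i => by rw [Subsingleton.elim i 0, ← ha, ← hb, hc])
      · rw [if_neg fun h => h1 h.1, if_neg fun h => h1 h.symm]
    simp only [CircuitLOCC.eval, Finset.univ_unique, Finset.sum_singleton, Matrix.sum_apply]
    simp only [localB, Circuit.instrument, wiring_apply, tensor, of_apply]
    simp only [hA]
    refine (Finset.sum_congr rfl fun s' _ => hz s').trans ?_
    rw [Finset.sum_ite_eq', if_pos (Finset.mem_univ _)]
  rw [show CircuitLOCC.eval _ _ = psiState (ρ₀ l) (ρ₁ l) from Matrix.ext fun x y => key x y,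
    fidelity_self (psiState_isDensity (h l).1 (h l).2)]
  norm_num

/-! ### The description of the preparation circuit -/

/-- The description of wire number `j`. -/
def wireCode (j : ℕ) : List ℕ := 1 :: List.replicate j 0

theorem codeWires_eq {k w : ℕ} (e : Fin k ↪ Fin w) :
    codeWires e = (List.ofFn fun i => wireCode (e i)).flatten := rfl

/-- Adds `k` to the numbers of all the wires of a description. -/
def shiftCode (k : ℕ) (L : List ℕ) : List ℕ :=
  L.flatMap fun a => if a = 1 then 1 :: List.replicate k 0 else [a]

theorem shiftCode_append (k : ℕ) (L L' : List ℕ) :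
    shiftCode k (L ++ L') = shiftCode k L ++ shiftCode k L' := List.flatMap_append

theorem shiftCode_cons (k a : ℕ) (L : List ℕ) :
    shiftCode k (a :: L) = (if a = 1 then 1 :: List.replicate k 0 else [a]) ++ shiftCode k L :=
  List.flatMap_cons

theorem shiftCode_flatten (k : ℕ) (L : List (List ℕ)) :
    shiftCode k L.flatten = (L.map (shiftCode k)).flatten := by
  induction L with
  | nil => rfl
  | cons a L ih => rw [List.flatten_cons, shiftCode_append, ih, List.map_cons, List.flatten_cons]

theorem shiftCode_wireCode (k j : ℕ) : shiftCode k (wireCode j) = wireCode (k + j) := by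
  have h : ∀ j, shiftCode k (List.replicate j 0) = List.replicate j 0 := by
    intro j
    induction j with
    | zero => rfl
    | succ j ih => rw [List.replicate_succ, shiftCode_cons, ih]; rfl
  rw [wireCode, shiftCode_cons, h, if_pos rfl, wireCode, List.replicate_add]
  rfl

/-- Block i starts at wire 4 + w i, and wires are written in unary, so the move inserts that many
ticks after each wire marker. -/
theorem codeWires_trans_blk {q w k : ℕ} (i : Fin q) (e : Fin k ↪ Fin w) :
    codeWires (e.trans (blk i)) = shiftCode (4 + w * i) (codeWires e) := by
  rw [codeWires_eq, codeWires_eq, shiftCode_flatten, List.map_ofFn]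
  congr 2
  funext r
  rw [Function.comp_apply, shiftCode_wireCode, Function.Embedding.trans_apply, blk_apply]
  congr 1
  simp only [Fin.val_natAdd, finProdFinEquiv_apply_val]
  ring

theorem Gate.shift_code {𝒢 : GateSet} {q w : ℕ} (i : Fin q) (g : Gate 𝒢 w) :
    (g.shift i).code = shiftCode (4 + w * i) g.code := by
  rw [Gate.code, Gate.code, shiftCode_cons, if_neg (by omega), ← codeWires_trans_blk]
  rfl

theorem Gate.flatten_shift_code {𝒢 : GateSet} {q w : ℕ} (i : Fin q) (gs : List (Gate 𝒢 w)) :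
    ((gs.map (Gate.shift i)).map Gate.code).flatten =
      shiftCode (4 + w * i) (gs.map Gate.code).flatten := by
  rw [shiftCode_flatten, List.map_map, List.map_map]
  congr 2
  funext g
  exact g.shift_code i

/-- Copies of the description `sec`, shifted to the blocks of the preparation circuit. -/
def copiesCode (w : ℕ) (pre post sec : List ℕ) (q : ℕ) : List ℕ :=
  ((List.range q).map fun i => pre ++ shiftCode (4 + w * i) sec ++ post).flatten

theorem copiesCode_succ (w : ℕ) (pre post sec : List ℕ) (q : ℕ) :
    copiesCode w pre post sec (q + 1) =
      copiesCode w pre post sec q ++ (pre ++ shiftCode (4 + w * q) sec ++ post) := by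
  simp [copiesCode, List.range_succ]

theorem copiesCode_eq_finRange (w : ℕ) (pre post sec : List ℕ) (q : ℕ) :
    copiesCode w pre post sec q =
      ((List.finRange q).map fun i : Fin q => pre ++ shiftCode (4 + w * i) sec ++ post).flatten := by
  rw [copiesCode]
  congr 1
  refine List.ext_getElem (by simp) fun i _ _ => by simp

/-- The words `[1]` and `[1, 0]` are ancilla wires 0 and 1, the halves of A and of B; the copies
between them are the outputs of the blocks. -/
theorem codeWires_prepOut {𝒢 : GateSet} {n : ℕ} (A : Circuit 𝒢 (Fin 1) (Fin n)) (q : ℕ) :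
    codeWires (prepOut A q) = [1] ++ copiesCode A.wires [] [] (codeWires A.out) q ++ [1, 0] := by
  have h0 : List.ofFn (fun r => wireCode (prepOut A q r)) =
      [1] :: (List.ofFn fun r : Fin (q * n) => wireCode
        (prepOut A q (Fin.castSucc (Fin.succ r)))) ++ [[1, 0]] := by
    rw [List.ofFn_succ', List.ofFn_succ, prepOut_last, prepOut_zero, List.concat_eq_append]
    rfl
  have h1 : (List.ofFn fun r : Fin (q * n) => wireCode
      (prepOut A q (Fin.castSucc (Fin.succ r)))).flatten =
      copiesCode A.wires [] [] (codeWires A.out) q := by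
    rw [List.ofFn_mul, copiesCode_eq_finRange, ← List.ofFn_eq_map]
    rw [List.flatten_flatten, List.map_ofFn]
    congr 2
    funext i
    rw [Function.comp_apply, List.nil_append, List.append_nil, ← codeWires_trans_blk, codeWires_eq]
    congr 2
    funext j
    rw [Function.Embedding.trans_apply, ← prepOut_block]
    congr 4
    ext
    simp [finProdFinEquiv_apply_val]
    ring
  rw [codeWires_eq, h0, List.cons_append, List.flatten_cons, List.flatten_append, h1]
  simp

theorem GateSet.Contains.gate_code_congr {𝒢 : GateSet} {k : ℕ} {U : Op (Bits k)}
    (h : 𝒢.Contains U) {w w' : ℕ} {f : Fin k ↪ Fin w} {f' : Fin k ↪ Fin w'}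
    (hf : ∀ i, (f i : ℕ) = f' i) : (h.gate f).code = (h.gate f').code := by
  refine congrArg (List.cons _) (congrArg List.flatten (congrArg List.ofFn (funext fun i => ?_)))
  exact congrArg (fun j => 1 :: List.replicate j 0) (hf _)

/-- The description of a two-qubit gate on the wires `j` and `j'`. -/
theorem exists_gate_code {𝒢 : GateSet} {U : Op (Bits 2)} (h : 𝒢.Contains U) :
    ∃ c : Bool, ∀ {w : ℕ} (f : Fin 2 ↪ Fin w), (h.gate f).code = (3 + (h.choose : ℕ)) ::
      if c then wireCode (f 0) ++ wireCode (f 1) else wireCode (f 1) ++ wireCode (f 0) := by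
  have key : ∀ {m : ℕ} (e : Fin 2 ≃ Fin m), ∃ c : Bool, ∀ F : Fin 2 → List ℕ,
      (List.ofFn fun i => F (e.symm i)).flatten = if c then F 0 ++ F 1 else F 1 ++ F 0 := by
    intro m e
    obtain rfl : 2 = m := by simpa using Fintype.card_congr e
    have hne : e.symm 0 ≠ e.symm 1 := fun h => by simpa using e.symm.injective h
    rcases Fin.exists_fin_two.1 ⟨e.symm 0, rfl⟩ with h0 | h0 <;>
      rcases Fin.exists_fin_two.1 ⟨e.symm 1, rfl⟩ with h1 | h1
    · exact absurd (h0.trans h1.symm) hne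
    · exact ⟨true, fun F => by simp [h0, h1]⟩
    · exact ⟨false, fun F => by simp [h0, h1]⟩
    · exact absurd (h0.trans h1.symm) hne
  obtain ⟨c, hc⟩ := key h.choose_spec.choose
  exact ⟨c, fun f => congrArg (List.cons _) (hc fun i => wireCode (f i))⟩

/-- The three words depend only on the gate set, so a fixed program can contain them. Everything
else is made of shifted sections of the description of A. -/
theorem exists_prep_code {𝒢 : GateSet} (hH : 𝒢.Contains hadamard) (hC : 𝒢.Contains cnot) :
    ∃ a pre post : List ℕ, ∀ {n : ℕ} (A : Circuit 𝒢 (Fin 1) (Fin n)) (q : ℕ),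
      (prep hH hC A q).code = List.replicate (4 + q * A.wires) 0 ++ 2 :: 2 :: ([1] ++
        copiesCode A.wires [] [] (codeWires A.out) q ++ [1, 0] ++ 2 :: (a ++
          copiesCode A.wires pre post (codeWires A.inp) q ++
            copiesCode A.wires [] [] (A.gates.map Gate.code).flatten q)) := by
  obtain ⟨c, hc⟩ := exists_gate_code hC
  -- The control wire 3 of a copying CNOT is written before or after its target, according to the
  -- order of the CNOT's qubits in the gate set.
  refine ⟨((ancGates hH hC 0).map Gate.code).flatten,
    (3 + (hC.choose : ℕ)) :: if c then wireCode 3 else [], if c then [] else wireCode 3,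
    fun A q => ?_⟩
  have h1 : ((ancGates hH hC (q * A.wires)).map Gate.code).flatten =
      ((ancGates hH hC 0).map Gate.code).flatten := by
    refine congrArg List.flatten ?_
    simp only [ancGates, List.map_cons, List.map_nil]
    refine congrArg₂ _ (hH.gate_code_congr fun i => rfl) (congrArg₂ _
      (hH.gate_code_congr fun i => rfl) (congrArg₂ _ (hC.gate_code_congr fun i => ?_)
        (congrArg₂ _ (hC.gate_code_congr fun i => ?_) rfl))) <;>
    fin_cases i <;> rfl
  have h2 : (((List.finRange q).map (copyGate hC q (A.inp 0))).map Gate.code).flatten =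
      copiesCode A.wires ((3 + (hC.choose : ℕ)) :: if c then wireCode 3 else [])
        (if c then [] else wireCode 3) (codeWires A.inp) q := by
    rw [copiesCode_eq_finRange, List.map_map]
    congr 2
    funext i
    have h3 : shiftCode (4 + A.wires * i) (codeWires A.inp) = wireCode (blk i (A.inp 0)) := by
      rw [← codeWires_trans_blk, codeWires_eq]
      simp
    rw [Function.comp_apply, copyGate, hc, h3]
    cases c <;> simp <;> rfl
  have h4 : ((((List.finRange q).map fun i => A.gates.map (Gate.shift i)).flatten).map
      Gate.code).flatten = copiesCode A.wires [] [] (A.gates.map Gate.code).flatten q := by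
    rw [copiesCode_eq_finRange, List.map_flatten, List.map_map, List.flatten_flatten, List.map_map]
    congr 2
    funext i
    simpa using Gate.flatten_shift_code i A.gates
  have h5 : (prep hH hC A q).code = List.replicate (4 + q * A.wires) 0 ++ 2 :: ([] ++ 2 ::
      (codeWires (prepOut A q) ++ 2 :: ((prepGates hH hC A q).map Gate.code).flatten)) := rfl
  rw [h5, codeWires_prepOut, prepGates, List.map_append, List.map_append, List.flatten_append,
    List.flatten_append, h1, h2, h4]
  simp

theorem mem_codeWires {k w : ℕ} (e : Fin k ↪ Fin w) {a : ℕ} (h : a ∈ codeWires e) : a < 2 := by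
  simp only [codeWires, List.mem_flatten, List.mem_ofFn] at h
  obtain ⟨L, ⟨i, rfl⟩, h⟩ := h
  rcases List.mem_cons.1 h with rfl | h
  · norm_num
  · rw [List.eq_of_mem_replicate h]; norm_num

/-- Descriptions use a fixed finite alphabet, as required for branching on the top symbol with
`dispatch`. -/
theorem Circuit.mem_code {𝒢 : GateSet} {i o : ℕ} (C : Circuit 𝒢 (Fin i) (Fin o)) {a : ℕ}
    (h : a ∈ C.code) : a < 3 + 𝒢.card := by
  simp only [Circuit.code, List.mem_append, List.mem_cons, List.mem_flatten, List.mem_map] at h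
  rcases h with h | rfl | h | rfl | h | rfl | ⟨L, ⟨g, -, rfl⟩, h⟩
  · rw [List.eq_of_mem_replicate h]; omega
  · omega
  · have := mem_codeWires _ h; omega
  · omega
  · have := mem_codeWires _ h; omega
  · omega
  · rcases List.mem_cons.1 h with rfl | h
    · have := g.kind.isLt; omega
    · have := mem_codeWires _ h; omega

/-! ### Programs -/

/-- A step pushes at most one symbol, so running time bounds output length. -/
theorem Exec.length_le {p : Prog} {s s' : Store} {t : ℕ} (h : Exec p s s' t) (r : ℕ) :
    (s' r).length ≤ (s r).length + t := by
  induction h with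
  | skip s => simp
  | push r' a s =>
    by_cases hr : r = r'
    · subst hr; simp
    · simp [Function.update_of_ne hr]
  | pop r' s =>
    by_cases hr : r = r'
    · subst hr; simp only [Function.update_self, List.length_tail]; omega
    · simp [Function.update_of_ne hr]
  | seq _ _ ih ih' => omega
  | ifTop_pos _ _ ih => omega
  | ifTop_neg _ _ ih => omega
  | while_done _ => omega
  | while_step _ _ _ ih ih' => omega

/-- Each wire contributes a tick and each gate at least its kind symbol, so the description is at
least as long as the circuit is large. -/
theorem UniformQPT.polyBounded_size {𝒢 : GateSet} {i o : ℕ → ℕ}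
    {A : ∀ l, Circuit 𝒢 (Fin (i l)) (Fin (o l))} (hA : UniformQPT A) :
    PolyBounded fun l => (A l).size := by
  obtain ⟨P, T, h⟩ := hA
  refine ⟨T, fun l => ?_⟩
  obtain ⟨s, t, hs, ht, hc⟩ := h l
  have h1 := hs.length_le 1
  have h2 : ∀ L : List (Gate 𝒢 (A l).wires), L.length ≤ ((L.map Gate.code).flatten).length := by
    intro L
    induction L with
    | nil => simp
    | cons g L ih =>
      simp only [List.map_cons, List.flatten_cons, List.length_append, List.length_cons, Gate.code]
      omega
  have h3 := h2 (A l).gates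
  rw [hc] at h1
  simp only [Circuit.code, List.length_append, List.length_cons, List.length_replicate,
    if_neg one_ne_zero, List.length_nil] at h1
  change (A l).gates.length + (A l).wires ≤ _
  omega

/-- The program `p`, running on the stacks from number `k` on. -/
def Prog.shift (k : ℕ) : Prog → Prog
  | .skip => .skip
  | .push r a => .push (r + k) a
  | .pop r => .pop (r + k)
  | .seq p q => .seq (p.shift k) (q.shift k)
  | .ifTop r a p q => .ifTop (r + k) a (p.shift k) (q.shift k)
  | .whileNonempty r p => .whileNonempty (r + k) (p.shift k)

/-- The stacks `v` below `k`, and the stacks `s` from number `k` on. -/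
def glue (k : ℕ) (v s : Store) : Store := fun r => if r < k then v r else s (r - k)

theorem glue_add (k : ℕ) (v s : Store) (r : ℕ) : glue k v s (r + k) = s r := by
  simp [glue]

theorem update_glue (k : ℕ) (v s : Store) (r : ℕ) (x : List ℕ) :
    Function.update (glue k v s) (r + k) x = glue k v (Function.update s r x) := by
  funext r'
  by_cases h : r' = r + k
  · subst h; simp [glue]
  · rw [Function.update_of_ne h]
    by_cases h' : r' < k
    · simp [glue, h']
    · rw [glue, glue, if_neg h', if_neg h', Function.update_of_ne (by omega)]

/-- This runs a given program as a subroutine, leaving the stacks below k free for other data. -/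
theorem Exec.shift {p : Prog} {s s' : Store} {t : ℕ} (h : Exec p s s' t) (k : ℕ) (v : Store) :
    Exec (p.shift k) (glue k v s) (glue k v s') t := by
  induction h with
  | skip s => exact Exec.skip _
  | push r a s =>
    have := Exec.push (r + k) a (glue k v s)
    rwa [update_glue, glue_add] at this
  | pop r s =>
    have := Exec.pop (r + k) (glue k v s)
    rwa [update_glue, glue_add] at this
  | seq _ _ ih ih' => exact Exec.seq ih ih'
  | ifTop_pos hr _ ih => exact Exec.ifTop_pos (by rwa [glue_add]) ih
  | ifTop_neg hr _ ih => exact Exec.ifTop_neg (by rwa [glue_add]) ih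
  | while_done hr => exact Exec.while_done (by rwa [glue_add])
  | while_step hr _ _ ih ih' => exact Exec.while_step (by rwa [glue_add]) ih ih'

/-- The program `p` leads from `s` to `s'` in at most `C` steps. -/
def Does (p : Prog) (s s' : Store) (C : ℕ) : Prop := ∃ t ≤ C, Exec p s s' t

theorem Does.mono {p : Prog} {s s' : Store} {C C' : ℕ} (h : Does p s s' C) (hC : C ≤ C') :
    Does p s s' C' := by
  obtain ⟨t, ht, he⟩ := h
  exact ⟨t, ht.trans hC, he⟩

theorem Does.congr {p : Prog} {s s' s'' : Store} {C C' : ℕ} (h : Does p s s' C) (hs : s' = s'')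
    (hC : C ≤ C') : Does p s s'' C' := hs ▸ h.mono hC

theorem Does.skip (s : Store) : Does .skip s s 0 := ⟨0, le_rfl, Exec.skip s⟩

theorem Does.push (r a : ℕ) (s : Store) :
    Does (.push r a) s (Function.update s r (a :: s r)) 1 := ⟨1, le_rfl, Exec.push r a s⟩

theorem Does.pop (r : ℕ) (s : Store) :
    Does (.pop r) s (Function.update s r (s r).tail) 1 := ⟨1, le_rfl, Exec.pop r s⟩

theorem Does.seq {p q : Prog} {s s' s'' : Store} {C C' : ℕ} (h : Does p s s' C)
    (h' : Does q s' s'' C') : Does (.seq p q) s s'' (C + C') := by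
  obtain ⟨t, ht, he⟩ := h
  obtain ⟨t', ht', he'⟩ := h'
  exact ⟨t + t', by omega, he.seq he'⟩

theorem Does.ifTop_pos {r a : ℕ} {p q : Prog} {s s' : Store} {C : ℕ}
    (hr : (s r).head? = some a) (h : Does p s s' C) : Does (.ifTop r a p q) s s' (C + 1) := by
  obtain ⟨t, ht, he⟩ := h
  exact ⟨t + 1, by omega, he.ifTop_pos hr⟩

theorem Does.ifTop_neg {r a : ℕ} {p q : Prog} {s s' : Store} {C : ℕ}
    (hr : (s r).head? ≠ some a) (h : Does q s s' C) : Does (.ifTop r a p q) s s' (C + 1) := by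
  obtain ⟨t, ht, he⟩ := h
  exact ⟨t + 1, by omega, he.ifTop_neg hr⟩

/-- A loop over the contents of a stack; `S p q` is the store when `p` has been processed and `q` is
left. -/
theorem Does.whileNonempty {r : ℕ} {body : Prog} (S : List ℕ → List ℕ → Store) {C : ℕ}
    (hS : ∀ p q, S p q r = q) (L : List ℕ)
    (hbody : ∀ p a q, p ++ a :: q = L → Does body (S p (a :: q)) (S (p ++ [a]) q) C) :
    Does (.whileNonempty r body) (S [] L) (S L []) ((C + 1) * L.length + 1) := by
  have key : ∀ q p, p ++ q = L →
      Does (.whileNonempty r body) (S p q) (S L []) ((C + 1) * q.length + 1) := by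
    intro q
    induction q with
    | nil =>
      intro p hp
      rw [List.append_nil] at hp
      subst hp
      exact ⟨1, by omega, Exec.while_done (hS _ _)⟩
    | cons a q ih =>
      intro p hp
      obtain ⟨t, ht, he⟩ := hbody p a q hp
      obtain ⟨t', ht', he'⟩ := ih (p ++ [a]) (by simpa using hp)
      refine ⟨t + t' + 1, ?_, Exec.while_step (by rw [hS]; simp) he he'⟩
      rw [List.length_cons, Nat.mul_succ]
      omega
  exact key L [] rfl

/-- A loop over a counter. -/
theorem Does.whileTicks {r : ℕ} {body : Prog} (S : ℕ → ℕ → Store) {C : ℕ} (n : ℕ)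
    (hS : ∀ i j, S i j r = List.replicate j 0)
    (hbody : ∀ i j, i + (j + 1) = n → Does body (S i (j + 1)) (S (i + 1) j) C) :
    Does (.whileNonempty r body) (S 0 n) (S n 0) ((C + 1) * n + 1) := by
  have key : ∀ j i, i + j = n →
      Does (.whileNonempty r body) (S i j) (S n 0) ((C + 1) * j + 1) := by
    intro j
    induction j with
    | zero =>
      rintro i rfl
      exact ⟨1, by omega, Exec.while_done (hS _ _)⟩
    | succ j ih =>
      intro i hi
      obtain ⟨t, ht, he⟩ := hbody i j hi
      obtain ⟨t', ht', he'⟩ := ih (i + 1) (by omega)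
      refine ⟨t + t' + 1, ?_, Exec.while_step (by rw [hS]; simp) he he'⟩
      rw [Nat.mul_succ]
      omega
  exact key n 0 (by omega)

/-- Run `f a`, where `a < K` is the top symbol of stack `r`. -/
def dispatch (r : ℕ) (f : ℕ → Prog) : ℕ → Prog
  | 0 => .skip
  | K + 1 => .ifTop r K (f K) (dispatch r f K)

theorem Does.dispatch {r : ℕ} {f : ℕ → Prog} {a : ℕ} {s s' : Store} {C : ℕ}
    (hr : (s r).head? = some a) (h : Does (f a) s s' C) :
    ∀ {K : ℕ}, a < K → Does (dispatch r f K) s s' (C + K) := by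
  intro K
  induction K with
  | zero => intro ha; omega
  | succ K ih =>
    intro ha
    by_cases hK : a = K
    · subst hK
      exact (Does.ifTop_pos hr h).mono (by omega)
    · exact (Does.ifTop_neg (by rw [hr]; simpa using hK) (ih (by omega))).mono (by omega)

/-- Empty the stack `r`. -/
def clear (r : ℕ) : Prog := .whileNonempty r (.pop r)

theorem Does.clear (r : ℕ) (s : Store) :
    Does (clear r) s (Function.update s r []) (2 * (s r).length + 1) := by
  have h := Does.whileNonempty (r := r) (body := .pop r) (C := 1)
    (fun _ q => Function.update s r q) (fun _ _ => Function.update_self ..) (s r)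
    fun p a q _ => by
      refine (Does.pop r _).congr ?_ le_rfl
      simp
  rw [Function.update_eq_self] at h
  exact h

/-- Move the contents of stack `r`, symbols less than `K`, to stack `d`. -/
def move (K r d : ℕ) : Prog :=
  .whileNonempty r (dispatch r (fun a => .seq (.pop r) (.push d a)) K)

/-- A program can push only constants, so transferring a symbol is a case distinction over the
alphabet. The transfer reverses the word. -/
theorem Does.move {K r d : ℕ} (hrd : r ≠ d) (s : Store) (hK : ∀ a ∈ s r, a < K) :
    Does (move K r d) s (Function.update (Function.update s r []) d ((s r).reverse ++ s d))
      ((K + 3) * (s r).length + 1) := by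
  have h := Does.whileNonempty (r := r) (C := 1 + 1 + K)
    (body := QInfo.dispatch r (fun a => .seq (.pop r) (.push d a)) K)
    (fun p q => Function.update (Function.update s r q) d (p.reverse ++ s d))
    (fun _ _ => by rw [Function.update_of_ne hrd, Function.update_self]) (s r)
    fun p a q hp => by
      refine Does.dispatch (a := a) ?_ ?_ (hK a (by rw [← hp]; simp))
      · rw [Function.update_of_ne hrd, Function.update_self]; rfl
      · refine ((Does.pop r _).seq (Does.push d a _)).congr ?_ le_rfl
        funext x
        simp only [Function.update_apply]
        split_ifs <;> simp_all
  rw [Function.update_eq_self, List.reverse_nil, List.nil_append, Function.update_eq_self] at h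
  exact h.mono (Nat.le_of_eq (by ring))

/-- Move the contents of stack `r` up to the first `2`, symbols less than `K`, to stack `d`; the
stack `m` is used for control. -/
def readSection (K r d m : ℕ) : Prog :=
  .seq (.push m 0) (.whileNonempty m (.ifTop r 2 (.seq (.pop r) (.pop m))
    (dispatch r (fun a => .seq (.pop r) (.push d a)) K)))

/-- Stack m carries a single flag that keeps the loop running. Meeting the separator 2 removes both
the separator and the flag, and the section arrives reversed. -/
theorem Does.readSection {K r d m : ℕ} (hrd : r ≠ d) (hrm : r ≠ m) (hdm : d ≠ m) (s : Store)
    (L L' : List ℕ) (hr : s r = L ++ 2 :: L') (hm : s m = []) (hL : ∀ a ∈ L, a < K ∧ a ≠ 2) :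
    Does (readSection K r d m) s (Function.update (Function.update s r L') d (L.reverse ++ s d))
      ((K + 4) * L.length + 6) := by
  have key : ∀ (L : List ℕ) (s : Store), s r = L ++ 2 :: L' → s m = [0] →
      (∀ a ∈ L, a < K ∧ a ≠ 2) →
      Does (.whileNonempty m (.ifTop r 2 (.seq (.pop r) (.pop m))
        (QInfo.dispatch r (fun a => .seq (.pop r) (.push d a)) K))) s
        (Function.update (Function.update (Function.update s m []) r L') d (L.reverse ++ s d))
        ((K + 4) * L.length + 5) := by
    intro L
    induction L with
    | nil =>
      intro s hr hm _
      obtain ⟨t, ht, he⟩ := Does.ifTop_pos (a := 2) (q := QInfo.dispatch r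
        (fun a => .seq (.pop r) (.push d a)) K) (by rw [hr]; rfl)
        ((Does.pop r s).seq (Does.pop m _))
      refine ⟨t + 1 + 1, by omega, Exec.while_step (by rw [hm]; simp) he ?_⟩
      have hs : Function.update (Function.update (Function.update s m []) r L') d
          (List.reverse [] ++ s d) = Function.update (Function.update s r (s r).tail) m
            (Function.update s r (s r).tail m).tail := by
        funext x
        simp only [Function.update_apply]
        split_ifs <;> simp_all
      rw [hs]
      exact Exec.while_done (by simp [Function.update_of_ne hrm.symm, hm])
    | cons a L ih =>
      intro s hr hm hL
      obtain ⟨ha, ha2⟩ := hL a (by simp)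
      obtain ⟨t, ht, he⟩ := Does.ifTop_neg (r := r) (a := 2) (p := .seq (.pop r) (.pop m))
        (by rw [hr]; simpa using ha2) (Does.dispatch (f := fun a => .seq (.pop r) (.push d a))
        (by rw [hr]; rfl) ((Does.pop r s).seq (Does.push d a _)) ha)
      obtain ⟨t', ht', he'⟩ := ih (Function.update (Function.update s r (s r).tail) d
        (a :: Function.update s r (s r).tail d))
        (by rw [Function.update_of_ne hrd, Function.update_self, hr]; rfl)
        (by rw [Function.update_of_ne hdm.symm, Function.update_of_ne hrm.symm, hm])
        (fun b hb => hL b (by simp [hb]))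
      refine ⟨t + t' + 1, ?_, Exec.while_step (by rw [hm]; simp) he ?_⟩
      · rw [List.length_cons, Nat.mul_succ]; omega
      · convert he' using 1
        funext x
        simp only [Function.update_apply]
        split_ifs <;> simp_all
  refine ((Does.push m 0 s).seq (key L (Function.update s m (0 :: s m)) ?_ ?_ hL)).congr ?_ ?_
  · rw [Function.update_of_ne hrm, hr]
  · rw [Function.update_self, hm]
  · funext x
    simp only [Function.update_apply]
    split_ifs <;> simp_all
  · omega

/-- Push the word `u` on stack `r`, first symbol first. -/
def emit (r : ℕ) : List ℕ → Prog
  | [] => .skip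
  | a :: u => .seq (.push r a) (emit r u)

theorem Does.emit (r : ℕ) (u : List ℕ) : ∀ s : Store,
    Does (emit r u) s (Function.update s r (u.reverse ++ s r)) u.length := by
  induction u with
  | nil =>
    intro s
    rw [List.reverse_nil, List.nil_append, Function.update_eq_self]
    exact Does.skip s
  | cons a u ih =>
    intro s
    refine ((Does.push r a s).seq (ih _)).congr ?_ (by simp [add_comm])
    simp

/-- Add the ticks on stack `r` to stack `d`; the stack `t` is used as temporary storage. -/
def copyTicks (r t d : ℕ) : Prog :=
  .seq (.whileNonempty r (.seq (.pop r) (.seq (.push t 0) (.push d 0)))) (move 1 t r)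

theorem Does.copyTicks {r t d : ℕ} (hrt : r ≠ t) (hrd : r ≠ d) (htd : t ≠ d) (s : Store) (k : ℕ)
    (hr : s r = List.replicate k 0) (ht : s t = []) :
    Does (copyTicks r t d) s (Function.update s d (List.replicate k 0 ++ s d)) (8 * k + 2) := by
  have h := Does.whileTicks (r := r) (C := 1 + (1 + 1))
    (body := .seq (.pop r) (.seq (.push t 0) (.push d 0)))
    (fun i j => Function.update (Function.update (Function.update s r (List.replicate j 0)) t
      (List.replicate i 0)) d (List.replicate i 0 ++ s d)) k
    (fun i j => by simp [Function.update_of_ne, hrt, hrd])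
    fun i j _ => by
      refine ((Does.pop r _).seq ((Does.push t 0 _).seq (Does.push d 0 _))).congr ?_ le_rfl
      funext x
      simp only [Function.update_apply]
      split_ifs <;> simp_all [List.replicate_succ]
  have hs : Function.update (Function.update (Function.update s r (List.replicate k 0)) t
      (List.replicate 0 0)) d (List.replicate 0 0 ++ s d) = s := by
    funext x
    simp only [Function.update_apply]
    split_ifs <;> simp_all
  rw [hs] at h
  have hts : Function.update (Function.update (Function.update s r (List.replicate 0 0)) t
      (List.replicate k 0)) d (List.replicate k 0 ++ s d) t = List.replicate k 0 := by
    simp [Function.update_of_ne, htd]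
  refine (h.seq (Does.move (K := 1) hrt.symm _ fun a ha => ?_)).congr ?_ ?_
  · rw [hts] at ha
    rw [List.eq_of_mem_replicate ha]
    norm_num
  · funext x
    simp only [Function.update_apply]
    split_ifs <;> simp_all
  · rw [hts, List.length_replicate]
    omega

/-- Polynomials of the number of ticks on stack `2` are computed on stack `3` in polynomial time. -/
theorem exists_evalProg (q : Polynomial ℕ) : ∃ (P : Prog) (C : ℕ → ℕ), PolyBounded C ∧
    ∀ (l : ℕ) (s : Store), s 2 = List.replicate l 0 → s 3 = [] → s 5 = [] → s 11 = [] →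
      Does P s (Function.update s 3 (List.replicate (q.eval l) 0)) (C l) := by
  induction q using Polynomial.recOnHorner with
  | M0 =>
    refine ⟨.skip, fun _ => 0, PolyBounded.const 0, fun l s _ h3 _ _ => ?_⟩
    refine (Does.skip s).congr ?_ le_rfl
    rw [Polynomial.eval_zero, List.replicate_zero, ← h3, Function.update_eq_self]
  | MC p a _ _ ih =>
    obtain ⟨P, C, hC, hP⟩ := ih
    refine ⟨.seq P (emit 3 (List.replicate a 0)), fun l => C l + a, hC.add (PolyBounded.const a),
      fun l s h2 h3 h5 h11 => ((hP l s h2 h3 h5 h11).seq (Does.emit 3 _ _)).congr ?_ (by simp)⟩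
    simp [add_comm]
  -- Horner's scheme: to multiply by l, every tick of the value adds l ticks to stack 11, and the
  -- result is moved back to stack 3.
  | MX p _ ih =>
    obtain ⟨P, C, hC, hP⟩ := ih
    refine ⟨.seq P (.seq (.whileNonempty 3 (.seq (.pop 3) (copyTicks 2 5 11))) (move 1 11 3)),
      fun l => C l + (((1 + (8 * l + 2) + 1) * p.eval l + 1) + (4 * (p.eval l * l) + 1)), ?_, ?_⟩
    · have h8 := (PolyBounded.const 8).mul PolyBounded.id
      exact hC.add (((((PolyBounded.const 1).add (h8.add (PolyBounded.const 2))).add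
        (PolyBounded.const 1)).mul (PolyBounded.eval p)).add (PolyBounded.const 1) |>.add
          (((PolyBounded.const 4).mul ((PolyBounded.eval p).mul PolyBounded.id)).add
            (PolyBounded.const 1)))
    · intro l s h2 h3 h5 h11
      refine ((hP l s h2 h3 h5 h11).seq ?_)
      have h := Does.whileTicks (r := 3) (C := 1 + (8 * l + 2))
        (body := .seq (.pop 3) (QInfo.copyTicks 2 5 11))
        (fun i j => Function.update (Function.update s 3 (List.replicate j 0)) 11
          (List.replicate (i * l) 0)) (p.eval l) (fun i j => by simp)
        fun i j _ => by
          refine ((Does.pop 3 _).seq (Does.copyTicks (by decide) (by decide) (by decide) _ l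
            (by simp [h2]) (by simp [h5]))).congr ?_ le_rfl
          funext x
          by_cases hx3 : x = 3
          · subst hx3; simp
          by_cases hx11 : x = 11
          · subst hx11; simp [Nat.succ_mul, Nat.add_comm]
          · simp [Function.update_of_ne, hx3, hx11]
      have hs : Function.update (Function.update s 3 (List.replicate (p.eval l) 0)) 11
          (List.replicate (0 * l) 0) = Function.update s 3 (List.replicate (p.eval l) 0) := by
        funext x
        simp only [Function.update_apply]
        split_ifs <;> simp_all
      rw [hs] at h
      refine h.seq ((Does.move (K := 1) (by decide) _ fun a ha => ?_).congr ?_ ?_)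
      · rw [Function.update_self] at ha
        rw [List.eq_of_mem_replicate ha]
        norm_num
      · funext x
        simp only [Function.update_apply]
        split_ifs <;> simp_all [Polynomial.eval_mul]
      · rw [Function.update_self, List.length_replicate]

/-- Write the description on stack `10` on stack `4`, shifted by the number of ticks on stack `7`;
the stacks `5` and `11` are used as temporary storage. -/
def emitShift (K : ℕ) : Prog :=
  .seq (.whileNonempty 10 (dispatch 10 (fun a => .seq (.pop 10) (.seq (.push 5 a) (.seq (.push 4 a)
    (if a = 1 then copyTicks 7 11 4 else .skip)))) K)) (move K 5 10)

/-- Stack 5 collects the processed section in reverse, and moving it back restores stack 10 for the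
next copy. -/
theorem Does.emitShift {K : ℕ} (s : Store) (k : ℕ) (sec : List ℕ) (h5 : s 5 = []) (h11 : s 11 = [])
    (h7 : s 7 = List.replicate k 0) (h10 : s 10 = sec) (hK : ∀ a ∈ sec, a < K) :
    Does (emitShift K) s (Function.update s 4 ((shiftCode k sec).reverse ++ s 4))
      ((2 * K + 8 * k + 9) * sec.length + 2) := by
  have h := Does.whileNonempty (r := 10) (C := 1 + (1 + (1 + (8 * k + 2))) + K)
    (body := QInfo.dispatch 10 (fun a => .seq (.pop 10) (.seq (.push 5 a) (.seq (.push 4 a)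
      (if a = 1 then QInfo.copyTicks 7 11 4 else .skip)))) K)
    (fun p q => Function.update (Function.update (Function.update s 10 q) 5 p.reverse) 4
      ((shiftCode k p).reverse ++ s 4)) (fun p q => by simp) sec
    fun p a q hp => by
      refine Does.dispatch (a := a) (by simp) ((Does.pop 10 _).seq ((Does.push 5 a _).seq
        ((Does.push 4 a _).seq (?_ : Does _ _ _ (8 * k + 2))))) (hK a (by rw [← hp]; simp))
      by_cases ha : a = 1
      · rw [if_pos ha]
        refine (Does.copyTicks (by decide) (by decide) (by decide) _ k (by simp [h7])
          (by simp [h11])).congr ?_ le_rfl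
        funext x
        by_cases hx4 : x = 4
        · subst hx4; simp [shiftCode, ha]
        by_cases hx5 : x = 5
        · subst hx5; simp
        by_cases hx10 : x = 10
        · subst hx10; simp
        · simp [Function.update_of_ne, hx4, hx5, hx10]
      · rw [if_neg ha]
        refine (Does.skip _).congr ?_ (Nat.zero_le _)
        funext x
        by_cases hx4 : x = 4
        · subst hx4; simp [shiftCode, ha]
        by_cases hx5 : x = 5
        · subst hx5; simp
        by_cases hx10 : x = 10
        · subst hx10; simp
        · simp [Function.update_of_ne, hx4, hx5, hx10]
  have hs : Function.update (Function.update (Function.update s 10 sec) 5 (List.reverse [])) 4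
      ((shiftCode k []).reverse ++ s 4) = s := by
    funext x
    simp only [Function.update_apply]
    split_ifs <;> simp_all [shiftCode]
  rw [hs] at h
  refine (h.seq (Does.move (K := K) (by decide) _ fun a ha => ?_)).congr ?_ ?_
  · exact hK a (by simpa using ha)
  · funext x
    simp only [Function.update_apply]
    split_ifs <;> simp_all
  · have : Function.update (Function.update (Function.update s 10 []) 5 sec.reverse) 4
      ((shiftCode k sec).reverse ++ s 4) 5 = sec.reverse := by simp
    rw [this, List.length_reverse]
    exact Nat.le_of_eq (by ring)

/-- Write shifted copies of the description on stack `10`, as many as there are ticks on stack `3`,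
between `pre` and `post` on stack `4`. The offset, on stack `7`, grows by the number of ticks on
stack `8` for each copy. -/
def emitCopies (K : ℕ) (pre post : List ℕ) : Prog :=
  .seq (.whileNonempty 3 (.seq (.pop 3) (.seq (.push 6 0) (.seq (emit 4 pre) (.seq (emitShift K)
    (.seq (emit 4 post) (copyTicks 8 5 7))))))) (move 1 6 3)

/-- A bound for the running time of `emitCopies`. -/
def emitCopiesTime (K c m w q : ℕ) : ℕ :=
  (c + (2 * K + 8 * (4 + w * q) + 9) * m + 8 * w + 7) * q + 4 * q + 2

/-- Stack 6 counts the ticks consumed from stack 3 and restores them at the end. The offset on stack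
7 starts at 4, past the ancillas, and is 4 + w i before copy i. -/
theorem Does.emitCopies {K : ℕ} (pre post : List ℕ) (s : Store) (w q : ℕ) (sec : List ℕ)
    (h3 : s 3 = List.replicate q 0) (h5 : s 5 = []) (h6 : s 6 = [])
    (h7 : s 7 = List.replicate 4 0) (h8 : s 8 = List.replicate w 0) (h10 : s 10 = sec)
    (h11 : s 11 = []) (hK : ∀ a ∈ sec, a < K) :
    Does (emitCopies K pre post) s (Function.update (Function.update s 7
      (List.replicate (4 + w * q) 0)) 4 ((copiesCode w pre post sec q).reverse ++ s 4))
      (emitCopiesTime K (pre.length + post.length) sec.length w q) := by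
  have h := Does.whileTicks (r := 3)
    (C := pre.length + post.length + (2 * K + 8 * (4 + w * q) + 9) * sec.length + 8 * w + 6)
    (body := .seq (.pop 3) (.seq (.push 6 0) (.seq (QInfo.emit 4 pre) (.seq (QInfo.emitShift K)
      (.seq (QInfo.emit 4 post) (QInfo.copyTicks 8 5 7))))))
    (fun i j => Function.update (Function.update (Function.update (Function.update s 3
      (List.replicate j 0)) 6 (List.replicate i 0)) 7 (List.replicate (4 + w * i) 0)) 4
        ((copiesCode w pre post sec i).reverse ++ s 4)) q (fun i j => by simp)
    fun i j hij => by
      refine ((Does.pop 3 _).seq ((Does.push 6 0 _).seq ((Does.emit 4 pre _).seq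
        ((Does.emitShift _ (4 + w * i) sec (by simp [h5]) (by simp [h11]) (by simp) (by simp [h10])
          hK).seq ((Does.emit 4 post _).seq (Does.copyTicks (by decide) (by decide) (by decide) _ w
            (by simp [h8]) (by simp [h5]))))))).congr ?_ ?_
      · have hw : w + (4 + w * i) = 4 + w * (i + 1) := by ring
        funext x
        by_cases hx3 : x = 3
        · subst hx3; simp
        by_cases hx4 : x = 4
        · subst hx4; simp [copiesCode_succ]
        by_cases hx6 : x = 6
        · subst hx6; simp [List.replicate_succ]
        by_cases hx7 : x = 7
        · subst hx7; simp [hw]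
        · simp [Function.update_of_ne, hx3, hx4, hx6, hx7]
      · have hi : w * i ≤ w * q := Nat.mul_le_mul_left _ (by omega)
        have := Nat.mul_le_mul_right sec.length
          (show 2 * K + 8 * (4 + w * i) + 9 ≤ 2 * K + 8 * (4 + w * q) + 9 by omega)
        omega
  have hs : Function.update (Function.update (Function.update (Function.update s 3
      (List.replicate q 0)) 6 (List.replicate 0 0)) 7 (List.replicate (4 + w * 0) 0)) 4
        ((copiesCode w pre post sec 0).reverse ++ s 4) = s := by
    funext x
    simp only [Function.update_apply]
    split_ifs <;> simp_all [copiesCode]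
  rw [hs] at h
  refine (h.seq (Does.move (K := 1) (by decide) _ fun a ha => ?_)).congr ?_ ?_
  · have h' : a ∈ List.replicate q 0 := by simpa using ha
    rw [List.eq_of_mem_replicate h']
    norm_num
  · funext x
    simp only [Function.update_apply]
    split_ifs <;> simp_all
  · have : Function.update (Function.update (Function.update (Function.update s 3
      (List.replicate 0 0)) 6 (List.replicate q 0)) 7 (List.replicate (4 + w * q) 0)) 4
        ((copiesCode w pre post sec q).reverse ++ s 4) 6 = List.replicate q 0 := by simp
    rw [this, List.length_replicate, emitCopiesTime]
    linarith

/-! ### The program writing the description of the preparation circuit -/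

/-- The contents of the stacks in use while the description of the preparation circuit is written:
the number of copies on stack `3`, the output on stack `4`, the number of wires on stack `8`, the
input wire on stack `9`, a section of the description on stack `10`, the rest on stack `13`. -/
structure Cfg (s : Store) (Q R W I S c : List ℕ) : Prop where
  h1 : s 1 = []
  h3 : s 3 = Q
  h4 : s 4 = R
  h5 : s 5 = []
  h6 : s 6 = []
  h7 : s 7 = []
  h8 : s 8 = W
  h9 : s 9 = I
  h10 : s 10 = S
  h11 : s 11 = []
  h13 : s 13 = c

/-- Write the number of wires of the preparation circuit. -/
def emitWires (K : ℕ) : Prog :=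
  .seq (emit 7 (List.replicate 4 0)) (.seq (emitCopies K [] []) (move 1 7 4))

/-- For an empty section and empty separators `emitCopies` writes nothing, but still leaves the
final offset 4 + w q on stack 7, which is the number of wires. -/
theorem Cfg.emitWires (K : ℕ) {s : Store} {q w : ℕ} {R I c : List ℕ}
    (h : Cfg s (List.replicate q 0) R (List.replicate w 0) I [] c) :
    ∃ s', Does (emitWires K) s s' (4 + (emitCopiesTime K 0 0 w q + (4 * (4 + w * q) + 1))) ∧
      Cfg s' (List.replicate q 0) ((List.replicate (4 + q * w) 0).reverse ++ R)
        (List.replicate w 0) I [] c := by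
  have hc : copiesCode w [] [] [] q = [] := by
    rw [copiesCode, List.flatten_eq_nil_iff]
    intro L hL
    obtain ⟨i, -, rfl⟩ := List.mem_map.1 hL
    rfl
  refine ⟨_, (Does.emit 7 _ s).seq ((Does.emitCopies (K := K) [] [] _ w q [] (by simp [h.h3])
    (by simp [h.h5]) (by simp [h.h6]) (by simp [h.h7]) (by simp [h.h8]) (by simp [h.h10])
    (by simp [h.h11]) (by simp)).seq ((Does.move (K := 1) (by decide) _ ?_).mono ?_)), ?_⟩
  · intro a ha
    have h' : a ∈ List.replicate (4 + w * q) 0 := by simpa using ha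
    rw [List.eq_of_mem_replicate h']
    norm_num
  · simp
  · constructor <;> simp [h.h1, h.h3, h.h4, h.h5, h.h6, h.h8, h.h9, h.h10, h.h11, h.h13, hc,
      mul_comm q w]

/-- Write shifted copies of the section on stack `10`, and remove it. -/
def writeCopies (K : ℕ) (pre post : List ℕ) : Prog :=
  .seq (emit 7 (List.replicate 4 0)) (.seq (emitCopies K pre post) (.seq (clear 7) (clear 10)))

theorem Cfg.writeCopies (K : ℕ) (pre post : List ℕ) {s : Store} {q w : ℕ} {u I S c : List ℕ}
    (h : Cfg s (List.replicate q 0) u.reverse (List.replicate w 0) I S c) (hK : ∀ a ∈ S, a < K) :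
    ∃ s', Does (writeCopies K pre post) s s' (4 + (emitCopiesTime K (pre.length + post.length)
        S.length w q + ((2 * (4 + w * q) + 1) + (2 * S.length + 1)))) ∧
      Cfg s' (List.replicate q 0) (u ++ copiesCode w pre post S q).reverse (List.replicate w 0) I
        [] c := by
  refine ⟨_, (Does.emit 7 _ s).seq ((Does.emitCopies (K := K) pre post _ w q S (by simp [h.h3])
    (by simp [h.h5]) (by simp [h.h6]) (by simp [h.h7]) (by simp [h.h8]) (by simp [h.h10])
    (by simp [h.h11]) hK).seq (((Does.clear 7 _).mono ?_).seq ((Does.clear 10 _).mono ?_))), ?_⟩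
  · simp
  · simp [h.h10]
  · constructor <;> simp [h.h1, h.h3, h.h4, h.h5, h.h6, h.h8, h.h9, h.h11, h.h13]

theorem Cfg.emit {s : Store} {Q u W I S c : List ℕ} (h : Cfg s Q u.reverse W I S c) (v : List ℕ) :
    ∃ s', Does (emit 4 v) s s' v.length ∧ Cfg s' Q (u ++ v).reverse W I S c := by
  refine ⟨_, Does.emit 4 v s, ?_⟩
  constructor <;> simp [h.h1, h.h3, h.h4, h.h5, h.h6, h.h7, h.h8, h.h9, h.h10, h.h11, h.h13]

theorem Cfg.readWires {K : ℕ} {s : Store} {Q R I S c : List ℕ} {w : ℕ} (hK : 0 < K)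
    (h : Cfg s Q R [] I S (List.replicate w 0 ++ 2 :: c)) :
    ∃ s', Does (readSection K 13 8 6) s s' ((K + 4) * w + 6) ∧
      Cfg s' Q R (List.replicate w 0) I S c := by
  refine ⟨_, (Does.readSection (by decide) (by decide) (by decide) s _ _ h.h13 h.h6 ?_).mono
    (by simp), ?_⟩
  · intro a ha
    rw [List.eq_of_mem_replicate ha]
    exact ⟨hK, by decide⟩
  · constructor <;> simp [h.h1, h.h3, h.h4, h.h5, h.h6, h.h7, h.h8, h.h9, h.h10, h.h11]

/-- The input section precedes the output section but is needed only later, among the gates. It is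
parked on stack 9 in reverse until `Cfg.loadInput` restores its order. -/
theorem Cfg.readInput {K : ℕ} {s : Store} {Q R W I S c : List ℕ}
    (h : Cfg s Q R W [] S (I ++ 2 :: c)) (hI : ∀ a ∈ I, a < K ∧ a ≠ 2) :
    ∃ s', Does (readSection K 13 9 6) s s' ((K + 4) * I.length + 6) ∧
      Cfg s' Q R W I.reverse S c := by
  refine ⟨_, Does.readSection (by decide) (by decide) (by decide) s _ _ h.h13 h.h6 hI, ?_⟩
  constructor <;> simp [h.h1, h.h3, h.h4, h.h5, h.h6, h.h7, h.h8, h.h9, h.h10, h.h11]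

/-- Each transfer reverses the word, so the detour over stack 5 restores its order. -/
theorem Cfg.readOutput {K : ℕ} {s : Store} {Q R W I O c : List ℕ}
    (h : Cfg s Q R W I [] (O ++ 2 :: c)) (hO : ∀ a ∈ O, a < K ∧ a ≠ 2) :
    ∃ s', Does (.seq (readSection K 13 5 6) (move K 5 10)) s s'
        (((K + 4) * O.length + 6) + ((K + 3) * O.length + 1)) ∧ Cfg s' Q R W I O c := by
  refine ⟨_, (Does.readSection (by decide) (by decide) (by decide) s _ _ h.h13 h.h6 hO).seq
    ((Does.move (K := K) (by decide) _ ?_).mono ?_), ?_⟩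
  · intro a ha
    exact (hO a (by simpa [h.h5] using ha)).1
  · simp [h.h5]
  · constructor <;> simp [h.h1, h.h3, h.h4, h.h5, h.h6, h.h7, h.h8, h.h9, h.h10, h.h11]

theorem Cfg.loadInput {K : ℕ} {s : Store} {Q R W I c : List ℕ}
    (h : Cfg s Q R W I.reverse [] c) (hI : ∀ a ∈ I, a < K) :
    ∃ s', Does (move K 9 10) s s' ((K + 3) * I.length + 1) ∧ Cfg s' Q R W [] I c := by
  refine ⟨_, (Does.move (K := K) (by decide) _ ?_).mono ?_, ?_⟩
  · intro a ha
    exact hI a (by simpa [h.h9] using ha)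
  · simp [h.h9]
  · constructor <;> simp [h.h1, h.h3, h.h4, h.h5, h.h6, h.h7, h.h8, h.h9, h.h10, h.h11, h.h13]

theorem Cfg.loadGates {K : ℕ} {s : Store} {Q R W I c : List ℕ}
    (h : Cfg s Q R W I [] c) (hc : ∀ a ∈ c, a < K) :
    ∃ s', Does (.seq (move K 13 5) (move K 5 10)) s s'
        (((K + 3) * c.length + 1) + ((K + 3) * c.length + 1)) ∧ Cfg s' Q R W I c [] := by
  refine ⟨_, ((Does.move (K := K) (by decide) _ ?_).mono ?_).seq
    ((Does.move (K := K) (by decide) _ ?_).mono ?_), ?_⟩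
  · intro a ha
    exact hc a (by simpa [h.h13] using ha)
  · simp [h.h13]
  · intro a ha
    exact hc a (by simpa [h.h13, h.h5] using ha)
  · simp [h.h13, h.h5]
  · constructor <;> simp [h.h1, h.h3, h.h4, h.h5, h.h6, h.h7, h.h8, h.h9, h.h10, h.h11, h.h13]

/-- Turn the description of a circuit on stack `13` into that of the preparation circuit, written on
stack `4` in reverse. -/
def writePrep (K : ℕ) (a pre post : List ℕ) : Prog :=
  .seq (readSection K 13 8 6) (.seq (emitWires K) (.seq (emit 4 [2, 2, 1])
    (.seq (readSection K 13 9 6) (.seq (.seq (readSection K 13 5 6) (move K 5 10))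
      (.seq (writeCopies K [] []) (.seq (emit 4 ([1, 0, 2] ++ a)) (.seq (move K 9 10)
        (.seq (writeCopies K pre post) (.seq (.seq (move K 13 5) (move K 5 10))
          (writeCopies K [] []))))))))))

/-- The description of the preparation circuit. -/
def prepCode (a pre post : List ℕ) (w q : ℕ) (I O G : List ℕ) : List ℕ :=
  List.replicate (4 + q * w) 0 ++ 2 :: 2 :: ([1] ++ copiesCode w [] [] O q ++ [1, 0] ++ 2 :: (a ++
    copiesCode w pre post I q ++ copiesCode w [] [] G q))

theorem exists_does_writePrep {K : ℕ} (hK : 3 ≤ K) (a pre post : List ℕ)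
    {w q : ℕ → ℕ} {s : ℕ → Store} {I O G : ℕ → List ℕ} (hw : PolyBounded w) (hq : PolyBounded q)
    (hI : PolyBounded fun l => (I l).length) (hO : PolyBounded fun l => (O l).length)
    (hG : PolyBounded fun l => (G l).length)
    (hs : ∀ l, Cfg (s l) (List.replicate (q l) 0) [] [] [] []
      (List.replicate (w l) 0 ++ 2 :: (I l ++ 2 :: (O l ++ 2 :: G l))))
    (hIK : ∀ l, ∀ b ∈ I l, b < 2) (hOK : ∀ l, ∀ b ∈ O l, b < 2) (hGK : ∀ l, ∀ b ∈ G l, b < K) :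
    ∃ C : ℕ → ℕ, PolyBounded C ∧ ∀ l, ∃ s', Does (writePrep K a pre post) (s l) s' (C l) ∧
      s' 1 = [] ∧ s' 4 = (prepCode a pre post (w l) (q l) (I l) (O l) (G l)).reverse := by
  -- The running time is left as `_` and is filled in by the chain of `Does.seq`.
  have hstep : ∀ l, ∃ s', Does (writePrep K a pre post) (s l) s' _ ∧ s' 1 = [] ∧
      s' 4 = (prepCode a pre post (w l) (q l) (I l) (O l) (G l)).reverse := fun l => by
    obtain ⟨s₁, d₁, h⟩ := (hs l).readWires (K := K) (by omega)
    obtain ⟨s₂, d₂, h⟩ := h.emitWires K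
    rw [List.append_nil] at h
    obtain ⟨s₃, d₃, h⟩ := h.emit [2, 2, 1]
    obtain ⟨s₄, d₄, h⟩ := h.readInput (K := K) fun b hb => by have := hIK l b hb; omega
    obtain ⟨s₅, d₅, h⟩ := h.readOutput (K := K) fun b hb => by have := hOK l b hb; omega
    obtain ⟨s₆, d₆, h⟩ := h.writeCopies K [] [] fun b hb => by have := hOK l b hb; omega
    obtain ⟨s₇, d₇, h⟩ := h.emit ([1, 0, 2] ++ a)
    obtain ⟨s₈, d₈, h⟩ := h.loadInput (K := K) fun b hb => by have := hIK l b hb; omega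
    obtain ⟨s₉, d₉, h⟩ := h.writeCopies K pre post fun b hb => by have := hIK l b hb; omega
    obtain ⟨s₁₀, d₁₀, h⟩ := h.loadGates (hGK l)
    obtain ⟨s₁₁, d₁₁, h⟩ := h.writeCopies K [] [] (hGK l)
    exact ⟨s₁₁, d₁.seq (d₂.seq (d₃.seq (d₄.seq (d₅.seq (d₆.seq (d₇.seq (d₈.seq (d₉.seq
      (d₁₀.seq d₁₁))))))))), h.h1, h.h4.trans (by simp [prepCode])⟩
  refine ⟨_, ?_, hstep⟩
  unfold emitCopiesTime
  -- The bound is built from the given polynomially bounded quantities and constants by sums and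
  -- products, and is taken apart accordingly.
  repeat' with_reducible first
    | exact hw
    | exact hq
    | exact hI
    | exact hO
    | exact hG
    | exact PolyBounded.const _
    | apply PolyBounded.add
    | apply PolyBounded.mul

/-- Copy the input `1^l` on the stacks `2` and `12`. -/
def copyInput : Prog := .whileNonempty 0 (.seq (.pop 0) (.seq (.push 2 0) (.push 12 0)))

theorem Does.copyInput (l : ℕ) :
    Does copyInput (fun r => if r = 0 then List.replicate l 0 else [])
      (glue 12 (fun r => if r = 2 then List.replicate l 0 else [])
        fun r => if r = 0 then List.replicate l 0 else []) (4 * l + 1) := by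
  have h := Does.whileTicks (r := 0) (C := 1 + (1 + 1))
    (body := .seq (.pop 0) (.seq (.push 2 0) (.push 12 0)))
    (fun i j r => if r = 0 then List.replicate j 0 else if r = 2 ∨ r = 12 then
      List.replicate i 0 else []) l (fun i j => rfl)
    fun i j _ => by
      refine ((Does.pop 0 _).seq ((Does.push 2 0 _).seq (Does.push 12 0 _))).congr ?_ le_rfl
      funext x
      by_cases hx0 : x = 0
      · subst hx0; simp
      by_cases hx2 : x = 2
      · subst hx2; simp [List.replicate_succ]
      by_cases hx12 : x = 12
      · subst hx12; simp [List.replicate_succ]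
      · simp [Function.update_of_ne, hx0, hx2, hx12]
  have hs : (fun r => if r = 0 then List.replicate l 0 else if r = 2 ∨ r = 12 then
      List.replicate 0 0 else [] : Store) = fun r => if r = 0 then List.replicate l 0 else [] := by
    funext r
    simp
  rw [hs] at h
  refine h.congr ?_ le_rfl
  funext r
  simp only [glue, List.replicate_zero]
  by_cases hr : r < 12
  · rw [if_pos hr]
    split_ifs <;> first | rfl | omega
  · rw [if_neg hr]
    split_ifs <;> first | rfl | omega

/-- The input is duplicated and the generator of A runs on the stacks from 12 on, so its output
lands on stack 13. Then q(l) is computed on stack 3, the new description is written in reverse on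
stack 4, and a final move puts it in order on stack 1. -/
theorem UniformQPT.prep {𝒢 : GateSet} (hH : 𝒢.Contains hadamard) (hC : 𝒢.Contains cnot) {n : ℕ → ℕ}
    {A : ∀ l, Circuit 𝒢 (Fin 1) (Fin (n l))} (hA : UniformQPT A) (q : Polynomial ℕ) :
    UniformQPT fun l => QInfo.prep hH hC (A l) (q.eval l) := by
  have hsize := hA.polyBounded_size
  obtain ⟨a, pre, post, hcode⟩ := exists_prep_code hH hC
  obtain ⟨P, T, hP⟩ := hA
  choose s₁ t₁ hexec ht₁ hs₁ using hP
  obtain ⟨E, CE, hCE, hE⟩ := exists_evalProg q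
  have hlen : ∀ l, (A l).code.length ≤ T.eval l := fun l => by
    have := (hexec l).length_le 1
    rw [hs₁, if_neg one_ne_zero, List.length_nil] at this
    exact this.trans (by have := ht₁ l; omega)
  have hcl : ∀ l, (A l).code.length = (A l).wires + ((codeWires (A l).inp).length +
      ((codeWires (A l).out).length + (((A l).gates.map Gate.code).flatten.length + 1) + 1) + 1) :=
    fun l => by simp only [Circuit.code, List.length_append, List.length_cons, List.length_replicate]
  have hT : PolyBounded fun l => T.eval l := PolyBounded.eval T
  let v : ℕ → Store := fun l r => if r = 2 then List.replicate l 0 else []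
  let s₂ : ℕ → Store := fun l =>
    Function.update (glue 12 (v l) (s₁ l)) 3 (List.replicate (q.eval l) 0)
  have hcfg : ∀ l, Cfg (s₂ l) (List.replicate (q.eval l) 0) [] [] [] []
      (List.replicate (A l).wires 0 ++ 2 :: (codeWires (A l).inp ++ 2 :: (codeWires (A l).out ++
        2 :: ((A l).gates.map Gate.code).flatten))) := fun l => by
    have h13 : s₁ l 1 = List.replicate (A l).wires 0 ++ 2 :: (codeWires (A l).inp ++ 2 ::
      (codeWires (A l).out ++ 2 :: ((A l).gates.map Gate.code).flatten)) := hs₁ l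
    constructor <;> simp [s₂, v, glue, h13]
  obtain ⟨C, hCb, hCd⟩ := exists_does_writePrep (K := 3 + 𝒢.card) (by omega) a pre post
    (hT.mono fun l => by have := hlen l; have := hcl l; omega) (PolyBounded.eval q)
    (hT.mono fun l => by have := hlen l; have := hcl l; omega)
    (hT.mono fun l => by have := hlen l; have := hcl l; omega)
    (hT.mono fun l => by have := hlen l; have := hcl l; omega) hcfg
    (fun l b hb => mem_codeWires _ hb) (fun l b hb => mem_codeWires _ hb)
    (fun l b hb => (A l).mem_code (by simp only [Circuit.code, List.mem_append, List.mem_cons, hb, or_true]))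
  have hCp : PolyBounded fun l => 4 * l + 1 + (T.eval l + (CE l + C l)) :=
    (((PolyBounded.const 4).mul PolyBounded.id).add (PolyBounded.const 1)).add
      (hT.add (hCE.add hCb))
  obtain ⟨T', hT'⟩ : PolyBounded fun l => 4 * l + 1 + (T.eval l + (CE l + C l)) +
      ((3 + 𝒢.card + 3) * (4 * l + 1 + (T.eval l + (CE l + C l))) + 1) :=
    hCp.add (((PolyBounded.const _).mul hCp).add (PolyBounded.const 1))
  refine ⟨.seq (.seq copyInput (.seq (P.shift 12) (.seq E (writePrep (3 + 𝒢.card) a pre post))))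
    (move (3 + 𝒢.card) 4 1), T', fun l => ?_⟩
  obtain ⟨s', hd, h1, h4⟩ := hCd l
  have d : Does (.seq copyInput (.seq (P.shift 12) (.seq E (writePrep (3 + 𝒢.card) a pre post))))
      (fun r => if r = 0 then List.replicate l 0 else []) s'
      (4 * l + 1 + (T.eval l + (CE l + C l))) :=
    (Does.copyInput l).seq (Does.seq ⟨t₁ l, ht₁ l, (hexec l).shift 12 (v l)⟩
      ((hE l _ (by simp [glue, v]) (by simp [glue, v]) (by simp [glue, v]) (by simp [glue, v])).seq
        hd))
  -- Stack 4 starts empty, so the running time so far bounds what the final move has to transfer.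
  have hlen4 : (s' 4).length ≤ 4 * l + 1 + (T.eval l + (CE l + C l)) := by
    obtain ⟨t, ht, he⟩ := d
    have := he.length_le 4
    simp only [OfNat.ofNat_ne_zero, if_false, List.length_nil] at this
    omega
  have hword : prepCode a pre post (A l).wires (q.eval l) (codeWires (A l).inp)
      (codeWires (A l).out) ((A l).gates.map Gate.code).flatten =
      (QInfo.prep hH hC (A l) (q.eval l)).code := (hcode (A l) (q.eval l)).symm
  obtain ⟨t, ht, he⟩ := d.seq ((Does.move (K := 3 + 𝒢.card) (r := 4) (d := 1) (by decide) s'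
    fun b hb => (QInfo.prep hH hC (A l) (q.eval l)).mem_code
      (by rw [← hword]; simpa [h4] using hb)).mono
      (Nat.add_le_add_right (Nat.mul_le_mul_left _ hlen4) 1))
  exact ⟨_, t, he, ht.trans (hT' l), by
    rw [Function.update_self, h1, h4, List.reverse_reverse, List.append_nil, hword]⟩

theorem UniformQPT.polyBounded_output {𝒢 : GateSet} {i o : ℕ → ℕ}
    {A : ∀ l, Circuit 𝒢 (Fin (i l)) (Fin (o l))} (hA : UniformQPT A) : PolyBounded o :=
  hA.polyBounded_size.mono fun l => by
    have h := Fintype.card_le_of_injective _ (A l).out.injective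
    rw [Fintype.card_fin, Fintype.card_fin] at h
    exact h.trans (Nat.le_add_left _ _)

end QInfo

end

/-! ### The theorem -/

theorem theorem3p1 (𝒢 : GateSet) (hH : 𝒢.Contains hadamard) (hCNOT : 𝒢.Contains cnot)
    (n : ℕ → ℕ) (ρ₀ ρ₁ : ∀ l, Op (Bits (n l))) (hEFI : IsEFI 𝒢 ρ₀ ρ₁) :
    -- some polynomial number of copies makes the pair exponentially far apart
    (∃ q : Polynomial ℕ, ∀ l : ℕ,
      1 - (1 / 2 : ℝ) ^ l ≤
        traceDist (tensorPow (q.eval l) (ρ₀ l)) (tensorPow (q.eval l) (ρ₁ l))) ∧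
    -- and for every such number of copies, the construction is pseudo-entangled
    ∀ q : Polynomial ℕ,
      (∀ l : ℕ, 1 - (1 / 2 : ℝ) ^ l ≤
        traceDist (tensorPow (q.eval l) (ρ₀ l)) (tensorPow (q.eval l) (ρ₁ l))) →
      ∀ (ε : ℕ → ℝ) (ψ φ : ∀ l, Op (Bits (q.eval l * n l + 1) × Bits 1)),
        (∀ l, ε l = (1 / 2 : ℝ) ^ l) →
        (∀ l, ψ l = psiState (tensorPow (q.eval l) (ρ₀ l)) (tensorPow (q.eval l) (ρ₁ l))) →
        (∀ l, φ l = phiState (tensorPow (q.eval l) (ρ₀ l)) (tensorPow (q.eval l) (ρ₁ l))) →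
        (∀ l, IsDensity (ψ l) ∧ IsDensity (φ l)) ∧
        PolyBounded (fun l => q.eval l * n l + 1 + 1) ∧
        -- `ψ` is separable, and free to create, even efficiently and without error
        (∀ l, IsSeparableState (ψ l)) ∧
        CompCostLE 𝒢 (fun _ => 0) ψ (fun _ => 0) ∧
        (∀ l, entCost 0 (ψ l) = 0) ∧
        (∀ E : EntFunctional, ∀ l,
          E (ε l) _ _ (ψ l) ≤ ((entCost (ε l) (ψ l) : ℕ∞) : ℝ≥0∞) → E (ε l) _ _ (ψ l) = 0) ∧
        -- one EPR pair can be distilled from `φ`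
        (∀ l, 1 ≤ distillable (ε l) (φ l)) ∧
        (∀ E : EntFunctional, ∀ l,
          ((distillable (ε l) (φ l) : ℕ∞) : ℝ≥0∞) ≤ E (ε l) _ _ (φ l) → 1 ≤ E (ε l) _ _ (φ l)) ∧
        -- polynomially many copies are computationally indistinguishable
        ManyCopyIndist 𝒢 ψ φ ∧
        -- both notions of pseudo-entanglement
        (∀ E : EntFunctional, IsEntMeasure E →
          IsPseudoEntEnsemble 𝒢 E ε (fun _ => 0) (fun _ => 1) ψ φ) ∧
        IsPseudoEntWith 𝒢 ε (fun _ => 0) (fun _ => 1) ψ φ := by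
  obtain ⟨A, hA, hA'⟩ := hEFI.generated
  have hn : PolyBounded n := hA.polyBounded_output
  refine ⟨exists_amplification hEFI.density hEFI.far, fun q hq ε ψ φ hε hψ hφ => ?_⟩
  obtain rfl : ε = fun l => (1 / 2 : ℝ) ^ l := funext hε
  obtain rfl : ψ = _ := funext hψ
  obtain rfl : φ = _ := funext hφ
  have hε0 : ∀ l : ℕ, 0 ≤ (1 / 2 : ℝ) ^ l := fun l => by positivity
  have hε1 : ∀ l : ℕ, (1 / 2 : ℝ) ^ l ≤ 1 := fun l => pow_le_one₀ (by norm_num) (by norm_num)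
  have hd : ∀ l, IsDensity (tensorPow (q.eval l) (ρ₀ l)) ∧ IsDensity (tensorPow (q.eval l) (ρ₁ l)) :=
    fun l => ⟨(hEFI.density l).1.tensorPow _, (hEFI.density l).2.tensorPow _⟩
  have hψd := fun l => psiState_isDensity (hd l).1 (hd l).2
  have hφd := fun l => phiState_isDensity (hd l).1 (hd l).2
  have hqn : PolyBounded fun l => q.eval l * n l := (PolyBounded.eval q).mul hn
  have hpoly : PolyBounded fun l => q.eval l * n l + 1 + 1 :=
    (hqn.add (PolyBounded.const 1)).add (PolyBounded.const 1)
  have hsep := fun l => psiState_isSeparable (hd l).1 (hd l).2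
  have hprep : ∀ l, (prep hH hCNOT (A l) (q.eval l)).apply 1 =
      joint (psiState (tensorPow (q.eval l) (ρ₀ l)) (tensorPow (q.eval l) (ρ₁ l))) := fun l => by
    rw [prep_apply, (hA' l).1, (hA' l).2]
  have huni := hA.prep hH hCNOT q
  have hcost : CompCostLE 𝒢 (fun _ => 0) (fun l => psiState (tensorPow (q.eval l) (ρ₀ l))
      (tensorPow (q.eval l) (ρ₁ l))) (fun _ => 0) :=
    compCostLE_psiState 𝒢 _ _ hd _ hprep huni.polyBounded_size
  have hzero : ∀ (ε : ℝ) (l : ℕ), 0 ≤ ε → entCost ε (psiState (tensorPow (q.eval l) (ρ₀ l))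
      (tensorPow (q.eval l) (ρ₁ l))) = 0 := fun ε l h =>
    entCost_eq_zero_of_separable h (hψd l) (hsep l)
  have hdist : ∀ l, 1 ≤ distillable ((1 / 2 : ℝ) ^ l) (phiState (tensorPow (q.eval l) (ρ₀ l))
      (tensorPow (q.eval l) (ρ₁ l))) := fun l => by
    -- The guarantee (1 + TD)/2 is at least 1 - 2^(-l)/2, within the allowed error.
    refine one_le_distillable_phiState (hd l).1 (hd l).2 ?_
    linarith [hq l, hε0 l]
  have hind : ManyCopyIndist 𝒢
      (fun l => psiState (tensorPow (q.eval l) (ρ₀ l)) (tensorPow (q.eval l) (ρ₁ l)))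
      (fun l => phiState (tensorPow (q.eval l) (ρ₀ l)) (tensorPow (q.eval l) (ρ₁ l))) :=
    -- Two hybrid arguments, over the q copies in ρ'_b and over the p copies of the result, around
    -- the passage from the pair to ψ and φ.
    fun p hp => ((hEFI.indist.tensorPow hn (fun l => (hEFI.density l).1)
      (fun l => (hEFI.density l).2) (PolyBounded.eval q)).psiState_phiState hqn).tensorPow hpoly
      (fun l => (hψd l).joint) (fun l => (hφd l).joint) hp
  refine ⟨fun l => ⟨hψd l, hφd l⟩, hpoly, hsep, hcost, fun l => hzero 0 l le_rfl,
    fun E l h => ?_, hdist, fun E l h => ?_, hind, fun E hE => ?_, ?_⟩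
  · rw [hzero _ l (hε0 l)] at h
    simpa using h
  · refine le_trans ?_ h
    exact_mod_cast ENat.toENNReal_le.2 (hdist l)
  · obtain ⟨ε₀, hε₀, hE⟩ := hE
    -- A measure is controlled only for errors up to ε₀, hence from some N on, which suffices for Θ.
    -- There ψ has value at most its cost 0, and φ lies between distillable entanglement at least 1
    -- and cost at most 1, so both constants can be 1.
    obtain ⟨N, hN⟩ := exists_pow_lt_of_lt_one hε₀ (show (1 / 2 : ℝ) < 1 by norm_num)
    have hlt : ∀ l, N ≤ l → (1 / 2 : ℝ) ^ l ≤ ε₀ := fun l hl =>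
      (pow_le_pow_of_le_one (by norm_num) (by norm_num) hl).trans hN.le
    refine ⟨fun l => ⟨hψd l, hφd l⟩, hpoly, ⟨_, huni, hprep⟩, ⟨1, 1, one_pos, N, fun l hl => ?_⟩,
      ⟨1, 1, one_pos, N, fun l hl => ?_⟩, hind⟩
    · have h := (hE _ (hε0 l) (hlt l hl) _ _ _ (hψd l)).2
      rw [hzero _ l (hε0 l)] at h
      simpa using h
    · have h := hE _ (hε0 l) (hlt l hl) _ _ _ (hφd l)
      have h1 := ENat.toENNReal_le.2 (hdist l)
      have h2 := ENat.toENNReal_le.2 (entCost_phiState_le (hε0 l) (hd l).1 (hd l).2)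
      simp only [ENat.toENNReal_one] at h1 h2
      simpa using And.intro (h1.trans h.1) (h.2.trans h2)
  · refine ⟨fun l => ⟨hε0 l, hε1 l⟩, fun l => ⟨hψd l, hφd l⟩, hpoly, ?_, fun l => ?_, hind⟩
    · obtain ⟨Γ, hΓ, h⟩ := hcost
      exact ⟨Γ, hΓ, fun l => le_trans (by simp) (h l)⟩
    · exact_mod_cast hdist l
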